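/- Work on $\mathbb{R}^3$ with complex-valued functions. Let $\dot H^1(\mathbb{R}^3)$ be the space of $u\in L^6(\mathbb{R}^3)$ with weak gradient $\nabla u\in L^2(\mathbb{R}^3)$, with norm $\|u\|_{\dot H^1}=\|\nabla u\|_{L^2}$. Let $W(x)=(1+|x|^2/3)^{-1/2}$ (which belongs to $\dot H^1$), $V_+=-5W^4$, $V_-=-W^4$, $\Lambda f=\tfrac12 f+x\cdot\nabla f$, and $\langle f,g\rangle=\operatorname{Re}\int_{\mathbb{R}^3} f\,\overline g\,dx$. For $\alpha>0$ let $$(-\Delta+\alpha)^{-1}f(x)=\int_{\mathbb{R}^3}\frac{e^{-\sqrt\alpha|x-y|}}{4\pi|x-y|}f(y)\,dy,$$ $$G(\alpha)^*f=\{1+V_+(-\Delta+\alpha)^{-1}\}\operatorname{Re}f-i\{1+V_-(-\Delta+\alpha)^{-1}\}\operatorname{Im}f .$$ For $y\in\mathbb{R}^3$, $\nu>0$, $\theta\in[-\pi,\pi)$ let $T_{(y,\nu,\theta)}[u](x)=\nu^{-1}e^{i\theta}u(\nu^{-2}x+y)$. For $\delta,r>0$ let $B_{\dot H^1}(W,\delta)=\{u\in\dot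 H^1:\|u-W\|_{\dot H^1}\le\delta\}$ and $B(\mathbf b_0,r)=\{(y,\nu,\theta)\in\mathbb{R}^3\times\mathbb{R}\times[-\pi,\pi):|y|+|\nu-1|+|\theta|<r\}$, where $\mathbf b_0=(0,1,0)$. **Theorem.** There exist $0<\delta_{\rm geo}<1$ and $0<r_{\rm geo}<\tfrac12$ such that for every $0<\alpha<1$ there is a unique continuous map $\mathbf b_\alpha\colon B_{\dot H^1}(W,\delta_{\rm geo})\to B(\mathbf b_0,r_{\rm geo})$ such that $\mathbf b_\alpha(W)=\mathbf b_0$ and, for every $u\in B_{\dot H^1}(W,\delta_{\rm geo})$, $$\langle T_{\mathbf b_\alpha(u)}[u]-W,\ G(\alpha)^*(V_+\partial_jW)\rangle=0\quad(1\le j\le3),$$ $$\langle T_{\mathbf b_\alpha(u)}[u]-W,\ G(\alpha)^*(V_+\Lambda W)\rangle=0,\qquad \langle T_{\mathbf b_\alpha(u)}[u]-W,\ G(\alpha)^*(iV_-W)\rangle=0,$$ where all the integrals defining these pairings converge absolutely. -/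

import Mathlib

open MeasureTheory
open scoped ContDiff ENNReal ComplexConjugate

noncomputable section

/-- Three-dimensional Euclidean space. -/
abbrev E3 : Type := EuclideanSpace ℝ (Fin 3)

/-- The `j`-th standard basis vector of `ℝ³`. -/
abbrev e3 (j : Fin 3) : E3 := EuclideanSpace.single j (1 : ℝ)

/-! ### The homogeneous Sobolev space `Ḣ¹(ℝ³)` of complex-valued functions -/

/-- `g` is the weak (distributional) `j`-th partial derivative of `u`. -/
def HasWeakPartial (j : Fin 3) (u g : E3 → ℂ) : Prop :=
  ∀ φ : E3 → ℝ, ContDiff ℝ ∞ φ → HasCompactSupport φ →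
    ∫ x, fderiv ℝ φ x (e3 j) • u x = -∫ x, φ x • g x

/-- The target of the gradient: `L²(ℝ³; ℂ)³`, with its Hilbert norm. -/
abbrev L2Fields : Type := PiLp 2 (fun _ : Fin 3 => Lp ℂ 2 (volume : Measure E3))

lemma integrable_test_smul {p : ℝ≥0∞} (hp : 1 ≤ p) (u : Lp ℂ p (volume : Measure E3))
    {φ : E3 → ℝ} (hφ : Continuous φ) (hc : HasCompactSupport φ) :
    Integrable (fun x => φ x • u x) :=
  ((Lp.memLp u).locallyIntegrable hp).integrable_smul_left_of_hasCompactSupport hφ hc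

lemma continuous_fderiv_e3 {φ : E3 → ℝ} (hφ : ContDiff ℝ ∞ φ) (j : Fin 3) :
    Continuous fun x => fderiv ℝ φ x (e3 j) :=
  (hφ.continuous_fderiv (by simp)).clm_apply continuous_const

/-- Pairs `(u, ∇u)` with `u ∈ L⁶` and weak gradient `∇u ∈ L²`. -/
def hdot1Submodule : Submodule ℂ (Lp ℂ 6 (volume : Measure E3) × L2Fields) where
  carrier := {p | ∀ j, HasWeakPartial j p.1 (p.2 j)}
  zero_mem' := by
    intro j φ _ _
    simp
  add_mem' := by
    intro p q hp hq j φ hφ hc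
    have hd := continuous_fderiv_e3 hφ j
    have hdc : HasCompactSupport fun x => fderiv ℝ φ x (e3 j) := hc.fderiv_apply (𝕜 := ℝ) _
    have h1 : ∫ x, fderiv ℝ φ x (e3 j) • (p.1 + q.1) x
        = (∫ x, fderiv ℝ φ x (e3 j) • p.1 x) + ∫ x, fderiv ℝ φ x (e3 j) • q.1 x := by
      rw [← integral_add (integrable_test_smul (by norm_num) p.1 hd hdc) (integrable_test_smul (by norm_num) q.1 hd hdc)]
      refine integral_congr_ae ?_
      filter_upwards [Lp.coeFn_add p.1 q.1] with x hx
      simp only [hx, Pi.add_apply, smul_add]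
    have h2 : ∫ x, φ x • (p.2 j + q.2 j) x
        = (∫ x, φ x • p.2 j x) + ∫ x, φ x • q.2 j x := by
      rw [← integral_add (integrable_test_smul (by norm_num) (p.2 j) hφ.continuous hc)
        (integrable_test_smul (by norm_num) (q.2 j) hφ.continuous hc)]
      refine integral_congr_ae ?_
      filter_upwards [Lp.coeFn_add (p.2 j) (q.2 j)] with x hx
      simp only [hx, Pi.add_apply, smul_add]
    have h3 := hp j φ hφ hc
    have h4 := hq j φ hφ hc
    simp only [Prod.fst_add, Prod.snd_add, PiLp.add_apply]
    rw [h1, h2, h3, h4, neg_add]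
  smul_mem' := by
    intro c p hp j φ hφ hc
    have h1 : ∫ x, fderiv ℝ φ x (e3 j) • (c • p.1) x
        = c * ∫ x, fderiv ℝ φ x (e3 j) • p.1 x := by
      rw [← integral_const_mul]
      refine integral_congr_ae ?_
      filter_upwards [Lp.coeFn_smul c p.1] with x hx
      simp only [hx, Pi.smul_apply, smul_eq_mul, mul_smul_comm]
    have h2 : ∫ x, φ x • (c • p.2 j) x = c * ∫ x, φ x • p.2 j x := by
      rw [← integral_const_mul]
      refine integral_congr_ae ?_
      filter_upwards [Lp.coeFn_smul c (p.2 j)] with x hx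
      simp only [hx, Pi.smul_apply, smul_eq_mul, mul_smul_comm]
    have h3 := hp j φ hφ hc
    simp only [Prod.smul_fst, Prod.smul_snd, PiLp.smul_apply]
    rw [h1, h2, h3, mul_neg]

/-- `Ḣ¹(ℝ³; ℂ)`: functions in `L⁶` with weak gradient in `L²` (an element carries its weak
gradient, which is determined by the function). -/
def Hdot1 : Type := hdot1Submodule

namespace Hdot1

instance : AddCommGroup Hdot1 := inferInstanceAs (AddCommGroup hdot1Submodule)

instance : Module ℂ Hdot1 := inferInstanceAs (Module ℂ hdot1Submodule)

/-- The underlying function (a representative of its class). -/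
def toFun (u : Hdot1) : E3 → ℂ := u.1.1

/-- The weak gradient, as a linear map into `L²(ℝ³; ℂ)³`. -/
def grad : Hdot1 →ₗ[ℂ] L2Fields :=
  (LinearMap.snd ℂ (Lp ℂ 6 (volume : Measure E3)) L2Fields).comp hdot1Submodule.subtype

/-- The norm of `Ḣ¹` is `‖u‖ = ‖∇u‖_{L²}`. -/
instance : SeminormedAddCommGroup Hdot1 :=
  SeminormedAddCommGroup.induced Hdot1 L2Fields grad

end Hdot1

/-! ### The Talenti function and the potentials -/

/-- The Talenti function `W(x) = (1 + |x|²/3)^{-1/2}` on `ℝ³`. -/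
def talenti (x : E3) : ℝ := (1 + ‖x‖ ^ 2 / 3) ^ (-(1 / 2) : ℝ)

/-- The classical partial derivative `∂_j f`. -/
def partialD (j : Fin 3) (f : E3 → ℝ) (x : E3) : ℝ := fderiv ℝ f x (e3 j)

/-- `Λ f = f / 2 + x · ∇f`. -/
def lam (f : E3 → ℝ) (x : E3) : ℝ := (1 / 2) * f x + fderiv ℝ f x x

/-- `V₊ = -5 W⁴`. -/
def Vplus (x : E3) : ℝ := -5 * talenti x ^ 4

/-- `V₋ = -W⁴`. -/
def Vminus (x : E3) : ℝ := -talenti x ^ 4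

lemma talenti_base_pos (x : E3) : 0 < 1 + ‖x‖ ^ 2 / 3 := by positivity

lemma hasFDerivAt_talenti (x : E3) :
    HasFDerivAt talenti
      ((-(1 / 3) * (1 + ‖x‖ ^ 2 / 3) ^ (-(3 / 2) : ℝ)) • innerSL ℝ x) x := by
  have h1 : HasFDerivAt (fun x : E3 => 1 + ‖x‖ ^ 2 / 3) ((1 / 3 : ℝ) • (2 • innerSL ℝ x)) x := by
    have h := ((hasStrictFDerivAt_norm_sq x).hasFDerivAt.const_mul (1 / 3 : ℝ)).const_add 1
    refine h.congr_of_eventuallyEq (Filter.Eventually.of_forall fun z => ?_)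
    simp only
    ring
  have h2 := h1.rpow_const (p := (-(1 / 2) : ℝ)) (Or.inl (talenti_base_pos x).ne')
  refine h2.congr_fderiv ?_
  ext v
  have : (-(1 / 2) - 1 : ℝ) = -(3 / 2) := by norm_num
  rw [this]
  simp
  ring

lemma partialD_talenti (j : Fin 3) (x : E3) :
    partialD j talenti x = -(1 / 3) * (1 + ‖x‖ ^ 2 / 3) ^ (-(3 / 2) : ℝ) * x j := by
  rw [partialD, (hasFDerivAt_talenti x).fderiv]
  simp [EuclideanSpace.inner_single_right]

lemma continuous_talenti : Continuous talenti :=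
  continuous_iff_continuousAt.2 fun x => (hasFDerivAt_talenti x).continuousAt

lemma continuous_partialD_talenti (j : Fin 3) : Continuous (partialD j talenti) := by
  have : partialD j talenti
      = fun x : E3 => -(1 / 3) * (1 + ‖x‖ ^ 2 / 3) ^ (-(3 / 2) : ℝ) * x j :=
    funext (partialD_talenti j)
  rw [this]
  refine (continuous_const.mul ?_).mul (by fun_prop)
  exact Continuous.rpow_const (by fun_prop) fun x => Or.inl (talenti_base_pos x).ne'

lemma integrable_japanese {r : ℝ} (hr : 3 < r) :
    Integrable fun x : E3 => (3 : ℝ) ^ (r / 2) * (1 + ‖x‖ ^ 2) ^ (-r / 2) :=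
  (integrable_rpow_neg_one_add_norm_sq (by simpa using hr)).const_mul _

lemma rpow_base_le (x : E3) {s : ℝ} (hs : 0 ≤ s) :
    (1 + ‖x‖ ^ 2 / 3) ^ (-s) ≤ (3 : ℝ) ^ s * (1 + ‖x‖ ^ 2) ^ (-s) := by
  have h : (1 + ‖x‖ ^ 2) / 3 ≤ 1 + ‖x‖ ^ 2 / 3 := by linarith
  calc (1 + ‖x‖ ^ 2 / 3) ^ (-s) ≤ ((1 + ‖x‖ ^ 2) / 3) ^ (-s) :=
        Real.rpow_le_rpow_of_nonpos (by positivity) h (by linarith)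
    _ = (3 : ℝ) ^ s * (1 + ‖x‖ ^ 2) ^ (-s) := by
        rw [Real.div_rpow (by positivity) (by norm_num), Real.rpow_neg (by norm_num : (0:ℝ) ≤ 3)]
        field_simp

lemma memLp_talenti : MemLp (fun x => (talenti x : ℂ)) 6 (volume : Measure E3) := by
  have hm : AEStronglyMeasurable (fun x => (talenti x : ℂ)) (volume : Measure E3) :=
    (Complex.continuous_ofReal.comp continuous_talenti).aestronglyMeasurable
  rw [← integrable_norm_rpow_iff hm (by norm_num) (by norm_num)]
  refine (integrable_japanese (r := 6) (by norm_num)).mono' (hm.norm.aemeasurable.pow_const _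
    |>.aestronglyMeasurable) (Filter.Eventually.of_forall fun x => ?_)
  have h := rpow_base_le x (s := 3) (by norm_num)
  have h0 : 0 ≤ (1 + ‖x‖ ^ 2 / 3 : ℝ) := (talenti_base_pos x).le
  have e : ‖(talenti x : ℂ)‖ ^ (6 : ℝ≥0∞).toReal = (1 + ‖x‖ ^ 2 / 3) ^ (-3 : ℝ) := by
    rw [Complex.norm_real, talenti, Real.norm_of_nonneg (Real.rpow_nonneg h0 _),
      ← Real.rpow_mul h0]
    norm_num
  rw [e, Real.norm_of_nonneg (Real.rpow_nonneg h0 _)]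
  convert h using 3 <;> norm_num

lemma memLp_partialD_talenti (j : Fin 3) :
    MemLp (fun x => (partialD j talenti x : ℂ)) 2 (volume : Measure E3) := by
  have hm : AEStronglyMeasurable (fun x => (partialD j talenti x : ℂ)) (volume : Measure E3) :=
    (Complex.continuous_ofReal.comp (continuous_partialD_talenti j)).aestronglyMeasurable
  rw [← integrable_norm_rpow_iff hm (by norm_num) (by norm_num)]
  refine (integrable_japanese (r := 4) (by norm_num)).mono' (hm.norm.aemeasurable.pow_const _
    |>.aestronglyMeasurable) (Filter.Eventually.of_forall fun x => ?_)
  have h := rpow_base_le x (s := 2) (by norm_num)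
  have hp := talenti_base_pos x
  have h0 : 0 ≤ (1 + ‖x‖ ^ 2 / 3 : ℝ) := hp.le
  have hx : (x j) ^ 2 ≤ ‖x‖ ^ 2 := by
    rw [EuclideanSpace.norm_sq_eq]
    have := Finset.single_le_sum (f := fun i => ‖x i‖ ^ 2) (fun i _ => by positivity)
      (Finset.mem_univ j)
    simpa using this
  have e : ‖(partialD j talenti x : ℂ)‖ ^ (2 : ℝ≥0∞).toReal ≤ (1 + ‖x‖ ^ 2 / 3) ^ (-2 : ℝ) := by
    have e1 : (1 + ‖x‖ ^ 2 / 3) ^ (-2 : ℝ)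
        = ((1 + ‖x‖ ^ 2 / 3) ^ (-(3 / 2) : ℝ)) ^ 2 * (1 + ‖x‖ ^ 2 / 3) := by
      rw [← Real.rpow_mul_natCast h0, ← Real.rpow_add_one hp.ne']
      norm_num
    have e2 : ‖(partialD j talenti x : ℂ)‖ ^ (2 : ℝ≥0∞).toReal = (partialD j talenti x) ^ 2 := by
      simp
    rw [e1, e2, partialD_talenti, mul_pow, mul_pow, mul_comm _ (((_ : ℝ) ^ (_ : ℝ)) ^ 2), mul_assoc]
    refine mul_le_mul_of_nonneg_left ?_ (by positivity)
    nlinarith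
  rw [Real.norm_of_nonneg (by positivity)]
  refine e.trans ?_
  have e3' : (-4 / 2 : ℝ) = -2 := by norm_num
  have e4 : (4 / 2 : ℝ) = 2 := by norm_num
  rw [e3', e4]
  exact h

lemma hasWeakPartial_talenti (j : Fin 3) :
    HasWeakPartial j (memLp_talenti.toLp _) ((memLp_partialD_talenti j).toLp _) := by
  intro φ hφ hc
  have hd := continuous_fderiv_e3 hφ j
  have hdc : HasCompactSupport fun x => fderiv ℝ φ x (e3 j) := hc.fderiv_apply (𝕜 := ℝ) _
  have a1 : ∫ x, fderiv ℝ φ x (e3 j) • (memLp_talenti.toLp _ : Lp ℂ 6 (volume : Measure E3)) x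
      = ((∫ x, talenti x * fderiv ℝ φ x (e3 j) : ℝ) : ℂ) := by
    rw [← integral_complex_ofReal]
    refine integral_congr_ae ?_
    filter_upwards [memLp_talenti.coeFn_toLp] with x hx
    rw [hx, Complex.real_smul]
    push_cast
    ring
  have a2 : ∫ x, φ x • ((memLp_partialD_talenti j).toLp _ : Lp ℂ 2 (volume : Measure E3)) x
      = ((∫ x, fderiv ℝ talenti x (e3 j) * φ x : ℝ) : ℂ) := by
    rw [← integral_complex_ofReal]
    refine integral_congr_ae ?_
    filter_upwards [(memLp_partialD_talenti j).coeFn_toLp] with x hx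
    rw [hx, Complex.real_smul, partialD]
    push_cast
    ring
  rw [a1, a2, ← Complex.ofReal_neg]
  congr 1
  refine integral_mul_fderiv_eq_neg_fderiv_mul_of_integrable ?_ ?_ ?_
    (fun x _ => (hasFDerivAt_talenti x).differentiableAt)
    (fun x _ => (hφ.differentiable (by simp)).differentiableAt)
  · exact ((continuous_partialD_talenti j).mul hφ.continuous).integrable_of_hasCompactSupport
      hc.mul_left
  · exact (continuous_talenti.mul hd).integrable_of_hasCompactSupport hdc.mul_left
  · exact (continuous_talenti.mul hφ.continuous).integrable_of_hasCompactSupport hc.mul_left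

/-- The Talenti function as an element of `Ḣ¹`, with its classical gradient. -/
def talentiH : Hdot1 :=
  ⟨(memLp_talenti.toLp _, WithLp.toLp 2 fun j => (memLp_partialD_talenti j).toLp _),
    hasWeakPartial_talenti⟩

/-! ### The operators -/

/-- The resolvent `(-Δ + α)⁻¹` on `ℝ³`, through its (Yukawa) kernel
`e^{-√α |x-y|} / (4π |x-y|)`. -/
def resolvent3 (α : ℝ) (f : E3 → ℝ) (x : E3) : ℝ :=
  ∫ y, Real.exp (-√α * ‖x - y‖) / (4 * Real.pi * ‖x - y‖) * f y

/-- `G(α)^* f = {1 + V₊(-Δ+α)⁻¹} Re f - i {1 + V₋(-Δ+α)⁻¹} Im f`. -/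
def Gstar (α : ℝ) (f : E3 → ℂ) (x : E3) : ℂ :=
  (((f x).re + Vplus x * resolvent3 α (fun y => (f y).re) x : ℝ) : ℂ)
    - Complex.I * (((f x).im + Vminus x * resolvent3 α (fun y => (f y).im) x : ℝ) : ℂ)

/-- `T_{(y,ν,θ)}[u](x) = ν⁻¹ e^{iθ} u(ν⁻² x + y)`. -/
def transf (b : E3 × ℝ × ℝ) (u : E3 → ℂ) (x : E3) : ℂ :=
  ((b.2.1⁻¹ : ℝ) : ℂ) * Complex.exp (Complex.I * b.2.2) * u ((b.2.1 ^ 2)⁻¹ • x + b.1)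

/-- `B((0,1,0), r)`: the parameters `(y,ν,θ) ∈ ℝ³ × ℝ × [-π,π)` with `|y|+|ν-1|+|θ| < r`. -/
def paramBall (r : ℝ) : Set (E3 × ℝ × ℝ) :=
  {b | b.2.2 ∈ Set.Ico (-Real.pi) Real.pi ∧ ‖b.1‖ + |b.2.1 - 1| + |b.2.2| < r}

/-- `⟨f, g⟩ = Re ∫ f \bar g` is an absolutely convergent integral and vanishes. -/
def PairsToZero (f g : E3 → ℂ) : Prop :=
  Integrable (fun x => f x * conj (g x)) ∧ (∫ x, f x * conj (g x)).re = 0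

end

/-! The functions `∂_j W` and `ΛW` solve `Δf = V₊ f`, and `W` solves `ΔW = V₋ W`. For such an `f`,
with its potential `V`, the adjoint operator produces `V · (f + (-Δ+α)⁻¹ Δf)`. Since the Newton
potential of `Δf` is `-f` (`DecayingLap.integral_inv_norm_mul_lap`), the singular part of the Yukawa
kernel cancels `f`. What is left is `-(√α / 4π)` times the potential of `V f` with the bounded
kernel `k_a(r) = (1 - e^{-ar}) / (ar)`, `a = √α` (`DecayingLap.add_resolvent3`). The scalar in front
degenerates as `α → 0`, but an orthogonality condition does not see it. For the translations `V₊ ∂_j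
W` has mean zero, so its potential is itself `O(a)` and a second factor `a` can be divided out. The
five remaining test profiles decay like `(1+|x|)⁻⁴` and are Lipschitz in a weighted sense, uniformly
in `0 < a ≤ 1` (`exists_profileBound`).

The theorem is now an implicit function theorem whose constants must not depend on `α`. At the
neutral parameter the derivatives of `b ↦ T_b W` are `∂_j W`, `-2ΛW` and `iW`. Tested against the
profiles they form a diagonal matrix: reflections kill the cross terms among translations and
scaling, and the phase is separated by real and imaginary parts. Each diagonal entry is a quadratic
form of `k_a`, and these are bounded below uniformly (`exists_le_diagonal`), for two different
reasons. For scaling and phase, `k_a` is an average of exponentials, exponentials are mixtures of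
Gaussians, and Gaussians are positive definite; as `a → 0` the form tends to the squared mean, which
is nonzero (`exists_le_kernelForm_expKernel`). For translations the mean vanishes, but the densities
are odd, and reflecting one variable turns the form into the integral of a nonnegative function. It
dominates `a` times its value at `a = 1` (`mul_kernelForm_odd_le`), which offsets the division by
`a`.

A general `u` in `Ḣ¹` is too rough to differentiate `T_b u` in `b`. A change of variables therefore
puts `b` on the profile, and only the size of `u` in `L¹((1+|x|)⁻³ dx)` matters. Sobolev and Hölder
bound it by the `Ḣ¹` norm (`exists_integral_norm_mul_wt_le`). Writing `u = W + (u - W)`, the first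
term is linearized and the second is a small Lipschitz perturbation
(`exists_profilePairing_bounds`). After normalization by the diagonal entries the pairings are a
perturbation of the identity in `b`, and `exists_continuous_zero` gives the unique zero and its
continuity. -/

noncomputable section

open Filter Topology Set

/-! ### Polynomial weights on `ℝ³` -/

/-- The weight `(1 + |x|)⁻¹`. -/
def wt (x : E3) : ℝ := (1 + ‖x‖)⁻¹

lemma wt_pos (x : E3) : 0 < wt x := by unfold wt; positivity

lemma wt_nonneg (x : E3) : 0 ≤ wt x := (wt_pos x).le

lemma wt_le_one (x : E3) : wt x ≤ 1 := by
  unfold wt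
  exact inv_le_one_of_one_le₀ (by linarith [norm_nonneg x])

lemma continuous_wt : Continuous wt := by
  unfold wt
  exact Continuous.inv₀ (by fun_prop) fun x => by positivity

lemma wt_pow_le {m n : ℕ} (h : m ≤ n) (x : E3) : wt x ^ n ≤ wt x ^ m :=
  pow_le_pow_of_le_one (wt_nonneg x) (wt_le_one x) h

lemma wt_add_le (x y : E3) : wt (x + y) ≤ (1 + ‖y‖) * wt x := by
  unfold wt
  rw [← div_eq_mul_inv, inv_eq_one_div, div_le_div_iff₀ (by positivity) (by positivity)]
  have h : ‖x‖ ≤ ‖x + y‖ + ‖y‖ := by simpa using norm_sub_le (x + y) y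
  nlinarith [norm_nonneg y, norm_nonneg (x + y)]

/-- Four is the least integer exponent above the dimension, which is why decay of order four recurs
below. -/
lemma integrable_wt_pow {n : ℕ} (hn : 4 ≤ n) : Integrable fun x : E3 => wt x ^ n := by
  have h := integrable_one_add_norm (E := E3) (μ := volume) (r := (n : ℝ))
    (by simp only [finrank_euclideanSpace, Fintype.card_fin]; exact_mod_cast hn)
  refine h.congr (Eventually.of_forall fun x => ?_)
  simp only [wt]
  rw [Real.rpow_neg (by positivity), Real.rpow_natCast, inv_pow]

lemma integrable_of_le_wt {F : Type*} [NormedAddCommGroup F] {f : E3 → F} {n : ℕ} (hn : 4 ≤ n)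
    (hf : AEStronglyMeasurable f) {C : ℝ} (h : ∀ x, ‖f x‖ ≤ C * wt x ^ n) : Integrable f :=
  ((integrable_wt_pow hn).const_mul C).mono' hf (Eventually.of_forall h)

/-! ### Cutoff functions and the divergence theorem on the whole space -/

/-- A fixed smooth bump function, equal to one on the unit ball. -/
def unitBump : ContDiffBump (0 : E3) := ⟨1, 2, one_pos, one_lt_two⟩

/-- The dilated cutoff `χ(x / (n + 1))`. -/
def cutoff (n : ℕ) (x : E3) : ℝ := unitBump (((n : ℝ) + 1)⁻¹ • x)

lemma contDiff_cutoff (n : ℕ) : ContDiff ℝ ∞ (cutoff n) :=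
  unitBump.contDiff.comp (contDiff_const_smul _)

lemma cutoff_nonneg (n : ℕ) (x : E3) : 0 ≤ cutoff n x := unitBump.nonneg

lemma cutoff_le_one (n : ℕ) (x : E3) : cutoff n x ≤ 1 := unitBump.le_one

lemma cutoff_eq_one {n : ℕ} {x : E3} (hx : ‖x‖ ≤ n + 1) : cutoff n x = 1 := by
  refine unitBump.one_of_mem_closedBall ?_
  have : (0 : ℝ) < n + 1 := by positivity
  rw [mem_closedBall_zero_iff, norm_smul, norm_inv, Real.norm_of_nonneg this.le,
    inv_mul_le_iff₀ this]
  simpa [unitBump] using hx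

lemma cutoff_eq_zero {n : ℕ} {x : E3} (hx : 2 * ((n : ℝ) + 1) ≤ ‖x‖) : cutoff n x = 0 := by
  refine unitBump.zero_of_le_dist ?_
  have : (0 : ℝ) < n + 1 := by positivity
  rw [dist_zero_right, norm_smul, norm_inv, Real.norm_of_nonneg this.le, le_inv_mul_iff₀ this]
  simpa [unitBump, mul_comm] using hx

lemma hasCompactSupport_cutoff (n : ℕ) : HasCompactSupport (cutoff n) := by
  refine HasCompactSupport.of_support_subset_isCompact
    (isCompact_closedBall (0 : E3) (2 * ((n : ℝ) + 1))) fun x hx => ?_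
  rw [mem_closedBall_zero_iff]
  by_contra h
  exact hx (cutoff_eq_zero (not_le.1 h).le)

lemma tendsto_cutoff (x : E3) : Tendsto (fun n => cutoff n x) atTop (𝓝 1) := by
  refine tendsto_const_nhds.congr' ?_
  obtain ⟨N, hN⟩ := exists_nat_ge ‖x‖
  filter_upwards [eventually_ge_atTop N] with n hn
  refine (cutoff_eq_one ?_).symm
  have : (N : ℝ) ≤ n := by exact_mod_cast hn
  linarith

lemma fderiv_cutoff_eq_zero_of_lt {n : ℕ} {x : E3} (hx : ‖x‖ < n + 1) :
    fderiv ℝ (cutoff n) x = 0 := by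
  have : cutoff n =ᶠ[𝓝 x] fun _ => 1 := by
    filter_upwards [(isOpen_lt continuous_norm continuous_const).mem_nhds hx] with y hy
    exact cutoff_eq_one (le_of_lt hy)
  rw [this.fderiv_eq]
  simp

lemma fderiv_cutoff_eq_zero_of_gt {n : ℕ} {x : E3} (hx : 2 * ((n : ℝ) + 1) < ‖x‖) :
    fderiv ℝ (cutoff n) x = 0 := by
  have : cutoff n =ᶠ[𝓝 x] fun _ => 0 := by
    filter_upwards [(isOpen_lt continuous_const continuous_norm).mem_nhds hx] with y hy
    exact cutoff_eq_zero (le_of_lt hy)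
  rw [this.fderiv_eq]
  simp

lemma exists_norm_fderiv_cutoff_le :
    ∃ C : ℝ, 0 ≤ C ∧ ∀ n x, ‖fderiv ℝ (cutoff n) x‖ ≤ C * ((n : ℝ) + 1)⁻¹ := by
  have hc : Continuous (fderiv ℝ (unitBump : E3 → ℝ)) :=
    (unitBump.contDiff (n := 1)).continuous_fderiv (by simp)
  obtain ⟨C, hC⟩ := (unitBump.hasCompactSupport.fderiv (𝕜 := ℝ)).exists_bound_of_continuous hc
  refine ⟨C, (norm_nonneg _).trans (hC 0), fun n x => ?_⟩
  have h1 : HasFDerivAt (cutoff n) ((fderiv ℝ unitBump (((n : ℝ) + 1)⁻¹ • x)).comp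
      (((n : ℝ) + 1)⁻¹ • ContinuousLinearMap.id ℝ E3)) x :=
    HasFDerivAt.comp x
      ((unitBump.contDiff (n := 1)).differentiable (by simp) _).hasFDerivAt
      ((((n : ℝ) + 1)⁻¹ • ContinuousLinearMap.id ℝ E3).hasFDerivAt)
  rw [h1.fderiv, ContinuousLinearMap.comp_smul, ContinuousLinearMap.comp_id, norm_smul, norm_inv,
    Real.norm_of_nonneg (by positivity), mul_comm]
  gcongr
  exact hC _

/-- The gradient of the cutoff vanishes for `|x| > 2(n+1)`, and on the rest `1/(n+1)` is at most a
multiple of `wt`. This gives a dominating function independent of `n`. -/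
lemma exists_norm_fderiv_cutoff_le_wt :
    ∃ C : ℝ, 0 ≤ C ∧ ∀ n x, ‖fderiv ℝ (cutoff n) x‖ ≤ C * wt x := by
  obtain ⟨C, hC0, hC⟩ := exists_norm_fderiv_cutoff_le
  refine ⟨3 * C, by positivity, fun n x => ?_⟩
  by_cases hx : 2 * ((n : ℝ) + 1) < ‖x‖
  · rw [fderiv_cutoff_eq_zero_of_gt hx, norm_zero]
    have := wt_nonneg x
    positivity
  · refine (hC n x).trans ?_
    have : ((n : ℝ) + 1)⁻¹ ≤ 3 * wt x := by
      unfold wt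
      rw [← div_eq_mul_inv, inv_eq_one_div, div_le_div_iff₀ (by positivity) (by positivity)]
      linarith
    nlinarith

lemma abs_clm_e3_le (L : E3 →L[ℝ] ℝ) (j : Fin 3) : |L (e3 j)| ≤ ‖L‖ := by
  simpa using L.le_opNorm (e3 j)

/-- The integral of a divergence vanishes when the field is `o(|x|⁻²)` in the integrated sense. -/
theorem integral_divergence_eq_zero {Φ : Fin 3 → E3 → ℝ} (hΦ : ∀ j, ContDiff ℝ 1 (Φ j))
    (hint : ∀ j, Integrable fun x => wt x * Φ j x)
    (hD : Integrable fun x => ∑ j, fderiv ℝ (Φ j) x (e3 j)) :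
    ∫ x, ∑ j, fderiv ℝ (Φ j) x (e3 j) = 0 := by
  have hcont : ∀ j, Continuous fun x => fderiv ℝ (Φ j) x (e3 j) := fun j =>
    ((hΦ j).continuous_fderiv (by simp)).clm_apply continuous_const
  have hχc : ∀ n, Continuous (cutoff n) := fun n => (contDiff_cutoff n).continuous
  have hχd : ∀ n j, Continuous fun x => fderiv ℝ (cutoff n) x (e3 j) := fun n j =>
    continuous_fderiv_e3 (contDiff_cutoff n) j
  have hχs : ∀ n j, HasCompactSupport fun x => fderiv ℝ (cutoff n) x (e3 j) := fun n j =>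
    (hasCompactSupport_cutoff n).fderiv_apply (𝕜 := ℝ) _
  have key : ∀ n, ∫ x, cutoff n x * ∑ j, fderiv ℝ (Φ j) x (e3 j)
      = -∑ j, ∫ x, fderiv ℝ (cutoff n) x (e3 j) * Φ j x := by
    intro n
    simp_rw [Finset.mul_sum]
    have hi : ∀ j, Integrable fun x => cutoff n x * fderiv ℝ (Φ j) x (e3 j) := fun j =>
      ((hχc n).mul (hcont j)).integrable_of_hasCompactSupport (hasCompactSupport_cutoff n).mul_right
    rw [integral_finsetSum _ fun j _ => hi j, ← Finset.sum_neg_distrib]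
    refine Finset.sum_congr rfl fun j _ => ?_
    refine integral_mul_fderiv_eq_neg_fderiv_mul_of_integrable ?_ ?_ ?_
      (fun x _ => (contDiff_cutoff n).differentiable (by simp) x)
      (fun x _ => (hΦ j).differentiable (by simp) x)
    · exact ((hχd n j).mul (hΦ j).continuous).integrable_of_hasCompactSupport (hχs n j).mul_right
    · exact hi j
    · exact ((hχc n).mul (hΦ j).continuous).integrable_of_hasCompactSupport
        (hasCompactSupport_cutoff n).mul_right
  have l1 : Tendsto (fun n => ∫ x, cutoff n x * ∑ j, fderiv ℝ (Φ j) x (e3 j)) atTop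
      (𝓝 (∫ x, ∑ j, fderiv ℝ (Φ j) x (e3 j))) := by
    refine tendsto_integral_of_dominated_convergence
      (fun x => ‖∑ j, fderiv ℝ (Φ j) x (e3 j)‖)
      (fun n => ((hχc n).mul (continuous_finsetSum _ fun j _ => hcont j)).aestronglyMeasurable)
      hD.norm (fun n => Eventually.of_forall fun x => ?_) (Eventually.of_forall fun x => ?_)
    · rw [norm_mul, Real.norm_of_nonneg (cutoff_nonneg n x)]
      exact mul_le_of_le_one_left (norm_nonneg _) (cutoff_le_one n x)
    · simpa using (tendsto_cutoff x).mul_const (∑ j, fderiv ℝ (Φ j) x (e3 j))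
  obtain ⟨C, hC0, hC⟩ := exists_norm_fderiv_cutoff_le
  obtain ⟨C', hC'0, hC'⟩ := exists_norm_fderiv_cutoff_le_wt
  -- The boundary term tends to zero pointwise because `∇χ_n = O(1/n)`, and it is dominated by a
  -- multiple of `wt |Φ|`.
  have l2 : ∀ j, Tendsto (fun n => ∫ x, fderiv ℝ (cutoff n) x (e3 j) * Φ j x) atTop (𝓝 0) := by
    intro j
    rw [← integral_zero E3 ℝ (μ := volume)]
    refine tendsto_integral_of_dominated_convergence (fun x => C' * ‖wt x * Φ j x‖)
      (fun n => ((hχd n j).mul (hΦ j).continuous).aestronglyMeasurable)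
      ((hint j).norm.const_mul C') (fun n => Eventually.of_forall fun x => ?_)
      (Eventually.of_forall fun x => ?_)
    · rw [norm_mul, norm_mul, ← mul_assoc, Real.norm_of_nonneg (wt_nonneg x)]
      gcongr
      exact (abs_clm_e3_le _ j).trans (hC' n x)
    · have h0 : Tendsto (fun n : ℕ => C * ((n : ℝ) + 1)⁻¹ * |Φ j x|) atTop (𝓝 0) := by
        have := tendsto_one_div_add_atTop_nhds_zero_nat (𝕜 := ℝ)
        simpa [one_div] using (this.const_mul C).mul_const |Φ j x|
      refine squeeze_zero_norm (fun n => ?_) h0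
      rw [norm_mul]
      exact mul_le_mul_of_nonneg_right ((abs_clm_e3_le _ j).trans (hC n x)) (abs_nonneg _)
  have l3 : Tendsto (fun n => ∫ x, cutoff n x * ∑ j, fderiv ℝ (Φ j) x (e3 j)) atTop (𝓝 0) := by
    simp_rw [key]
    simpa using (tendsto_finsetSum Finset.univ fun j _ => l2 j).neg
  exact tendsto_nhds_unique l1 l3

/-! ### The Talenti function: algebra and derivatives -/

lemma talenti_pos (x : E3) : 0 < talenti x := Real.rpow_pos_of_pos (talenti_base_pos x) _

/-- This relation eliminates `|x|²` in favour of `W`, so the differential identities for `W` below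
become polynomial identities. -/
lemma talenti_sq_mul (x : E3) : talenti x ^ 2 * (1 + ‖x‖ ^ 2 / 3) = 1 := by
  have h := talenti_base_pos x
  rw [talenti, ← Real.rpow_mul_natCast h.le, ← Real.rpow_add_one h.ne']
  norm_num

lemma talenti_cube (x : E3) : (1 + ‖x‖ ^ 2 / 3) ^ (-(3 / 2) : ℝ) = talenti x ^ 3 := by
  rw [talenti, ← Real.rpow_mul_natCast (talenti_base_pos x).le]
  norm_num

lemma talenti_le_one (x : E3) : talenti x ≤ 1 := by
  have h1 := talenti_sq_mul x
  have h2 := talenti_pos x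
  nlinarith [sq_nonneg ‖x‖, mul_nonneg (sq_nonneg (talenti x)) (sq_nonneg ‖x‖)]

lemma talenti_mul_norm_le (x : E3) : talenti x * ‖x‖ ≤ 2 := by
  have h1 := talenti_sq_mul x
  have h2 := talenti_pos x
  nlinarith [mul_nonneg h2.le (norm_nonneg x), sq_nonneg (talenti x)]

lemma talenti_le_wt (x : E3) : talenti x ≤ 3 * wt x := by
  unfold wt
  rw [← div_eq_mul_inv, le_div_iff₀ (by positivity)]
  linarith [talenti_le_one x, talenti_mul_norm_le x]

lemma talenti_pow_le_wt (n : ℕ) (x : E3) : talenti x ^ n ≤ 3 ^ n * wt x ^ n := by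
  rw [← mul_pow]
  exact pow_le_pow_left₀ (talenti_pos x).le (talenti_le_wt x) n

lemma sum_coord_sq (x : E3) : ∑ j, x j ^ 2 = ‖x‖ ^ 2 := by
  rw [EuclideanSpace.norm_sq_eq]
  simp

lemma abs_coord_le (x : E3) (j : Fin 3) : |x j| ≤ ‖x‖ := by
  simpa using PiLp.norm_apply_le x j

lemma contDiff_talenti {n : ℕ∞} : ContDiff ℝ n talenti := by
  unfold talenti
  refine ContDiff.rpow_const_of_ne ?_ fun x => (talenti_base_pos x).ne'
  exact contDiff_const.add ((contDiff_norm_sq ℝ).div_const _)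

lemma hasFDerivAt_talenti' (x : E3) :
    HasFDerivAt talenti ((-(1 / 3) * talenti x ^ 3) • innerSL ℝ x) x := by
  rw [← talenti_cube]
  exact hasFDerivAt_talenti x

lemma hasFDerivAt_talenti_pow (n : ℕ) (x : E3) :
    HasFDerivAt (fun x => talenti x ^ (n + 1))
      ((-((n + 1 : ℝ) / 3) * talenti x ^ (n + 3)) • innerSL ℝ x) x := by
  refine ((hasFDerivAt_talenti' x).pow (n + 1)).congr_fderiv ?_
  ext v
  simp
  ring

lemma partialD_talenti' (j : Fin 3) (x : E3) :
    partialD j talenti x = -(1 / 3) * talenti x ^ 3 * x j := by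
  rw [partialD_talenti, talenti_cube]

lemma talenti_cube_mul_norm_sq (x : E3) :
    talenti x ^ 3 * ‖x‖ ^ 2 = 3 * (talenti x - talenti x ^ 3) := by
  linear_combination 3 * talenti x * talenti_sq_mul x

lemma lam_talenti (x : E3) : lam talenti x = talenti x ^ 3 - 1 / 2 * talenti x := by
  rw [lam, (hasFDerivAt_talenti' x).fderiv]
  simp
  linear_combination (-1 / 3) * talenti_cube_mul_norm_sq x

lemma hasFDerivAt_coord (j : Fin 3) (x : E3) :
    HasFDerivAt (fun x : E3 => x j) (EuclideanSpace.proj j : E3 →L[ℝ] ℝ) x :=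
  (EuclideanSpace.proj j : E3 →L[ℝ] ℝ).hasFDerivAt

lemma contDiff_coord {n : ℕ∞} (j : Fin 3) : ContDiff ℝ n fun x : E3 => x j :=
  (EuclideanSpace.proj j : E3 →L[ℝ] ℝ).contDiff

/-! ### Newton potentials of Laplacians of decaying functions -/

/-- `f` is a decaying function with partial derivatives `f' j` and Laplacian `ψ`. -/
structure DecayingLap (f : E3 → ℝ) (f' : Fin 3 → E3 → ℝ) (ψ : E3 → ℝ) : Prop where
  contDiff : ContDiff ℝ 1 f
  contDiff' : ∀ j, ContDiff ℝ 1 (f' j)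
  partial_eq : ∀ j x, fderiv ℝ f x (e3 j) = f' j x
  lap_eq : ∀ x, ∑ j, fderiv ℝ (f' j) x (e3 j) = ψ x
  bound : ∃ C, 0 ≤ C ∧ ∀ x, |f x| ≤ C * wt x ∧ (∀ j, |f' j x| ≤ C * wt x ^ 2) ∧
    |ψ x| ≤ C * wt x ^ 4

namespace DecayingLap

variable {f g : E3 → ℝ} {f' g' : Fin 3 → E3 → ℝ} {ψ χ : E3 → ℝ}

lemma continuous_lap (h : DecayingLap f f' ψ) : Continuous ψ := by
  rw [← funext h.lap_eq]
  exact continuous_finsetSum _ fun j _ =>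
    ((h.contDiff' j).continuous_fderiv (by simp)).clm_apply continuous_const

/-- The constant may depend on the scale and the centre: it only justifies Green's identity at each
fixed scale, never a limit. -/
lemma exists_wt_comp_le {c : ℝ} (hc : 0 < c) (x : E3) :
    ∃ M, 0 ≤ M ∧ ∀ y, wt (c • (y - x)) ≤ M * wt y := by
  refine ⟨(1 + c⁻¹) * (1 + ‖x‖), by positivity, fun y => ?_⟩
  have h1 : wt (c • (y - x)) ≤ (1 + c⁻¹) * wt (y - x) := by
    unfold wt
    rw [← div_eq_mul_inv, inv_eq_one_div, div_le_div_iff₀ (by positivity) (by positivity),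
      norm_smul, Real.norm_of_nonneg hc.le]
    have : c⁻¹ * c = 1 := inv_mul_cancel₀ hc.ne'
    have h3 : 0 < c⁻¹ := inv_pos.2 hc
    have h4 := norm_nonneg (y - x)
    nlinarith [mul_nonneg hc.le h4]
  have h2 : wt (y - x) ≤ (1 + ‖x‖) * wt y := by
    simpa [sub_eq_add_neg] using wt_add_le y (-x)
  calc wt (c • (y - x)) ≤ (1 + c⁻¹) * wt (y - x) := h1
    _ ≤ (1 + c⁻¹) * ((1 + ‖x‖) * wt y) := by gcongr
    _ = _ := by ring

lemma fderiv_comp_affine {F : E3 → ℝ} (hF : ContDiff ℝ 1 F) (a c : ℝ) (x y v : E3) :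
    fderiv ℝ (fun y => a * F (c • (y - x))) y v = a * c * fderiv ℝ F (c • (y - x)) v := by
  have h1 : HasFDerivAt (fun y : E3 => c • (y - x)) (c • ContinuousLinearMap.id ℝ E3) y :=
    ((hasFDerivAt_id y).sub_const x).const_smul c
  have h2 := (((hF.differentiable (by simp) (c • (y - x))).hasFDerivAt.comp y h1).const_mul a)
  have h3 : HasFDerivAt (fun y => a * F (c • (y - x)))
    (a • (fderiv ℝ F (c • (y - x))).comp (c • ContinuousLinearMap.id ℝ E3)) y := h2
  rw [h3.fderiv]
  simp
  ring

/-- With this normalization the Laplacian `c³ ψ(c(y - x))` keeps its integral and concentrates at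
`x` as `c → ∞`. Applied to the bubble, it gives smooth approximations of the Newton kernel. -/
lemma comp_affine (h : DecayingLap f f' ψ) {c : ℝ} (hc : 0 < c) (x : E3) :
    DecayingLap (fun y => c * f (c • (y - x))) (fun j y => c ^ 2 * f' j (c • (y - x)))
      (fun y => c ^ 3 * ψ (c • (y - x))) where
  contDiff := contDiff_const.mul (h.contDiff.comp (by fun_prop))
  contDiff' j := contDiff_const.mul ((h.contDiff' j).comp (by fun_prop))
  partial_eq j y := by
    rw [fderiv_comp_affine h.contDiff, h.partial_eq]
    ring
  lap_eq y := by
    simp_rw [fderiv_comp_affine (h.contDiff' _), ← h.lap_eq, Finset.mul_sum]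
    ring_nf
  bound := by
    obtain ⟨C, hC0, hC⟩ := h.bound
    obtain ⟨M, hM0, hM⟩ := exists_wt_comp_le hc x
    refine ⟨c * C * M + c ^ 2 * C * M ^ 2 + c ^ 3 * C * M ^ 4, by positivity, fun y => ?_⟩
    have hw := wt_nonneg y
    have hp : ∀ n : ℕ, wt (c • (y - x)) ^ n ≤ M ^ n * wt y ^ n := fun n => by
      rw [← mul_pow]
      exact pow_le_pow_left₀ (wt_nonneg _) (hM y) n
    obtain ⟨h1, h2, h3⟩ := hC (c • (y - x))
    refine ⟨?_, fun j => ?_, ?_⟩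
    · rw [abs_mul, abs_of_pos hc]
      calc c * |f (c • (y - x))| ≤ c * (C * (M * wt y)) := by
            gcongr
            exact h1.trans (mul_le_mul_of_nonneg_left (hM y) hC0)
        _ = (c * C * M) * wt y := by ring
        _ ≤ _ := by
            gcongr
            nlinarith [show 0 ≤ c ^ 2 * C * M ^ 2 by positivity,
              show 0 ≤ c ^ 3 * C * M ^ 4 by positivity]
    · rw [abs_mul, abs_of_pos (by positivity : 0 < c ^ 2)]
      calc c ^ 2 * |f' j (c • (y - x))| ≤ c ^ 2 * (C * (M ^ 2 * wt y ^ 2)) := by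
            gcongr
            exact (h2 j).trans (mul_le_mul_of_nonneg_left (hp 2) hC0)
        _ = (c ^ 2 * C * M ^ 2) * wt y ^ 2 := by ring
        _ ≤ _ := by
            gcongr
            nlinarith [show 0 ≤ c * C * M by positivity,
              show 0 ≤ c ^ 3 * C * M ^ 4 by positivity]
    · rw [abs_mul, abs_of_pos (by positivity : 0 < c ^ 3)]
      calc c ^ 3 * |ψ (c • (y - x))| ≤ c ^ 3 * (C * (M ^ 4 * wt y ^ 4)) := by
            gcongr
            exact h3.trans (mul_le_mul_of_nonneg_left (hp 4) hC0)
        _ = (c ^ 3 * C * M ^ 4) * wt y ^ 4 := by ring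
        _ ≤ _ := by
            gcongr
            nlinarith [show 0 ≤ c * C * M by positivity,
              show 0 ≤ c ^ 2 * C * M ^ 2 by positivity]

/-- Green's second identity for decaying functions. -/
theorem integral_mul_lap_comm (hf : DecayingLap f f' ψ) (hg : DecayingLap g g' χ) :
    ∫ x, g x * ψ x = ∫ x, f x * χ x := by
  obtain ⟨C, hC0, hC⟩ := hf.bound
  obtain ⟨D, hD0, hD⟩ := hg.bound
  have i1 : Integrable fun x => g x * ψ x := by
    refine integrable_of_le_wt (n := 5) (C := D * C) (by norm_num)
      (hg.contDiff.continuous.mul hf.continuous_lap).aestronglyMeasurable fun x => ?_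
    rw [norm_mul]
    calc |g x| * |ψ x| ≤ (D * wt x) * (C * wt x ^ 4) := by
          have := wt_nonneg x
          gcongr
          exacts [(hD x).1, (hC x).2.2]
      _ = _ := by ring
  have i2 : Integrable fun x => f x * χ x := by
    refine integrable_of_le_wt (n := 5) (C := C * D) (by norm_num)
      (hf.contDiff.continuous.mul hg.continuous_lap).aestronglyMeasurable fun x => ?_
    rw [norm_mul]
    calc |f x| * |χ x| ≤ (C * wt x) * (D * wt x ^ 4) := by
          have := wt_nonneg x
          gcongr
          exacts [(hC x).1, (hD x).2.2]
      _ = _ := by ring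
  -- The field `g ∇f - f ∇g` decays like `wt³`; the extra weight in `integral_divergence_eq_zero`
  -- makes this exactly integrable.
  have hdiv : ∀ x, ∑ j, fderiv ℝ (fun x => g x * f' j x - f x * g' j x) x (e3 j)
      = g x * ψ x - f x * χ x := by
    intro x
    rw [← hf.lap_eq, ← hg.lap_eq, Finset.mul_sum, Finset.mul_sum, ← Finset.sum_sub_distrib]
    refine Finset.sum_congr rfl fun j _ => ?_
    have d1 := (hf.contDiff.differentiable (by simp) x).hasFDerivAt
    have d2 := (hg.contDiff.differentiable (by simp) x).hasFDerivAt
    have d3 := ((hf.contDiff' j).differentiable (by simp) x).hasFDerivAt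
    have d4 := ((hg.contDiff' j).differentiable (by simp) x).hasFDerivAt
    have d5 : HasFDerivAt (fun x => g x * f' j x - f x * g' j x) _ x :=
      (d2.mul d3).sub (d1.mul d4)
    rw [d5.fderiv]
    simp [hf.partial_eq, hg.partial_eq]
    ring
  have key := integral_divergence_eq_zero (Φ := fun j x => g x * f' j x - f x * g' j x)
    (fun j => (hg.contDiff.mul (hf.contDiff' j)).sub (hf.contDiff.mul (hg.contDiff' j)))
    (fun j => by
      refine integrable_of_le_wt (n := 4) (C := 2 * (C * D)) le_rfl
        (continuous_wt.mul ((hg.contDiff.continuous.mul (hf.contDiff' j).continuous).sub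
          (hf.contDiff.continuous.mul (hg.contDiff' j).continuous))).aestronglyMeasurable
        fun x => ?_
      have hw := wt_nonneg x
      have a1 : |g x * f' j x| ≤ (D * wt x) * (C * wt x ^ 2) := by
        rw [abs_mul]
        gcongr
        exacts [(hD x).1, (hC x).2.1 j]
      have a2 : |f x * g' j x| ≤ (C * wt x) * (D * wt x ^ 2) := by
        rw [abs_mul]
        gcongr
        exacts [(hC x).1, (hD x).2.1 j]
      rw [norm_mul, Real.norm_of_nonneg hw]
      calc wt x * |g x * f' j x - f x * g' j x|
          ≤ wt x * ((D * wt x) * (C * wt x ^ 2) + (C * wt x) * (D * wt x ^ 2)) := by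
            gcongr
            exact (abs_sub _ _).trans (add_le_add a1 a2)
        _ = _ := by ring)
    ((i1.sub i2).congr (Eventually.of_forall fun x => (hdiv x).symm))
  simp_rw [hdiv] at key
  rw [integral_sub i1 i2] at key
  linarith

end DecayingLap

/-! ### The radial profile of the Talenti function -/

/-- The radial profile `(1 + r²/3)^{-1/2}`. -/
def talentiProfile (r : ℝ) : ℝ := (1 + r ^ 2 / 3) ^ (-(1 / 2) : ℝ)

lemma talentiProfile_pos (r : ℝ) : 0 < talentiProfile r :=
  Real.rpow_pos_of_pos (by positivity) _

lemma talentiProfile_sq_mul (r : ℝ) : talentiProfile r ^ 2 * (1 + r ^ 2 / 3) = 1 := by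
  have h : (0 : ℝ) < 1 + r ^ 2 / 3 := by positivity
  rw [talentiProfile, ← Real.rpow_mul_natCast h.le, ← Real.rpow_add_one h.ne']
  norm_num

/-- The square of `r w(r)` is `3(1 - (1 + r²/3)⁻¹)`. The limit `√3` is the coefficient of `1/r` in
the far field of the bubble. -/
lemma tendsto_mul_talentiProfile :
    Tendsto (fun r => r * talentiProfile r) atTop (𝓝 (√3)) := by
  have h0 : Tendsto (fun r : ℝ => (1 + r ^ 2 / 3)⁻¹) atTop (𝓝 0) :=
    tendsto_inv_atTop_zero.comp (tendsto_atTop_add_const_left _ _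
      ((tendsto_pow_atTop two_ne_zero).atTop_div_const (by norm_num)))
  have h1 : Tendsto (fun r : ℝ => √(3 * (1 - (1 + r ^ 2 / 3)⁻¹))) atTop (𝓝 (√(3 * (1 - 0)))) :=
    ((h0.const_sub 1).const_mul 3).sqrt
  simp only [sub_zero, mul_one] at h1
  refine h1.congr' ?_
  filter_upwards [eventually_ge_atTop 0] with r hr
  have hp := talentiProfile_pos r
  have h2 := talentiProfile_sq_mul r
  have h3 : (0 : ℝ) < 1 + r ^ 2 / 3 := by positivity
  have h4 : 3 * (1 - (1 + r ^ 2 / 3)⁻¹) = (r * talentiProfile r) ^ 2 := by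
    rw [← eq_div_iff h3.ne'] at h2
    rw [mul_pow, h2]
    field_simp
    ring
  rw [h4, Real.sqrt_sq (by positivity)]

lemma hasDerivAt_talentiProfile (r : ℝ) :
    HasDerivAt talentiProfile (-(r / 3) * talentiProfile r ^ 3) r := by
  have h : (0 : ℝ) < 1 + r ^ 2 / 3 := by positivity
  have h1 : HasDerivAt (fun r : ℝ => 1 + r ^ 2 / 3) (2 * r / 3) r := by
    simpa using ((hasDerivAt_pow 2 r).div_const 3).const_add 1
  have h2 := h1.rpow_const (p := (-(1 / 2) : ℝ)) (Or.inl h.ne')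
  refine h2.congr_deriv ?_
  have : talentiProfile r ^ 3 = (1 + r ^ 2 / 3) ^ (-(1 / 2) - 1 : ℝ) := by
    rw [talentiProfile, ← Real.rpow_mul_natCast h.le]
    norm_num
  rw [this]
  ring

lemma continuous_talentiProfile : Continuous talentiProfile :=
  continuous_iff_continuousAt.2 fun r => (hasDerivAt_talentiProfile r).continuousAt

/-- In polar coordinates the integrand `r² w⁵` has the primitive `(r w)³ / 3`. The value is `4π`
times the far-field coefficient `√3`, and this ratio becomes the constant in the Newton potential.
-/
lemma integral_talenti_pow_five : ∫ x, talenti x ^ 5 = 4 * √3 * Real.pi := by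
  have e : ∫ y in Ioi (0 : ℝ), y ^ 2 * talentiProfile y ^ 5 = √3 := by
    have hd : ∀ r ∈ Ioi (0 : ℝ), HasDerivAt (fun r => (r * talentiProfile r) ^ 3 / 3)
        (r ^ 2 * talentiProfile r ^ 5) r := by
      intro r _
      refine ((((hasDerivAt_id r).mul (hasDerivAt_talentiProfile r)).pow 3).div_const 3).congr_deriv
        ?_
      simp
      linear_combination (-r ^ 2 * talentiProfile r ^ 3) * talentiProfile_sq_mul r
    have ht : Tendsto (fun r => (r * talentiProfile r) ^ 3 / 3) atTop (𝓝 (√3 ^ 3 / 3)) :=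
      (tendsto_mul_talentiProfile.pow 3).div_const 3
    rw [integral_Ioi_of_hasDerivAt_of_nonneg ?_ hd (fun r hr => ?_) ht]
    · have : √3 ^ 2 = 3 := Real.sq_sqrt (by norm_num)
      simp
      linear_combination (√3 / 3) * this
    · exact ((continuous_id.mul continuous_talentiProfile).pow 3).div_const 3 |>.continuousWithinAt
    · have := talentiProfile_pos r
      positivity
  have h := integral_fun_norm_addHaar (volume : Measure E3) fun r => talentiProfile r ^ 5
  have hv : (volume : Measure E3).real (Metric.ball 0 1) = 4 / 3 * Real.pi := by
    rw [Measure.real, EuclideanSpace.volume_ball_fin_three]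
    simp only [one_pow, ENNReal.ofReal_one, one_mul]
    rw [ENNReal.toReal_ofReal (by positivity)]
    ring
  simp only [finrank_euclideanSpace, Fintype.card_fin, smul_eq_mul, hv] at h
  rw [show (3 - 1 : ℕ) = 2 from rfl, e] at h
  change ∫ x : E3, talentiProfile ‖x‖ ^ 5 = _
  rw [h]
  simp
  ring

/-! ### The three Laplacians -/

lemma integrable_talenti_pow {n : ℕ} (hn : 4 ≤ n) : Integrable fun x => talenti x ^ n :=
  integrable_of_le_wt hn (continuous_talenti.pow n).aestronglyMeasurable fun x => by
    rw [Real.norm_of_nonneg (pow_nonneg (talenti_pos x).le n)]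
    exact talenti_pow_le_wt n x

lemma fderiv_talenti_pow_mul_coord (n : ℕ) (c : ℝ) (i j : Fin 3) (x : E3) :
    fderiv ℝ (fun x => c * talenti x ^ (n + 1) * x i) x (e3 j)
      = c * (talenti x ^ (n + 1) * (if i = j then 1 else 0)
        - (n + 1) / 3 * talenti x ^ (n + 3) * x j * x i) := by
  have h : HasFDerivAt (fun x => c * talenti x ^ (n + 1) * x i) _ x :=
    ((hasFDerivAt_talenti_pow n x).const_mul c).mul (hasFDerivAt_coord i x)
  rw [h.fderiv]
  simp [EuclideanSpace.inner_single_right]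
  split_ifs <;> ring

lemma abs_talenti_pow_mul_coord_le (n : ℕ) (j : Fin 3) (x : E3) :
    |talenti x ^ (n + 1) * x j| ≤ 2 * 3 ^ n * wt x ^ n := by
  have h1 := talenti_mul_norm_le x
  have h2 := talenti_pos x
  have h3 := abs_coord_le x j
  rw [abs_mul, abs_of_pos (pow_pos h2 _), pow_succ]
  calc talenti x ^ n * talenti x * |x j| ≤ talenti x ^ n * talenti x * ‖x‖ := by gcongr
    _ = talenti x ^ n * (talenti x * ‖x‖) := by ring
    _ ≤ (3 ^ n * wt x ^ n) * 2 := by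
      gcongr
      · exact mul_nonneg (by positivity) (pow_nonneg (wt_nonneg x) n)
      · exact talenti_pow_le_wt n x
    _ = _ := by ring

lemma talenti_pow_le_wt_of_le {m n : ℕ} (h : m ≤ n) (x : E3) :
    talenti x ^ n ≤ 3 ^ n * wt x ^ m :=
  (talenti_pow_le_wt n x).trans (mul_le_mul_of_nonneg_left (wt_pow_le h x) (by positivity))

lemma talenti_pow_mul_coord_le_of_le {m n : ℕ} (h : m ≤ n) (j : Fin 3) (x : E3) :
    talenti x ^ (n + 1) * x j ≤ 2 * 3 ^ n * wt x ^ m ∧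
      -(2 * 3 ^ n * wt x ^ m) ≤ talenti x ^ (n + 1) * x j := by
  have h1 := (abs_talenti_pow_mul_coord_le n j x).trans
    (mul_le_mul_of_nonneg_left (wt_pow_le h x) (by positivity))
  exact ⟨(abs_le.1 h1).2, (abs_le.1 h1).1⟩

/-- This is the energy-critical equation of the bubble, checked from the power rule and the relation
between `W²` and `|x|²`. -/
lemma decayingLap_talenti : DecayingLap talenti (fun j x => -(1 / 3) * talenti x ^ 3 * x j)
    (fun x => -talenti x ^ 5) where
  contDiff := contDiff_talenti
  contDiff' j := (contDiff_const.mul (contDiff_talenti.pow 3)).mul (contDiff_coord j)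
  partial_eq j x := partialD_talenti' j x
  lap_eq x := by
    simp_rw [fderiv_talenti_pow_mul_coord 2]
    have h := sum_coord_sq x
    have h2 := talenti_sq_mul x
    simp only [Fin.sum_univ_three] at h ⊢
    simp
    linear_combination (1 / 3) * talenti x ^ 5 * h + talenti x ^ 3 * h2
  bound := by
    -- The constant is `3⁵`, from `W⁵ ≤ 3⁵ wt⁵`.
    refine ⟨243, by norm_num, fun x => ?_⟩
    have h1 := talenti_pos x
    have hw := wt_nonneg x
    refine ⟨?_, fun j => ?_, ?_⟩
    · rw [abs_of_pos h1]
      linarith [talenti_le_wt x]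
    · have := abs_talenti_pow_mul_coord_le 2 j x
      rw [mul_assoc, abs_mul]
      norm_num at this ⊢
      nlinarith [pow_nonneg hw 2]
    · rw [abs_neg, abs_of_pos (by positivity)]
      have := talenti_pow_le_wt 5 x
      have h3 := wt_pow_le (m := 4) (n := 5) (by norm_num) x
      norm_num at this
      linarith

/-- Behind this lies the scaling invariance of the critical equation, which puts `ΛW` in the kernel
of its linearization. The check uses that `ΛW` is a polynomial in `W`. -/
lemma decayingLap_lam_talenti : DecayingLap (lam talenti)
    (fun j x => (-1) * talenti x ^ 5 * x j - (-1 / 6) * talenti x ^ 3 * x j)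
    (fun x => Vplus x * lam talenti x) where
  contDiff := by
    rw [funext lam_talenti]
    exact (contDiff_talenti.pow 3).sub (contDiff_const.mul contDiff_talenti)
  contDiff' j := ((contDiff_const.mul (contDiff_talenti.pow 5)).mul (contDiff_coord j)).sub
    ((contDiff_const.mul (contDiff_talenti.pow 3)).mul (contDiff_coord j))
  partial_eq j x := by
    rw [funext lam_talenti]
    have h : HasFDerivAt (fun x => talenti x ^ 3 - 1 / 2 * talenti x) _ x :=
      (hasFDerivAt_talenti_pow 2 x).sub ((hasFDerivAt_talenti' x).const_mul (1 / 2))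
    rw [h.fderiv]
    simp [EuclideanSpace.inner_single_right]
    ring
  lap_eq x := by
    have hd : ∀ j, fderiv ℝ (fun x : E3 => (-1) * talenti x ^ 5 * x j
        - (-1 / 6) * talenti x ^ 3 * x j) x (e3 j)
        = fderiv ℝ (fun x : E3 => (-1) * talenti x ^ (4 + 1) * x j) x (e3 j)
          - fderiv ℝ (fun x : E3 => (-1 / 6) * talenti x ^ (2 + 1) * x j) x (e3 j) := by
      intro j
      have c1 : ContDiff ℝ 1 fun x : E3 => (-1) * talenti x ^ 5 * x j :=
        (contDiff_const.mul (contDiff_talenti.pow 5)).mul (contDiff_coord j)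
      have c2 : ContDiff ℝ 1 fun x : E3 => (-1 / 6) * talenti x ^ 3 * x j :=
        (contDiff_const.mul (contDiff_talenti.pow 3)).mul (contDiff_coord j)
      have := ((c1.differentiable (by simp) x).hasFDerivAt.sub
        (c2.differentiable (by simp) x).hasFDerivAt).fderiv
      exact congrArg (fun L : E3 →L[ℝ] ℝ => L (e3 j)) this
    simp_rw [hd, fderiv_talenti_pow_mul_coord]
    have h := sum_coord_sq x
    have h2 := talenti_sq_mul x
    rw [lam_talenti, Vplus]
    simp only [Fin.sum_univ_three] at h ⊢
    simp
    linear_combination (5 / 3 * talenti x ^ 7 - 1 / 6 * talenti x ^ 5) * h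
      + (5 * talenti x ^ 5 - 1 / 2 * talenti x ^ 3) * h2
  bound := by
    -- The largest coefficient is `5 · 3⁷ = 10935`, from the term `5 W⁷` of the Laplacian.
    refine ⟨11000, by norm_num, fun x => ?_⟩
    have h1 := talenti_pos x
    have hw := wt_nonneg x
    refine ⟨?_, fun j => ?_, ?_⟩
    · rw [lam_talenti, abs_le]
      have h3 := talenti_pow_le_wt_of_le (m := 1) (n := 3) (by norm_num) x
      have h4 := talenti_le_wt x
      have h5 : 0 < talenti x ^ 3 := by positivity
      constructor <;> linarith
    · obtain ⟨a1, a2⟩ := talenti_pow_mul_coord_le_of_le (m := 2) (n := 2) le_rfl j x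
      obtain ⟨a3, a4⟩ := talenti_pow_mul_coord_le_of_le (m := 2) (n := 4) (by norm_num) j x
      have hw2 := pow_nonneg hw 2
      norm_num at a1 a2 a3 a4
      rw [abs_le]
      constructor <;> linarith
    · have e : Vplus x * lam talenti x = 5 / 2 * talenti x ^ 5 - 5 * talenti x ^ 7 := by
        rw [lam_talenti, Vplus]
        ring
      have a1 := talenti_pow_le_wt_of_le (m := 4) (n := 5) (by norm_num) x
      have a2 := talenti_pow_le_wt_of_le (m := 4) (n := 7) (by norm_num) x
      have h5 : 0 < talenti x ^ 5 := by positivity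
      have h7 : 0 < talenti x ^ 7 := by positivity
      have hw2 := pow_nonneg hw 4
      rw [e, abs_le]
      constructor <;> linarith

/-- Translation invariance of the critical equation is the reason: differentiating it along `e_i`
gives the linearized equation. Here too the identity is verified directly. -/
lemma decayingLap_partialD_talenti (i : Fin 3) : DecayingLap (partialD i talenti)
    (fun j x => -(1 / 3) * (talenti x ^ 3 * (if i = j then 1 else 0)) + 1 / 3 * talenti x ^ 5 * x j * x i)
    (fun x => Vplus x * partialD i talenti x) where
  contDiff := by
    rw [funext (partialD_talenti' i)]
    exact (contDiff_const.mul (contDiff_talenti.pow 3)).mul (contDiff_coord i)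
  contDiff' j := (contDiff_const.mul ((contDiff_talenti.pow 3).mul contDiff_const)).add
    (((contDiff_const.mul (contDiff_talenti.pow 5)).mul (contDiff_coord j)).mul (contDiff_coord i))
  partial_eq j x := by
    rw [funext (partialD_talenti' i), fderiv_talenti_pow_mul_coord 2]
    push_cast
    ring
  lap_eq x := by
    have hd : ∀ j, fderiv ℝ (fun x : E3 => -(1 / 3) * (talenti x ^ 3 * (if i = j then 1 else 0))
        + 1 / 3 * talenti x ^ 5 * x j * x i) x (e3 j)
        = (if i = j then 1 else 0) * (talenti x ^ 5 * x j) * (1 / 3)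
          + (1 / 3) * (talenti x ^ 5 - 5 / 3 * talenti x ^ 7 * x j * x j) * x i
          + (if i = j then 1 else 0) * (1 / 3 * talenti x ^ 5 * x j) := by
      intro j
      have h : HasFDerivAt (fun x : E3 => -(1 / 3) * (talenti x ^ 3 * (if i = j then 1 else 0))
        + 1 / 3 * talenti x ^ 5 * x j * x i) _ x :=
        (((hasFDerivAt_talenti_pow 2 x).mul_const (if i = j then 1 else 0)).const_mul
          (-(1 / 3))).add ((((hasFDerivAt_talenti_pow 4 x).const_mul (1 / 3)).mul
            (hasFDerivAt_coord j x)).mul (hasFDerivAt_coord i x))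
      rw [h.fderiv]
      split_ifs <;> simp [EuclideanSpace.inner_single_right, *] <;> ring
    simp_rw [hd]
    have h := sum_coord_sq x
    have h2 := talenti_sq_mul x
    rw [partialD_talenti', Vplus, Finset.sum_add_distrib, Finset.sum_add_distrib]
    simp only [ite_mul, one_mul, zero_mul, Finset.sum_ite_eq, Finset.mem_univ, if_true]
    simp only [Fin.sum_univ_three] at h ⊢
    linear_combination (-5 / 9 * talenti x ^ 7 * x i) * h - 5 / 3 * talenti x ^ 5 * x i * h2
  bound := by
    refine ⟨10000, by norm_num, fun x => ?_⟩
    have h1 := talenti_pos x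
    have hw := wt_nonneg x
    refine ⟨?_, fun j => ?_, ?_⟩
    · obtain ⟨a1, a2⟩ := talenti_pow_mul_coord_le_of_le (m := 1) (n := 2) (by norm_num) i x
      norm_num at a1 a2
      rw [partialD_talenti', abs_le]
      constructor <;> linarith
    · have a0 := talenti_pow_le_wt_of_le (m := 2) (n := 3) (by norm_num) x
      have a3 : |talenti x ^ 5 * x j * x i| ≤ 108 * wt x ^ 2 := by
        have e : talenti x ^ 5 * x j * x i
            = (talenti x ^ 3 * x j) * (talenti x ^ 2 * x i) := by ring
        have b1 := abs_talenti_pow_mul_coord_le 2 j x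
        have b2 := (abs_talenti_pow_mul_coord_le 1 i x)
        rw [e, abs_mul]
        calc _ ≤ (2 * 3 ^ 2 * wt x ^ 2) * (2 * 3 ^ 1 * wt x ^ 1) := by gcongr
          _ ≤ (2 * 3 ^ 2 * wt x ^ 2) * (2 * 3 ^ 1 * 1) := by
            gcongr
            simpa using wt_le_one x
          _ = _ := by ring
      have h3 : 0 < talenti x ^ 3 := by positivity
      have hw2 := pow_nonneg hw 2
      rw [abs_le] at a3 ⊢
      split_ifs <;> constructor <;> linarith
    · have e : Vplus x * partialD i talenti x = 5 / 3 * (talenti x ^ 7 * x i) := by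
        rw [partialD_talenti', Vplus]
        ring
      obtain ⟨a1, a2⟩ := talenti_pow_mul_coord_le_of_le (m := 4) (n := 6) (by norm_num) i x
      have hw2 := pow_nonneg hw 4
      norm_num at a1 a2
      rw [e, abs_le]
      constructor <;> linarith

/-! ### The Newton potential -/

lemma integrableOn_inv_norm : IntegrableOn (fun z : E3 => ‖z‖⁻¹) (Metric.ball 0 1) := by
  rw [integrableOn_fun_norm_addHaar (volume : Measure E3) (f := fun r => r⁻¹)]
  have : IntegrableOn (fun y : ℝ => y) (Ioo 0 1) :=
    (continuous_id.integrableOn_Icc (a := 0) (b := 1)).mono_set Ioo_subset_Icc_self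
  refine this.congr_fun (fun y hy => ?_) measurableSet_Ioo
  have : y ≠ 0 := hy.1.ne'
  simp
  field_simp

/-- Inside the unit ball around `x` the singularity is integrable and `ψ` is bounded; outside, the
kernel is at most one and `ψ` is integrable. -/
lemma integrable_inv_norm_mul {ψ : E3 → ℝ} (hψ : Integrable ψ) {C : ℝ} (hC : ∀ y, |ψ y| ≤ C)
    (x : E3) : Integrable fun y => ‖x - y‖⁻¹ * ψ y := by
  have h1 : Integrable fun y : E3 => (Metric.ball (0 : E3) 1).indicator (fun z => ‖z‖⁻¹) (x - y) :=
    ((integrable_indicator_iff Metric.isOpen_ball.measurableSet).2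
      integrableOn_inv_norm).comp_sub_left x
  refine Integrable.mono' ((h1.const_mul C).add hψ.norm) ?_ (Eventually.of_forall fun y => ?_)
  · exact ((measurable_const.sub measurable_id).norm.inv.aestronglyMeasurable).mul
      hψ.aestronglyMeasurable
  · rw [norm_mul, norm_inv, norm_norm, Pi.add_apply, Real.norm_eq_abs]
    by_cases h : x - y ∈ Metric.ball (0 : E3) 1
    · rw [indicator_of_mem h, mul_comm]
      have := mul_le_mul_of_nonneg_right (hC y) (inv_nonneg.2 (norm_nonneg (x - y)))
      linarith [abs_nonneg (ψ y)]
    · rw [indicator_of_notMem h, mul_zero, zero_add]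
      refine mul_le_of_le_one_left (abs_nonneg _) (inv_le_one_of_one_le₀ ?_)
      simpa using h

/-- Concentrating bubbles lose their core and leave only their far field, `√3` times the Newton
kernel without its `4π`. -/
lemma tendsto_mul_talenti_smul {z : E3} (hz : z ≠ 0) :
    Tendsto (fun n : ℕ => ((n : ℝ) + 1) * talenti (((n : ℝ) + 1) • z)) atTop
      (𝓝 (√3 * ‖z‖⁻¹)) := by
  have hz' : 0 < ‖z‖ := norm_pos_iff.2 hz
  have h1 : Tendsto (fun n : ℕ => ((n : ℝ) + 1) * ‖z‖) atTop atTop :=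
    (tendsto_natCast_atTop_atTop.atTop_add tendsto_const_nhds).atTop_mul_const hz'
  refine ((tendsto_mul_talentiProfile.comp h1).mul_const ‖z‖⁻¹).congr fun n => ?_
  have e : talenti (((n : ℝ) + 1) • z) = talentiProfile (((n : ℝ) + 1) * ‖z‖) := by
    rw [talenti, talentiProfile, norm_smul, Real.norm_of_nonneg (by positivity)]
  rw [e]
  simp only [Function.comp_apply]
  field_simp

namespace DecayingLap

variable {f : E3 → ℝ} {f' : Fin 3 → E3 → ℝ} {ψ : E3 → ℝ}

lemma integrable_lap (h : DecayingLap f f' ψ) : Integrable ψ := by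
  obtain ⟨C, -, hC⟩ := h.bound
  exact integrable_of_le_wt le_rfl h.continuous_lap.aestronglyMeasurable fun x => (hC x).2.2

lemma integrable_inv_norm_mul_lap (h : DecayingLap f f' ψ) (x : E3) :
    Integrable fun y => ‖x - y‖⁻¹ * ψ y := by
  obtain ⟨C, hC0, hC⟩ := h.bound
  refine integrable_inv_norm_mul h.integrable_lap (C := C) (fun y => ?_) x
  refine (hC y).2.2.trans (mul_le_of_le_one_right hC0 ?_)
  exact pow_le_one₀ (wt_nonneg y) (wt_le_one y)

/-- The Newton potential of `Δf` is `-f`. -/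
theorem integral_inv_norm_mul_lap (h : DecayingLap f f' ψ) (x : E3) :
    ∫ y, ‖x - y‖⁻¹ * ψ y = -(4 * Real.pi * f x) := by
  obtain ⟨C, hC0, hC⟩ := h.bound
  -- The concentrating bubble replaces the singular kernel in Green's identity. Its Laplacian is an
  -- approximate delta at `x`, and rescaling turns that into a fixed density `W⁵`.
  have green : ∀ n : ℕ, ∫ y, (((n : ℝ) + 1) * talenti (((n : ℝ) + 1) • (y - x))) * ψ y
      = -∫ z, f (((n : ℝ) + 1)⁻¹ • z + x) * talenti z ^ 5 := by
    intro n
    have hn : (0 : ℝ) < n + 1 := by positivity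
    rw [h.integral_mul_lap_comm (decayingLap_talenti.comp_affine hn x)]
    have e1 : ∀ y : E3, f y * (((n : ℝ) + 1) ^ 3 * -talenti (((n : ℝ) + 1) • (y - x)) ^ 5)
        = -((n : ℝ) + 1) ^ 3 * (fun z => f (((n : ℝ) + 1)⁻¹ • z + x) * talenti z ^ 5)
          (((n : ℝ) + 1) • (y - x)) := by
      intro y
      simp only [smul_smul, inv_mul_cancel₀ hn.ne', one_smul, sub_add_cancel]
      ring
    simp_rw [e1]
    rw [integral_const_mul, integral_sub_right_eq_self
      (fun y => f (((n : ℝ) + 1)⁻¹ • (((n : ℝ) + 1) • y) + x) * talenti (((n : ℝ) + 1) • y) ^ 5) x,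
      Measure.integral_comp_smul volume
        (fun z => f (((n : ℝ) + 1)⁻¹ • z + x) * talenti z ^ 5) ((n : ℝ) + 1)]
    simp only [finrank_euclideanSpace, Fintype.card_fin, smul_eq_mul]
    rw [abs_of_pos (by positivity)]
    field_simp
  -- Domination comes from `W(z)|z| ≤ 2`, which is unaffected by the rescaling.
  have l1 : Tendsto (fun n : ℕ => ∫ y, (((n : ℝ) + 1) * talenti (((n : ℝ) + 1) • (y - x))) * ψ y)
      atTop (𝓝 (∫ y, √3 * (‖x - y‖⁻¹ * ψ y))) := by
    refine tendsto_integral_of_dominated_convergence (fun y => 2 * ‖‖x - y‖⁻¹ * ψ y‖)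
      (fun n => ?_) ((h.integrable_inv_norm_mul_lap x).norm.const_mul 2)
      (fun n => ?_) ?_
    · refine ((continuous_const.mul (continuous_talenti.comp ?_)).mul
        h.continuous_lap).aestronglyMeasurable
      fun_prop
    · have hne : ∀ᵐ y : E3, y ≠ x := by simp [ae_iff]
      filter_upwards [hne] with y hy
      have hp : 0 < ‖x - y‖ := norm_pos_iff.2 (sub_ne_zero.2 hy.symm)
      have hn : (0 : ℝ) < n + 1 := by positivity
      have ht := talenti_mul_norm_le (((n : ℝ) + 1) • (y - x))
      have htp := talenti_pos (((n : ℝ) + 1) • (y - x))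
      rw [norm_smul, Real.norm_of_nonneg hn.le, norm_sub_rev] at ht
      rw [norm_mul, Real.norm_of_nonneg (mul_pos hn htp).le, norm_mul,
        Real.norm_of_nonneg (inv_pos.2 hp).le, ← mul_assoc]
      refine mul_le_mul_of_nonneg_right ?_ (norm_nonneg _)
      rw [← div_eq_mul_inv, le_div_iff₀ hp]
      linarith
    · have hne : ∀ᵐ y : E3, y ≠ x := by simp [ae_iff]
      filter_upwards [hne] with y hy
      have := (tendsto_mul_talenti_smul (sub_ne_zero.2 hy)).mul_const (ψ y)
      rwa [norm_sub_rev, mul_assoc] at this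
  have l2 : Tendsto (fun n : ℕ => ∫ z, f (((n : ℝ) + 1)⁻¹ • z + x) * talenti z ^ 5) atTop
      (𝓝 (∫ z, f x * talenti z ^ 5)) := by
    refine tendsto_integral_of_dominated_convergence (fun z => C * talenti z ^ 5)
      (fun n => ?_) ((integrable_talenti_pow (by norm_num)).const_mul C)
      (fun n => Eventually.of_forall fun z => ?_) (Eventually.of_forall fun z => ?_)
    · refine ((h.contDiff.continuous.comp ?_).mul (continuous_talenti.pow 5)).aestronglyMeasurable
      fun_prop
    · have htp := talenti_pos z
      rw [norm_mul, Real.norm_of_nonneg (pow_pos htp 5).le]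
      gcongr
      refine ((hC _).1).trans (mul_le_of_le_one_right hC0 (wt_le_one _))
    · have h0 : Tendsto (fun n : ℕ => ((n : ℝ) + 1)⁻¹ • z + x) atTop (𝓝 ((0 : ℝ) • z + x)) := by
        have := tendsto_one_div_add_atTop_nhds_zero_nat (𝕜 := ℝ)
        simp only [one_div] at this
        exact (this.smul_const z).add_const x
      rw [zero_smul, zero_add] at h0
      exact ((h.contDiff.continuous.tendsto x).comp h0).mul_const _
  simp_rw [green] at l1
  have key := tendsto_nhds_unique l1 l2.neg
  rw [integral_const_mul, integral_const_mul, integral_talenti_pow_five] at key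
  have h3 : (0 : ℝ) < √3 := by positivity
  have h4 : √3 * (∫ y, ‖x - y‖⁻¹ * ψ y) = √3 * -(4 * Real.pi * f x) := by linear_combination key
  exact mul_left_cancel₀ h3.ne' h4

end DecayingLap

/-! ### The kernel `(1 - e^{-ar}) / (ar)` -/

/-- `k_a(r) = ∫₀¹ e^{-arτ} dτ`, so that `1 - e^{-ar} = a r k_a(r)`. -/
def expKernel (a r : ℝ) : ℝ := ∫ τ in (0 : ℝ)..1, Real.exp (-(a * r * τ))

lemma intervalIntegrable_exp (a r : ℝ) :
    IntervalIntegrable (fun τ => Real.exp (-(a * r * τ))) volume 0 1 :=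
  Continuous.intervalIntegrable (by fun_prop) _ _

lemma expKernel_nonneg (a r : ℝ) : 0 ≤ expKernel a r :=
  intervalIntegral.integral_nonneg zero_le_one fun _ _ => (Real.exp_pos _).le

lemma expKernel_le_one {a r : ℝ} (ha : 0 ≤ a) (hr : 0 ≤ r) : expKernel a r ≤ 1 := by
  have h := intervalIntegral.integral_mono_on zero_le_one (intervalIntegrable_exp a r)
    (intervalIntegrable_const (c := (1 : ℝ))) fun τ hτ => by
      rw [Real.exp_le_one_iff]
      have := hτ.1
      have : 0 ≤ a * r * τ := by positivity
      linarith
  simpa [expKernel] using h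

lemma one_sub_exp_eq (a r : ℝ) : 1 - Real.exp (-(a * r)) = a * r * expKernel a r := by
  by_cases h : a * r = 0
  · simp [h]
  · obtain ⟨ha, hr⟩ := mul_ne_zero_iff.1 h
    have h1 : ∀ τ ∈ uIcc (0 : ℝ) 1, HasDerivAt (fun τ => -Real.exp (-(a * r * τ)) / (a * r))
        (Real.exp (-(a * r * τ))) τ := by
      intro τ _
      have h2 : HasDerivAt (fun τ : ℝ => -(a * r * τ)) (-(a * r)) τ := by
        simpa using (hasDerivAt_id τ).const_mul (-(a * r))
      refine (h2.exp.neg.div_const (a * r)).congr_deriv ?_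
      field_simp
    rw [expKernel, intervalIntegral.integral_eq_sub_of_hasDerivAt h1 (intervalIntegrable_exp a r)]
    simp only [mul_one, mul_zero, neg_zero, Real.exp_zero]
    field_simp
    ring

lemma abs_exp_neg_sub_exp_neg_le {s t : ℝ} (hs : 0 ≤ s) (ht : 0 ≤ t) :
    |Real.exp (-s) - Real.exp (-t)| ≤ |s - t| := by
  wlog h : s ≤ t generalizing s t
  · rw [abs_sub_comm, abs_sub_comm s]
    exact this ht hs (le_of_not_ge h)
  have h1 : Real.exp (-t) ≤ Real.exp (-s) := Real.exp_le_exp.2 (by linarith)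
  rw [abs_of_nonneg (by linarith), abs_of_nonpos (by linarith)]
  have h2 : Real.exp (-t) = Real.exp (-s) * Real.exp (-(t - s)) := by
    rw [← Real.exp_add]
    ring_nf
  have h3 := Real.add_one_le_exp (-(t - s))
  have h4 : Real.exp (-s) ≤ 1 := Real.exp_le_one_iff.2 (by linarith)
  have h5 := Real.exp_pos (-s)
  rw [h2]
  nlinarith

/-- The Lipschitz constant is `a`, not just a fixed number: this is the source of the additional
factor `a` gained on densities of mean zero. -/
lemma abs_expKernel_sub_le {a r s : ℝ} (ha : 0 ≤ a) (hr : 0 ≤ r) (hs : 0 ≤ s) :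
    |expKernel a r - expKernel a s| ≤ a * |r - s| := by
  rw [expKernel, expKernel, ← intervalIntegral.integral_sub (intervalIntegrable_exp a r)
    (intervalIntegrable_exp a s)]
  have h := intervalIntegral.norm_integral_le_of_norm_le_const (a := (0 : ℝ)) (b := 1)
    (C := a * |r - s|) (f := fun τ => Real.exp (-(a * r * τ)) - Real.exp (-(a * s * τ)))
    fun τ hτ => by
      rw [uIoc_of_le zero_le_one] at hτ
      have hτ0 := hτ.1.le
      refine (abs_exp_neg_sub_exp_neg_le (by positivity) (by positivity)).trans ?_
      rw [show a * r * τ - a * s * τ = a * (r - s) * τ by ring, abs_mul, abs_mul, abs_of_nonneg ha,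
        abs_of_nonneg hτ0]
      exact mul_le_of_le_one_right (by positivity) hτ.2
  simpa using h

lemma continuous_expKernel (a : ℝ) : Continuous (expKernel a) := by
  unfold expKernel
  exact intervalIntegral.continuous_parametric_intervalIntegral_of_continuous'
    (by fun_prop) _ _

/-- Convexity of the exponential between `0` and `-d`, evaluated at the intermediate point `-ad`. -/
lemma mul_one_sub_exp_le {a d : ℝ} (ha : 0 ≤ a) (ha1 : a ≤ 1) :
    a * (1 - Real.exp (-d)) ≤ 1 - Real.exp (-(a * d)) := by
  have h := convexOn_exp.2 (mem_univ (0 : ℝ)) (mem_univ (-d)) (sub_nonneg.2 ha1) ha (by ring)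
  simp only [smul_eq_mul, mul_zero, zero_add, Real.exp_zero, mul_one] at h
  rw [show -(a * d) = a * -d by ring]
  linarith

/-- Under the integral over `τ`, the decrement of `e^{-arτ}` factors into a value and a relative
drop. The value is larger for smaller `a`, and the relative drop is at least `a` times that for `a =
1` by `mul_one_sub_exp_le`. In the translation entries the factor `a` here balances the `a⁻¹` of the
profile. -/
lemma mul_expKernel_sub_le {a r s : ℝ} (ha : 0 ≤ a) (ha1 : a ≤ 1) (hr : 0 ≤ r) (h : r ≤ s) :
    a * (expKernel 1 r - expKernel 1 s) ≤ expKernel a r - expKernel a s := by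
  simp only [expKernel]
  rw [← intervalIntegral.integral_sub (intervalIntegrable_exp 1 r) (intervalIntegrable_exp 1 s),
    ← intervalIntegral.integral_sub (intervalIntegrable_exp a r) (intervalIntegrable_exp a s),
    ← intervalIntegral.integral_const_mul]
  refine intervalIntegral.integral_mono_on zero_le_one
    (((intervalIntegrable_exp 1 r).sub (intervalIntegrable_exp 1 s)).const_mul a)
    ((intervalIntegrable_exp a r).sub (intervalIntegrable_exp a s)) fun τ hτ => ?_
  have hτ0 := hτ.1
  have h1 : Real.exp (-(1 * s * τ)) = Real.exp (-(r * τ)) * Real.exp (-((s - r) * τ)) := by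
    rw [← Real.exp_add]
    ring_nf
  have h2 : Real.exp (-(a * s * τ)) = Real.exp (-(a * r * τ)) * Real.exp (-(a * ((s - r) * τ))) := by
    rw [← Real.exp_add]
    ring_nf
  rw [h1, h2, one_mul]
  have h3 := mul_one_sub_exp_le (d := (s - r) * τ) ha ha1
  have h4 : Real.exp (-(r * τ)) ≤ Real.exp (-(a * r * τ)) := by
    rw [Real.exp_le_exp, neg_le_neg_iff, mul_assoc]
    exact mul_le_of_le_one_left (by positivity) ha1
  have h5 : 0 ≤ 1 - Real.exp (-(a * ((s - r) * τ))) := by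
    rw [sub_nonneg, Real.exp_le_one_iff, neg_nonpos]
    have := sub_nonneg.2 h
    positivity
  have h6 := Real.exp_pos (-(r * τ))
  calc a * (Real.exp (-(r * τ)) - Real.exp (-(r * τ)) * Real.exp (-((s - r) * τ)))
      = Real.exp (-(r * τ)) * (a * (1 - Real.exp (-((s - r) * τ)))) := by ring
    _ ≤ Real.exp (-(r * τ)) * (1 - Real.exp (-(a * ((s - r) * τ)))) := by gcongr
    _ ≤ Real.exp (-(a * r * τ)) * (1 - Real.exp (-(a * ((s - r) * τ)))) := by gcongr
    _ = _ := by ring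

lemma expKernel_lt {r s : ℝ} (h : r < s) : expKernel 1 s < expKernel 1 r := by
  refine intervalIntegral.integral_lt_integral_of_continuousOn_of_le_of_exists_lt zero_lt_one
    (by fun_prop) (by fun_prop) (fun τ hτ => ?_) ⟨1, by simp, ?_⟩
  · rw [Real.exp_le_exp, neg_le_neg_iff]
    have := hτ.1.le
    gcongr
  · rw [Real.exp_lt_exp]
    linarith

/-! ### The potential with this kernel -/

/-- `∫ k_a(|x - y|) ψ(y) dy`. -/
def expPotential (a : ℝ) (ψ : E3 → ℝ) (x : E3) : ℝ := ∫ y, expKernel a ‖x - y‖ * ψ y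

lemma integrable_expKernel_mul {a : ℝ} (ha : 0 ≤ a) {ψ : E3 → ℝ} (hψ : Integrable ψ) (x : E3) :
    Integrable fun y => expKernel a ‖x - y‖ * ψ y := by
  refine hψ.norm.mono' ?_ (Eventually.of_forall fun y => ?_)
  · exact ((continuous_expKernel a).comp (by fun_prop)).aestronglyMeasurable.mul
      hψ.aestronglyMeasurable
  · rw [norm_mul, Real.norm_of_nonneg (expKernel_nonneg _ _)]
    exact mul_le_of_le_one_left (norm_nonneg _) (expKernel_le_one ha (norm_nonneg _))

lemma abs_expPotential_le {a : ℝ} (ha : 0 ≤ a) {ψ : E3 → ℝ} (hψ : Integrable ψ) (x : E3) :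
    |expPotential a ψ x| ≤ ∫ y, |ψ y| := by
  refine (norm_integral_le_integral_norm _).trans
    (integral_mono (integrable_expKernel_mul ha hψ x).norm hψ.norm fun y => ?_)
  change ‖expKernel a ‖x - y‖ * ψ y‖ ≤ ‖ψ y‖
  rw [norm_mul, Real.norm_of_nonneg (expKernel_nonneg _ _)]
  exact mul_le_of_le_one_left (norm_nonneg _) (expKernel_le_one ha (norm_nonneg _))

lemma abs_expPotential_sub_le {a : ℝ} (ha : 0 ≤ a) {ψ : E3 → ℝ} (hψ : Integrable ψ) (x x' : E3) :
    |expPotential a ψ x - expPotential a ψ x'| ≤ (a * ∫ y, |ψ y|) * ‖x - x'‖ := by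
  rw [expPotential, expPotential, ← integral_sub (integrable_expKernel_mul ha hψ x)
    (integrable_expKernel_mul ha hψ x')]
  have h : ∀ y, ‖expKernel a ‖x - y‖ * ψ y - expKernel a ‖x' - y‖ * ψ y‖
      ≤ (a * ‖x - x'‖) * |ψ y| := by
    intro y
    rw [← sub_mul, norm_mul, Real.norm_eq_abs (ψ y)]
    gcongr
    refine (abs_expKernel_sub_le ha (norm_nonneg _) (norm_nonneg _)).trans ?_
    gcongr
    simpa using abs_norm_sub_norm_le (x - y) (x' - y)
  refine (norm_integral_le_of_norm_le (hψ.abs.const_mul _) (Eventually.of_forall h)).trans ?_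
  rw [integral_const_mul]
  apply le_of_eq
  ring

/-- Subtracting `k_a(|x|)` from the kernel costs nothing when the mean vanishes, and the difference
is at most `a|y|`. -/
lemma abs_expPotential_le_of_integral_eq_zero {a : ℝ} (ha : 0 ≤ a) {ψ : E3 → ℝ}
    (hψ : Integrable ψ) (hψ1 : Integrable fun y => ‖y‖ * |ψ y|) (h0 : ∫ y, ψ y = 0) (x : E3) :
    |expPotential a ψ x| ≤ a * ∫ y, ‖y‖ * |ψ y| := by
  have e : expPotential a ψ x = ∫ y, (expKernel a ‖x - y‖ - expKernel a ‖x‖) * ψ y := by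
    simp_rw [sub_mul]
    rw [integral_sub (integrable_expKernel_mul ha hψ x) (hψ.const_mul _), integral_const_mul, h0,
      mul_zero, sub_zero, expPotential]
  have h : ∀ y, ‖(expKernel a ‖x - y‖ - expKernel a ‖x‖) * ψ y‖ ≤ a * (‖y‖ * |ψ y|) := by
    intro y
    rw [norm_mul, Real.norm_eq_abs (ψ y), ← mul_assoc]
    gcongr
    refine (abs_expKernel_sub_le ha (norm_nonneg _) (norm_nonneg _)).trans ?_
    gcongr
    simpa using abs_norm_sub_norm_le (x - y) x
  rw [e]
  refine (norm_integral_le_of_norm_le (hψ1.const_mul a) (Eventually.of_forall h)).trans ?_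
  rw [integral_const_mul]

/-- For a decaying `f`, `f + (-Δ + α)⁻¹ Δf` is a potential with a bounded kernel. -/
lemma DecayingLap.add_resolvent3 {f : E3 → ℝ} {f' : Fin 3 → E3 → ℝ} {ψ : E3 → ℝ}
    (h : DecayingLap f f' ψ) {α : ℝ} (x : E3) :
    f x + resolvent3 α ψ x = -(√α / (4 * Real.pi)) * expPotential (√α) ψ x := by
  -- The kernel splits as `e^{-ar}/r = 1/r - a k_a(r)`. The first piece is the Newton kernel, whose
  -- potential of `ψ` cancels `f`.
  have e : resolvent3 α ψ x = ∫ y, ((4 * Real.pi)⁻¹ * (‖x - y‖⁻¹ * ψ y)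
      - √α / (4 * Real.pi) * (expKernel (√α) ‖x - y‖ * ψ y)) := by
    refine integral_congr_ae ?_
    have hne : ∀ᵐ y : E3, y ≠ x := by simp [ae_iff]
    filter_upwards [hne] with y hy
    have hp : 0 < ‖x - y‖ := norm_pos_iff.2 (sub_ne_zero.2 hy.symm)
    have h1 := one_sub_exp_eq (√α) ‖x - y‖
    have hpi := Real.pi_pos
    rw [show -√α * ‖x - y‖ = -(√α * ‖x - y‖) by ring]
    have h2 : Real.exp (-(√α * ‖x - y‖)) = 1 - √α * ‖x - y‖ * expKernel (√α) ‖x - y‖ := by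
      linarith
    rw [h2]
    field_simp
  rw [e, integral_sub ((h.integrable_inv_norm_mul_lap x).const_mul _)
    ((integrable_expKernel_mul (Real.sqrt_nonneg α) h.integrable_lap x).const_mul _),
    integral_const_mul, integral_const_mul, h.integral_inv_norm_mul_lap, expPotential]
  have hpi := Real.pi_pos
  field_simp
  ring

/-- The potential factors out, leaving `V₊ (f + (-Δ+α)⁻¹(V₊ f))`, and `V₊ f` is the Laplacian of
`f`. -/
lemma Gstar_ofReal_mul {f : E3 → ℝ} {f' : Fin 3 → E3 → ℝ}
    (h : DecayingLap f f' fun x => Vplus x * f x) (α : ℝ) (x : E3) :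
    Gstar α (fun x => ((Vplus x * f x : ℝ) : ℂ)) x
      = ((-(√α / (4 * Real.pi)) * (Vplus x * expPotential (√α) (fun x => Vplus x * f x) x) : ℝ)
        : ℂ) := by
  have e := h.add_resolvent3 (α := α) x
  have e0 : resolvent3 α (fun _ => 0) x = 0 := by simp [resolvent3]
  simp only [Gstar, Complex.ofReal_re, Complex.ofReal_im, e0]
  rw [← mul_add, e]
  simp only [mul_zero, add_zero, Complex.ofReal_zero, sub_zero]
  congr 1
  ring

lemma Gstar_I_mul {f : E3 → ℝ} {f' : Fin 3 → E3 → ℝ}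
    (h : DecayingLap f f' fun x => Vminus x * f x) (α : ℝ) (x : E3) :
    Gstar α (fun x => Complex.I * ((Vminus x * f x : ℝ) : ℂ)) x
      = -Complex.I * ((-(√α / (4 * Real.pi))
        * (Vminus x * expPotential (√α) (fun x => Vminus x * f x) x) : ℝ) : ℂ) := by
  have e := h.add_resolvent3 (α := α) x
  have e0 : resolvent3 α (fun _ => 0) x = 0 := by simp [resolvent3]
  have h1 : ∀ r : ℝ, (Complex.I * (r : ℂ)).re = 0 := fun r => by simp
  have h2 : ∀ r : ℝ, (Complex.I * (r : ℂ)).im = r := fun r => by simp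
  simp only [Gstar, h1, h2, e0]
  rw [← mul_add, e]
  simp only [mul_zero, add_zero, Complex.ofReal_zero, zero_sub, neg_mul]
  congr 3
  ring

/-! ### Quadratic forms of radial kernels -/

/-- `∬ k(|x - y|) ψ(x) φ(y) dx dy`. -/
def kernelForm (k : ℝ → ℝ) (ψ φ : E3 → ℝ) : ℝ :=
  ∫ p : E3 × E3, k ‖p.1 - p.2‖ * (ψ p.1 * φ p.2)

lemma integrable_kernelForm {k : ℝ → ℝ} (hk : Continuous k) {B : ℝ} (hB : ∀ r, 0 ≤ r → |k r| ≤ B)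
    {ψ φ : E3 → ℝ} (hψ : Integrable ψ) (hφ : Integrable φ) :
    Integrable fun p : E3 × E3 => k ‖p.1 - p.2‖ * (ψ p.1 * φ p.2) := by
  refine (hψ.mul_prod hφ).bdd_mul (c := B) ?_ (Eventually.of_forall fun p => ?_)
  · exact (hk.comp (by fun_prop)).aestronglyMeasurable
  · exact hB _ (norm_nonneg _)

lemma abs_expKernel_le_one {a : ℝ} (ha : 0 ≤ a) (r : ℝ) (hr : 0 ≤ r) : |expKernel a r| ≤ 1 := by
  rw [abs_of_nonneg (expKernel_nonneg a r)]
  exact expKernel_le_one ha hr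

lemma integral_mul_expPotential {a : ℝ} (ha : 0 ≤ a) {ψ φ : E3 → ℝ} (hψ : Integrable ψ)
    (hφ : Integrable φ) :
    ∫ x, ψ x * expPotential a φ x = kernelForm (expKernel a) ψ φ := by
  rw [kernelForm, Measure.volume_eq_prod, integral_prod]
  · refine integral_congr_ae (Eventually.of_forall fun x => ?_)
    simp only [expPotential]
    rw [← integral_const_mul]
    refine integral_congr_ae (Eventually.of_forall fun y => ?_)
    simp only
    ring
  · exact integrable_kernelForm (continuous_expKernel a) (abs_expKernel_le_one ha) hψ hφ

/-- The reflection in the hyperplane `x_j = 0`. -/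
def coordRefl (j : Fin 3) : E3 ≃ₗᵢ[ℝ] E3 :=
  LinearIsometryEquiv.piLpCongrRight 2 fun i =>
    if i = j then LinearIsometryEquiv.neg ℝ else LinearIsometryEquiv.refl ℝ ℝ

lemma coordRefl_apply (j i : Fin 3) (x : E3) :
    coordRefl j x i = if i = j then -x i else x i := by
  simp only [coordRefl, LinearIsometryEquiv.piLpCongrRight_apply]
  split_ifs <;> simp

lemma measurePreserving_coordRefl (j : Fin 3) : MeasurePreserving (coordRefl j) :=
  (coordRefl j).measurePreserving

lemma measurableEmbedding_coordRefl (j : Fin 3) : MeasurableEmbedding (coordRefl j) :=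
  (coordRefl j).toHomeomorph.measurableEmbedding

lemma integral_eq_zero_of_odd {ψ : E3 → ℝ} (j : Fin 3) (h : ∀ x, ψ (coordRefl j x) = -ψ x) :
    ∫ x, ψ x = 0 := by
  have h1 := (measurePreserving_coordRefl j).integral_comp (measurableEmbedding_coordRefl j) ψ
  simp_rw [h] at h1
  rw [integral_neg] at h1
  linarith

/-- Reflecting both variables preserves their distance and the measure, so the form equals its own
negative. This provides the vanishing off-diagonal entries. -/
lemma kernelForm_eq_zero (k : ℝ → ℝ) {ψ φ : E3 → ℝ} (j : Fin 3)
    (hψφ : ∀ x y, ψ (coordRefl j x) * φ (coordRefl j y) = -(ψ x * φ y)) :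
    kernelForm k ψ φ = 0 := by
  have h1 := ((measurePreserving_coordRefl j).prod (measurePreserving_coordRefl j)).integral_comp
    ((measurableEmbedding_coordRefl j).prodMap (measurableEmbedding_coordRefl j))
    fun p : E3 × E3 => k ‖p.1 - p.2‖ * (ψ p.1 * φ p.2)
  simp only [Prod.map_fst, Prod.map_snd, ← map_sub, LinearIsometryEquiv.norm_map, hψφ,
    mul_neg, integral_neg, ← Measure.volume_eq_prod] at h1
  rw [kernelForm]
  linarith

/-- Reflecting only one variable changes the kernel to the distance from the mirror image. Averaging
the two expressions replaces the kernel by a difference with a controlled sign. -/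
lemma kernelForm_refl_left (k : ℝ → ℝ) {ψ φ : E3 → ℝ} (j : Fin 3)
    (hψ : ∀ x, ψ (coordRefl j x) = -ψ x) :
    kernelForm k ψ φ
      = -∫ p : E3 × E3, k ‖coordRefl j p.1 - p.2‖ * (ψ p.1 * φ p.2) := by
  have h1 := ((measurePreserving_coordRefl j).prod (MeasurePreserving.id volume)).integral_comp
    ((measurableEmbedding_coordRefl j).prodMap (MeasurableEmbedding.id))
    fun p : E3 × E3 => k ‖p.1 - p.2‖ * (ψ p.1 * φ p.2)
  simp only [Prod.map_fst, Prod.map_snd, hψ, neg_mul, mul_neg, integral_neg, id,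
    ← Measure.volume_eq_prod] at h1
  rw [kernelForm, h1]

/-- The sign of `x_j y_j` decides whether `x` or its mirror image is closer to `y`. -/
lemma norm_coordRefl_sub_sq (j : Fin 3) (x y : E3) :
    ‖coordRefl j x - y‖ ^ 2 = ‖x - y‖ ^ 2 + 4 * (x j * y j) := by
  rw [← sum_coord_sq, ← sum_coord_sq]
  fin_cases j <;> simp [Fin.sum_univ_three, coordRefl_apply] <;> ring

lemma strictAnti_expKernel_one : StrictAnti (expKernel 1) := fun _ _ h => expKernel_lt h

section Odd

variable {ρ : E3 → ℝ} {j : Fin 3}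

lemma two_mul_kernelForm_odd (hρ : ∀ x, ρ (coordRefl j x) = ρ x)
    (hint : Integrable fun x => ρ x * x j) {a : ℝ} (ha : 0 ≤ a) :
    (Integrable fun p : E3 × E3 =>
      (expKernel a ‖p.1 - p.2‖ - expKernel a ‖coordRefl j p.1 - p.2‖)
        * ((ρ p.1 * p.1 j) * (ρ p.2 * p.2 j))) ∧
    2 * kernelForm (expKernel a) (fun x => ρ x * x j) (fun x => ρ x * x j)
      = ∫ p : E3 × E3, (expKernel a ‖p.1 - p.2‖ - expKernel a ‖coordRefl j p.1 - p.2‖)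
        * ((ρ p.1 * p.1 j) * (ρ p.2 * p.2 j)) := by
  have i1 := integrable_kernelForm (continuous_expKernel a) (abs_expKernel_le_one ha) hint hint
  have i2 : Integrable fun p : E3 × E3 => expKernel a ‖coordRefl j p.1 - p.2‖
      * ((ρ p.1 * p.1 j) * (ρ p.2 * p.2 j)) := by
    refine (hint.mul_prod hint).bdd_mul (c := 1) ?_ (Eventually.of_forall fun p => ?_)
    · refine ((continuous_expKernel a).comp (Continuous.norm ?_)).aestronglyMeasurable
      exact ((coordRefl j).continuous.comp continuous_fst).sub continuous_snd
    · exact abs_expKernel_le_one ha _ (norm_nonneg _)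
  have h := kernelForm_refl_left (expKernel a) (φ := fun x => ρ x * x j) (ψ := fun x => ρ x * x j) j
    fun x => by simp [hρ, coordRefl_apply]
  refine ⟨(i1.sub i2).congr (Eventually.of_forall fun p => by simp only [Pi.sub_apply]; ring), ?_⟩
  simp_rw [sub_mul]
  rw [integral_sub i1 i2, two_mul]
  nth_rewrite 2 [h]
  rw [kernelForm]
  ring

/-- In the symmetrized form the kernel difference and `x_j y_j` have the same sign, so
`mul_expKernel_sub_le` applies pointwise, with `|x - y|` and the mirrored distance exchanged when
`x_j y_j ≤ 0`. -/
lemma mul_kernelForm_odd_le (hρ : ∀ x, ρ (coordRefl j x) = ρ x) (hρ0 : ∀ x, 0 ≤ ρ x)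
    (hint : Integrable fun x => ρ x * x j) {a : ℝ} (ha : 0 ≤ a) (ha1 : a ≤ 1) :
    a * kernelForm (expKernel 1) (fun x => ρ x * x j) (fun x => ρ x * x j)
      ≤ kernelForm (expKernel a) (fun x => ρ x * x j) (fun x => ρ x * x j) := by
  obtain ⟨i1, h1⟩ := two_mul_kernelForm_odd hρ hint (zero_le_one' ℝ)
  obtain ⟨i2, h2⟩ := two_mul_kernelForm_odd hρ hint ha
  have h3 := integral_mono (i1.const_mul a) i2 fun p => by
    have e := norm_coordRefl_sub_sq j p.1 p.2
    have hr := mul_nonneg (hρ0 p.1) (hρ0 p.2)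
    simp only
    rw [← mul_assoc, show ρ p.1 * p.1 j * (ρ p.2 * p.2 j)
      = (ρ p.1 * ρ p.2) * (p.1 j * p.2 j) by ring]
    rcases le_total 0 (p.1 j * p.2 j) with h | h
    · have hle : ‖p.1 - p.2‖ ≤ ‖coordRefl j p.1 - p.2‖ :=
        (sq_le_sq₀ (norm_nonneg _) (norm_nonneg _)).1 (by linarith)
      exact mul_le_mul_of_nonneg_right (mul_expKernel_sub_le ha ha1 (norm_nonneg _) hle)
        (mul_nonneg hr h)
    · have hle : ‖coordRefl j p.1 - p.2‖ ≤ ‖p.1 - p.2‖ :=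
        (sq_le_sq₀ (norm_nonneg _) (norm_nonneg _)).1 (by linarith)
      have := mul_expKernel_sub_le ha ha1 (norm_nonneg _) hle
      refine mul_le_mul_of_nonpos_right ?_ (mul_nonpos_of_nonneg_of_nonpos hr h)
      linarith
  rw [integral_const_mul, ← h1, ← h2] at h3
  linarith

/-- The symmetrized integrand is continuous and nonnegative, so one point where it is nonzero
suffices; `(e_j, e_j)` is such a point because it lies off the mirror. -/
lemma kernelForm_odd_pos (hρ : ∀ x, ρ (coordRefl j x) = ρ x) (hρ0 : ∀ x, 0 < ρ x)
    (hρc : Continuous ρ) (hint : Integrable fun x => ρ x * x j) :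
    0 < kernelForm (expKernel 1) (fun x => ρ x * x j) (fun x => ρ x * x j) := by
  obtain ⟨i1, h1⟩ := two_mul_kernelForm_odd hρ hint (zero_le_one' ℝ)
  have key : 0 < ∫ p : E3 × E3, (expKernel 1 ‖p.1 - p.2‖ - expKernel 1 ‖coordRefl j p.1 - p.2‖)
        * ((ρ p.1 * p.1 j) * (ρ p.2 * p.2 j)) := by
    have hcont : Continuous fun p : E3 × E3 =>
        (expKernel 1 ‖p.1 - p.2‖ - expKernel 1 ‖coordRefl j p.1 - p.2‖)
        * ((ρ p.1 * p.1 j) * (ρ p.2 * p.2 j)) := by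
      have c1 := (coordRefl j).continuous
      have c2 := continuous_expKernel 1
      fun_prop
    have hnn : ∀ p : E3 × E3, 0 ≤
        (expKernel 1 ‖p.1 - p.2‖ - expKernel 1 ‖coordRefl j p.1 - p.2‖)
        * ((ρ p.1 * p.1 j) * (ρ p.2 * p.2 j)) := by
      intro p
      have e := norm_coordRefl_sub_sq j p.1 p.2
      have hr := mul_pos (hρ0 p.1) (hρ0 p.2)
      rw [show ρ p.1 * p.1 j * (ρ p.2 * p.2 j) = (ρ p.1 * ρ p.2) * (p.1 j * p.2 j) by ring]
      rcases le_total 0 (p.1 j * p.2 j) with h | h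
      · have hle : ‖p.1 - p.2‖ ≤ ‖coordRefl j p.1 - p.2‖ :=
          (sq_le_sq₀ (norm_nonneg _) (norm_nonneg _)).1 (by linarith)
        exact mul_nonneg (sub_nonneg.2 (strictAnti_expKernel_one.antitone hle))
          (mul_nonneg hr.le h)
      · have hle : ‖coordRefl j p.1 - p.2‖ ≤ ‖p.1 - p.2‖ :=
          (sq_le_sq₀ (norm_nonneg _) (norm_nonneg _)).1 (by linarith)
        exact mul_nonneg_of_nonpos_of_nonpos (sub_nonpos.2 (strictAnti_expKernel_one.antitone hle))
          (mul_nonpos_of_nonneg_of_nonpos hr.le h)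
    rw [integral_pos_iff_support_of_nonneg hnn i1]
    refine hcont.isOpen_support.measure_pos _ ⟨(e3 j, e3 j), ?_⟩
    have hlt : ‖e3 j - e3 j‖ < ‖coordRefl j (e3 j) - e3 j‖ := by
      have e := norm_coordRefl_sub_sq j (e3 j) (e3 j)
      rw [sub_self, norm_zero] at e ⊢
      rw [norm_pos_iff]
      intro h
      rw [h, norm_zero] at e
      simp at e
    have h3 := expKernel_lt hlt
    have h4 := hρ0 (e3 j)
    rw [Function.mem_support]
    refine mul_ne_zero (sub_pos.2 h3).ne' ?_
    simpa using h4.ne'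
  linarith

end Odd

/-! ### Positivity of Gaussian and exponential kernels -/

/-- The parallelogram law about the midpoint of `x` and `y`: it splits a product of two Gaussians in
`z` into one centred at the midpoint and one in `x - y`. -/
lemma norm_sub_sq_add (x y z : E3) :
    ‖x - z‖ ^ 2 + ‖y - z‖ ^ 2 = 2 * ‖z - (1 / 2 : ℝ) • (x + y)‖ ^ 2 + ‖x - y‖ ^ 2 / 2 := by
  simp only [← sum_coord_sq, Fin.sum_univ_three]
  simp
  ring

lemma integrable_exp_neg_mul_norm_sq {b : ℝ} (hb : 0 < b) :
    Integrable fun z : E3 => Real.exp (-b * ‖z‖ ^ 2) := by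
  by_contra h
  -- A non-integrable function has integral zero by convention, whereas the Gaussian formula gives a
  -- positive value.
  have h1 := GaussianFourier.integral_rexp_neg_mul_sq_norm (V := E3) hb
  rw [integral_undef h] at h1
  have : 0 < (Real.pi / b) ^ ((Module.finrank ℝ E3 : ℝ) / 2) :=
    Real.rpow_pos_of_pos (div_pos Real.pi_pos hb) _
  linarith

/-- A Gaussian is, up to a positive factor, the self-convolution of a Gaussian of doubled exponent.
Inserting this and integrating over the midpoint variable `z` last makes the form an integral of
squares. -/
lemma kernelForm_gaussian_nonneg {u : ℝ} (hu : 0 ≤ u) {ψ : E3 → ℝ} (hψ : Integrable ψ) :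
    0 ≤ kernelForm (fun r => Real.exp (-u * r ^ 2)) ψ ψ := by
  have hform : Integrable fun p : E3 × E3 =>
      Real.exp (-u * ‖p.1 - p.2‖ ^ 2) * (ψ p.1 * ψ p.2) := by
    refine integrable_kernelForm (k := fun r => Real.exp (-u * r ^ 2)) (by fun_prop) (B := 1)
      (fun r _ => ?_) hψ hψ
    rw [Real.abs_exp, Real.exp_le_one_iff]
    nlinarith [sq_nonneg r, mul_nonneg hu (sq_nonneg r)]
  rcases hu.eq_or_lt with rfl | hu
  · simp only [kernelForm, neg_zero, zero_mul, Real.exp_zero, one_mul]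
    rw [Measure.volume_eq_prod, integral_prod_mul]
    exact mul_self_nonneg _
  set F : (E3 × E3) → E3 → ℝ := fun p z =>
    (Real.exp (-(2 * u) * ‖p.1 - z‖ ^ 2) * ψ p.1) * (Real.exp (-(2 * u) * ‖p.2 - z‖ ^ 2) * ψ p.2)
    with hF
  have hFeq : ∀ p z, F p z = (Real.exp (-u * ‖p.1 - p.2‖ ^ 2) * (ψ p.1 * ψ p.2))
      * Real.exp (-(4 * u) * ‖z - (1 / 2 : ℝ) • (p.1 + p.2)‖ ^ 2) := by
    intro p z
    have e : Real.exp (-(2 * u) * ‖p.1 - z‖ ^ 2) * Real.exp (-(2 * u) * ‖p.2 - z‖ ^ 2)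
        = Real.exp (-u * ‖p.1 - p.2‖ ^ 2)
          * Real.exp (-(4 * u) * ‖z - (1 / 2 : ℝ) • (p.1 + p.2)‖ ^ 2) := by
      rw [← Real.exp_add, ← Real.exp_add]
      congr 1
      linear_combination (-(2 * u)) * norm_sub_sq_add p.1 p.2 z
    simp only [hF]
    linear_combination (ψ p.1 * ψ p.2) * e
  have hg := integrable_exp_neg_mul_norm_sq (b := 4 * u) (by positivity)
  have hmeas : AEStronglyMeasurable (Function.uncurry F)
      (((volume : Measure E3).prod volume).prod volume) := by
    have m1 : AEStronglyMeasurable (fun q : (E3 × E3) × E3 => ψ q.1.1 * ψ q.1.2)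
        (((volume : Measure E3).prod volume).prod volume) :=
      (hψ.mul_prod hψ).aestronglyMeasurable.comp_fst
    have m2 : AEStronglyMeasurable (fun q : (E3 × E3) × E3 =>
        Real.exp (-(2 * u) * ‖q.1.1 - q.2‖ ^ 2) * Real.exp (-(2 * u) * ‖q.1.2 - q.2‖ ^ 2))
        (((volume : Measure E3).prod volume).prod volume) :=
      (Continuous.aestronglyMeasurable (by fun_prop))
    refine (m2.mul m1).congr (Eventually.of_forall fun q => ?_)
    simp only [Pi.mul_apply, Function.uncurry, hF]
    ring
  have hint : Integrable (Function.uncurry F)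
      (((volume : Measure E3).prod volume).prod volume) := by
    rw [integrable_prod_iff hmeas]
    refine ⟨Eventually.of_forall fun p => ?_, ?_⟩
    · simp only [Function.uncurry, hFeq]
      exact (hg.comp_sub_right _).const_mul _
    · simp only [Function.uncurry, hFeq, norm_mul, integral_const_mul]
      have e : ∀ p : E3 × E3, ∫ z : E3, ‖Real.exp (-(4 * u) * ‖z - (1 / 2 : ℝ) • (p.1 + p.2)‖ ^ 2)‖
          = ∫ z : E3, Real.exp (-(4 * u) * ‖z‖ ^ 2) := by
        intro p
        simp only [Real.norm_eq_abs, Real.abs_exp]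
        exact integral_sub_right_eq_self (fun z : E3 => Real.exp (-(4 * u) * ‖z‖ ^ 2)) _
      simp_rw [e]
      refine Integrable.mul_const ?_ _
      exact hform.norm.congr (Eventually.of_forall fun p => by simp only [norm_mul])
  have h1 : ∫ p : E3 × E3, ∫ z, F p z
      = kernelForm (fun r => Real.exp (-u * r ^ 2)) ψ ψ
        * ∫ z : E3, Real.exp (-(4 * u) * ‖z‖ ^ 2) := by
    simp only [hFeq, integral_const_mul]
    rw [kernelForm, ← integral_mul_const]
    refine integral_congr_ae (Eventually.of_forall fun p => ?_)
    simp only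
    rw [integral_sub_right_eq_self (fun z : E3 => Real.exp (-(4 * u) * ‖z‖ ^ 2))]
  have h2 : 0 ≤ ∫ p : E3 × E3, ∫ z, F p z := by
    rw [Measure.volume_eq_prod, integral_integral_swap hint]
    refine integral_nonneg fun z => ?_
    simp only [hF]
    rw [integral_prod_mul (fun x => Real.exp (-(2 * u) * ‖x - z‖ ^ 2) * ψ x)
      (fun x => Real.exp (-(2 * u) * ‖x - z‖ ^ 2) * ψ x)]
    exact mul_self_nonneg _
  have h3 : 0 < ∫ z : E3, Real.exp (-(4 * u) * ‖z‖ ^ 2) := by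
    rw [GaussianFourier.integral_rexp_neg_mul_sq_norm (by positivity)]
    exact Real.rpow_pos_of_pos (div_pos Real.pi_pos (by positivity)) _
  rw [h1] at h2
  exact nonneg_of_mul_nonneg_left h2 h3

/-- The substitution `v = w - c/w` maps the half-line onto the whole line, with inverse `w = (v +
√(v² + 4c)) / 2`. The Jacobian is one half plus an odd function of `v`, and the odd part integrates
to zero against the Gaussian. -/
lemma integral_Ioi_exp_neg_sub_div_sq {c : ℝ} (hc : 0 < c) :
    ∫ w in Ioi (0 : ℝ), Real.exp (-(w - c / w) ^ 2) = √Real.pi / 2 := by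
  have hq : ∀ v : ℝ, 0 < v ^ 2 + 4 * c := fun v => by positivity
  have hlt : ∀ v : ℝ, |v| < √(v ^ 2 + 4 * c) := fun v => by
    rw [← Real.sqrt_sq_eq_abs]
    exact Real.sqrt_lt_sqrt (sq_nonneg v) (by linarith)
  have hw : ∀ v : ℝ, 0 < (v + √(v ^ 2 + 4 * c)) / 2 := fun v => by
    have := neg_abs_le v
    linarith [hlt v]
  have hquad : ∀ v : ℝ, (v + √(v ^ 2 + 4 * c)) / 2 - c / ((v + √(v ^ 2 + 4 * c)) / 2) = v := by
    intro v
    have h1 := Real.sq_sqrt (hq v).le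
    have h2 := (hw v).ne'
    have h3 : v + √(v ^ 2 + 4 * c) ≠ 0 := by
      intro h
      rw [h] at h2
      simp at h2
    field_simp
    linear_combination h1
  have hder : ∀ v ∈ (univ : Set ℝ), HasDerivWithinAt (fun v => (v + √(v ^ 2 + 4 * c)) / 2)
      ((1 + v / √(v ^ 2 + 4 * c)) / 2) univ v := by
    intro v _
    have h1 : HasDerivAt (fun v : ℝ => v ^ 2 + 4 * c) (2 * v) v := by
      simpa using (hasDerivAt_pow 2 v).add_const (4 * c)
    have h2 := (((hasDerivAt_id v).add (h1.sqrt (hq v).ne')).div_const 2)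
    refine (h2.congr_deriv ?_).hasDerivWithinAt
    have : √(v ^ 2 + 4 * c) ≠ 0 := (Real.sqrt_pos.2 (hq v)).ne'
    field_simp
  have hinj : InjOn (fun v => (v + √(v ^ 2 + 4 * c)) / 2) univ := by
    intro v _ v' _ h
    have h' : (v + √(v ^ 2 + 4 * c)) / 2 = (v' + √(v' ^ 2 + 4 * c)) / 2 := h
    rw [← hquad v, ← hquad v', h']
  have himg : (fun v => (v + √(v ^ 2 + 4 * c)) / 2) '' univ = Ioi 0 := by
    ext w
    constructor
    · rintro ⟨v, -, rfl⟩
      exact hw v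
    · intro h
      have h : 0 < w := h
      refine ⟨w - c / w, mem_univ _, ?_⟩
      have e : (w - c / w) ^ 2 + 4 * c = (w + c / w) ^ 2 := by
        field_simp
        ring
      have : 0 < w + c / w := by positivity
      simp only [e, Real.sqrt_sq this.le]
      ring
  have habs : ∀ v : ℝ, |v / √(v ^ 2 + 4 * c)| ≤ 1 := fun v => by
    rw [abs_div, abs_of_pos (Real.sqrt_pos.2 (hq v)), div_le_one (Real.sqrt_pos.2 (hq v))]
    exact (hlt v).le
  rw [← himg, integral_image_eq_integral_abs_deriv_smul MeasurableSet.univ hder hinj]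
  have e1 : ∀ v : ℝ, |(1 + v / √(v ^ 2 + 4 * c)) / 2| •
      Real.exp (-((v + √(v ^ 2 + 4 * c)) / 2 - c / ((v + √(v ^ 2 + 4 * c)) / 2)) ^ 2)
      = 1 / 2 * Real.exp (-1 * v ^ 2) + 1 / 2 * (v / √(v ^ 2 + 4 * c) * Real.exp (-1 * v ^ 2)) := by
    intro v
    have := abs_le.1 (habs v)
    rw [hquad, abs_of_nonneg (by linarith), smul_eq_mul, neg_one_mul]
    ring
  have i1 : Integrable fun v : ℝ => Real.exp (-1 * v ^ 2) := integrable_exp_neg_mul_sq one_pos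
  have hcd : Continuous fun v : ℝ => v / √(v ^ 2 + 4 * c) :=
    continuous_id.div (by fun_prop) fun v => (Real.sqrt_pos.2 (hq v)).ne'
  have i2 : Integrable fun v : ℝ => v / √(v ^ 2 + 4 * c) * Real.exp (-1 * v ^ 2) :=
    i1.bdd_mul (c := 1) hcd.aestronglyMeasurable (Eventually.of_forall habs)
  have i3 : ∫ v : ℝ, v / √(v ^ 2 + 4 * c) * Real.exp (-1 * v ^ 2) = 0 := by
    have h := integral_neg_eq_self (fun v : ℝ => v / √(v ^ 2 + 4 * c) * Real.exp (-1 * v ^ 2)) volume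
    simp only [neg_sq, neg_div, neg_mul, integral_neg] at h
    simp only [neg_mul]
    linarith
  simp only [e1]
  rw [setIntegral_univ, integral_add (i1.const_mul _) (i2.const_mul _), integral_const_mul,
    integral_const_mul, i3, integral_gaussian]
  simp
  ring

/-- The exponential is a mixture of Gaussians. -/
lemma exp_neg_eq_integral_gaussian {s : ℝ} (hs : 0 ≤ s) :
    Real.exp (-s)
      = (2 / √Real.pi) * ∫ w in Ioi (0 : ℝ), Real.exp (-w ^ 2) * Real.exp (-(1 / (4 * w ^ 2)) * s ^ 2) := by
  have hpi : 0 < √Real.pi := Real.sqrt_pos.2 Real.pi_pos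
  rcases hs.eq_or_lt with rfl | hs
  · have := integral_gaussian_Ioi 1
    simp only [neg_mul, one_mul, div_one] at this
    simp [this]
    field_simp
  · have h := integral_Ioi_exp_neg_sub_div_sq (c := s / 2) (by positivity)
    -- Completing the square: `w² + s²/(4w²) = (w - s/(2w))² + s`.
    have e : ∫ w in Ioi (0 : ℝ), Real.exp (-w ^ 2) * Real.exp (-(1 / (4 * w ^ 2)) * s ^ 2)
        = ∫ w in Ioi (0 : ℝ), Real.exp (-s) * Real.exp (-(w - s / 2 / w) ^ 2) := by
      refine setIntegral_congr_fun measurableSet_Ioi fun w hw => ?_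
      have hw : (0 : ℝ) < w := hw
      rw [← Real.exp_add, ← Real.exp_add]
      congr 1
      field_simp
      ring
    rw [e, integral_const_mul, h]
    field_simp

/-- Positivity passes from Gaussians to exponentials by Fubini, since the mixing density `e^{-w²}`
is positive. -/
lemma kernelForm_exp_nonneg {t : ℝ} (ht : 0 ≤ t) {ψ : E3 → ℝ} (hψ : Integrable ψ) :
    0 ≤ kernelForm (fun r => Real.exp (-(t * r))) ψ ψ := by
  set μ : Measure ℝ := volume.restrict (Ioi 0) with hμ
  set F : (E3 × E3) → ℝ → ℝ := fun p w =>
    (Real.exp (-w ^ 2) * Real.exp (-(1 / (4 * w ^ 2)) * (t * ‖p.1 - p.2‖) ^ 2)) * (ψ p.1 * ψ p.2)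
    with hF
  have hg : Integrable (fun w : ℝ => Real.exp (-w ^ 2)) μ := by
    simpa using (integrable_exp_neg_mul_sq one_pos).restrict (s := Ioi 0)
  have hint : Integrable (Function.uncurry F) (((volume : Measure E3).prod volume).prod μ) := by
    have h1 : Integrable (fun q : (E3 × E3) × ℝ => (ψ q.1.1 * ψ q.1.2) * Real.exp (-q.2 ^ 2))
        (((volume : Measure E3).prod volume).prod μ) := (hψ.mul_prod hψ).mul_prod hg
    have h2 := h1.bdd_mul (c := 1) (f := fun q : (E3 × E3) × ℝ =>
      Real.exp (-(1 / (4 * q.2 ^ 2)) * (t * ‖q.1.1 - q.1.2‖) ^ 2)) ?_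
      (Eventually.of_forall fun q => ?_)
    · refine h2.congr (Eventually.of_forall fun q => ?_)
      simp only [Function.uncurry, hF]
      ring
    · exact Measurable.aestronglyMeasurable (by fun_prop)
    · rw [Real.norm_eq_abs, Real.abs_exp, Real.exp_le_one_iff, neg_mul, neg_nonpos]
      positivity
  have h1 : kernelForm (fun r => Real.exp (-(t * r))) ψ ψ
      = (2 / √Real.pi) * ∫ p : E3 × E3, ∫ w, F p w ∂μ := by
    rw [kernelForm, ← integral_const_mul]
    refine integral_congr_ae (Eventually.of_forall fun p => ?_)
    simp only [hF]
    rw [exp_neg_eq_integral_gaussian (s := t * ‖p.1 - p.2‖) (by positivity), integral_mul_const]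
    ring
  rw [h1, Measure.volume_eq_prod, integral_integral_swap hint]
  refine mul_nonneg (by positivity) (integral_nonneg fun w => ?_)
  have h2 := kernelForm_gaussian_nonneg (u := 1 / (4 * w ^ 2) * t ^ 2) (by positivity) hψ
  have h3 : ∫ p : E3 × E3, F p w = Real.exp (-w ^ 2)
      * kernelForm (fun r => Real.exp (-(1 / (4 * w ^ 2) * t ^ 2) * r ^ 2)) ψ ψ := by
    rw [kernelForm, ← integral_const_mul]
    refine integral_congr_ae (Eventually.of_forall fun p => ?_)
    simp only [hF]
    rw [show -(1 / (4 * w ^ 2)) * (t * ‖p.1 - p.2‖) ^ 2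
      = -(1 / (4 * w ^ 2) * t ^ 2) * ‖p.1 - p.2‖ ^ 2 by ring]
    ring
  change 0 ≤ ∫ p : E3 × E3, F p w
  rw [h3]
  positivity

/-- Uniform positivity of the form of `k_a`, `0 ≤ a ≤ 1`, on functions of nonzero mean. -/
lemma exists_le_kernelForm_expKernel {ψ : E3 → ℝ} (hψ : Integrable ψ) (h0 : ∫ x, ψ x ≠ 0) :
    ∃ c : ℝ, 0 < c ∧ ∀ a : ℝ, 0 ≤ a → a ≤ 1 → c ≤ kernelForm (expKernel a) ψ ψ := by
  -- The form of `k_a` is the average of `P (a τ)` over `0 ≤ τ ≤ 1`. It remains to know that `P` is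
  -- nonnegative and that near zero it stays close to the squared mean `P 0`.
  set P : ℝ → ℝ := fun t => kernelForm (fun r => Real.exp (-(t * r))) ψ ψ with hP
  have hP0 : P 0 = (∫ x, ψ x) ^ 2 := by
    simp only [hP, kernelForm, zero_mul, neg_zero, Real.exp_zero, one_mul]
    rw [Measure.volume_eq_prod, integral_prod_mul, sq]
  have hP0pos : 0 < P 0 := by rw [hP0]; positivity
  have hlim : Tendsto P (𝓝[≥] 0) (𝓝 (P 0)) := by
    simp only [hP, kernelForm]
    refine tendsto_integral_filter_of_dominated_convergence (fun p : E3 × E3 => ‖ψ p.1 * ψ p.2‖)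
      (Eventually.of_forall fun t => ?_) ?_ (hψ.mul_prod hψ).norm
      (Eventually.of_forall fun p => ?_)
    · exact (Continuous.aestronglyMeasurable (by fun_prop)).mul
        (hψ.mul_prod hψ).aestronglyMeasurable
    · filter_upwards [self_mem_nhdsWithin] with t ht
      refine Eventually.of_forall fun p => ?_
      rw [norm_mul, Real.norm_eq_abs, Real.abs_exp]
      refine mul_le_of_le_one_left (norm_nonneg _) (Real.exp_le_one_iff.2 ?_)
      have ht : 0 ≤ t := ht
      rw [neg_nonpos]
      positivity
    · have hc : Continuous fun t : ℝ => Real.exp (-(t * ‖p.1 - p.2‖)) * (ψ p.1 * ψ p.2) := by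
        fun_prop
      exact hc.continuousWithinAt
  obtain ⟨ε, hε, hεP⟩ : ∃ ε > 0, ∀ t, 0 ≤ t → t < ε → P 0 / 2 ≤ P t := by
    have h1 := hlim.eventually (eventually_ge_nhds (half_lt_self hP0pos))
    obtain ⟨ε, hε, h2⟩ := Metric.mem_nhdsWithin_iff.1 h1
    refine ⟨ε, hε, fun t ht0 ht => h2 ⟨?_, ht0⟩⟩
    simpa [abs_of_nonneg ht0] using ht
  -- For `τ ≤ t₀` and every `a ≤ 1` the argument `a τ` stays below `ε`, so one interval of averaging
  -- works for all `a`; the rest of the average is discarded by positivity.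
  set t₀ := min (ε / 2) 1 with ht₀
  have ht₀pos : 0 < t₀ := lt_min (by positivity) one_pos
  refine ⟨t₀ * (P 0 / 2), by positivity, fun a ha ha1 => ?_⟩
  set μ : Measure ℝ := volume.restrict (Ioc 0 1) with hμ
  set F : (E3 × E3) → ℝ → ℝ := fun p τ =>
    Real.exp (-(a * ‖p.1 - p.2‖ * τ)) * (ψ p.1 * ψ p.2) with hF
  have hint : Integrable (Function.uncurry F) (((volume : Measure E3).prod volume).prod μ) := by
    have h1 : Integrable (fun q : (E3 × E3) × ℝ => (ψ q.1.1 * ψ q.1.2) * 1)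
        (((volume : Measure E3).prod volume).prod μ) :=
      (hψ.mul_prod hψ).mul_prod (integrable_const (1 : ℝ))
    refine h1.norm.mono' ?_ ?_
    · have := h1.aestronglyMeasurable
      simp only [mul_one] at this
      exact (Continuous.aestronglyMeasurable (by fun_prop)).mul this
    · have hτ : ∀ᵐ q : (E3 × E3) × ℝ ∂(((volume : Measure E3).prod volume).prod μ), q.2 ∈ Ioc (0 : ℝ) 1 :=
        Measure.quasiMeasurePreserving_snd.ae (ae_restrict_mem measurableSet_Ioc)
      filter_upwards [hτ] with q hq
      simp only [Function.uncurry, hF, mul_one]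
      rw [norm_mul, Real.norm_eq_abs (Real.exp _), Real.abs_exp]
      refine mul_le_of_le_one_left (norm_nonneg _) (Real.exp_le_one_iff.2 ?_)
      have := hq.1.le
      rw [neg_nonpos]
      positivity
  have h1 : kernelForm (expKernel a) ψ ψ = ∫ τ, P (a * τ) ∂μ := by
    have e : kernelForm (expKernel a) ψ ψ = ∫ p : E3 × E3, ∫ τ, F p τ ∂μ := by
      rw [kernelForm]
      refine integral_congr_ae (Eventually.of_forall fun p => ?_)
      simp only [hF, expKernel]
      rw [integral_mul_const, intervalIntegral.integral_of_le zero_le_one]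
    rw [e, Measure.volume_eq_prod, integral_integral_swap hint]
    refine integral_congr_ae (Eventually.of_forall fun τ => ?_)
    simp only [hF, hP, kernelForm, Measure.volume_eq_prod]
    refine integral_congr_ae (Eventually.of_forall fun p => ?_)
    simp only
    ring_nf
  have hPi : Integrable (fun τ => P (a * τ)) μ := by
    have h2 := hint.integral_prod_right
    refine h2.congr (Eventually.of_forall fun τ => ?_)
    simp only [hF, hP, kernelForm, Measure.volume_eq_prod, Function.uncurry]
    refine integral_congr_ae (Eventually.of_forall fun p => ?_)
    simp only
    ring_nf
  rw [h1]
  have hsub : Ioc (0 : ℝ) t₀ ⊆ Ioc 0 1 := Ioc_subset_Ioc_right (min_le_right _ _)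
  calc t₀ * (P 0 / 2) = ∫ _ in Ioc (0 : ℝ) t₀, P 0 / 2 := by simp [ht₀pos.le]
    _ ≤ ∫ τ in Ioc (0 : ℝ) t₀, P (a * τ) := by
      refine setIntegral_mono_on (by simp) (IntegrableOn.mono_set hPi hsub) measurableSet_Ioc
        fun τ hτ => hεP _ (mul_nonneg ha hτ.1.le) ?_
      have h3 : τ ≤ ε / 2 := hτ.2.trans (min_le_left _ _)
      have h4 : a * τ ≤ τ := mul_le_of_le_one_left hτ.1.le ha1
      linarith
    _ ≤ ∫ τ, P (a * τ) ∂μ := by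
      refine setIntegral_mono_set hPi ?_ hsub.eventuallyLE
      filter_upwards [ae_restrict_mem measurableSet_Ioc] with τ hτ
      exact kernelForm_exp_nonneg (mul_nonneg ha hτ.1.le) hψ

/-! ### Test profiles -/

/-- Decay and weighted Lipschitz bounds for a test profile. -/
structure ProfileBound (C : ℝ) (g : E3 → ℝ) : Prop where
  continuous : Continuous g
  abs_le : ∀ x, |g x| ≤ C * wt x ^ 4
  abs_sub_le : ∀ x y, |g x - g y| ≤ C * ‖x - y‖ * (wt x ^ 4 + wt y ^ 4)

lemma ProfileBound.mono {C D : ℝ} {g : E3 → ℝ} (h : ProfileBound C g) (hCD : C ≤ D) :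
    ProfileBound D g where
  continuous := h.continuous
  abs_le x := (h.abs_le x).trans (by have := pow_nonneg (wt_nonneg x) 4; gcongr)
  abs_sub_le x y := (h.abs_sub_le x y).trans (by
    have := pow_nonneg (wt_nonneg x) 4
    have := pow_nonneg (wt_nonneg y) 4
    gcongr)

/-- The relation between `W²` and `|x|²` gives `W(x)² - W(y)² = W(x)² W(y)² (|y|² - |x|²)/3`, and
`W² |x| ≤ 2` absorbs the growth of `|x| + |y|`. The constant is `2/3 · 2 · 3⁴`. -/
lemma abs_talenti_pow_four_sub_le (x y : E3) :
    |talenti x ^ 4 - talenti y ^ 4| ≤ 108 * ‖x - y‖ * (wt x ^ 4 + wt y ^ 4) := by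
  have hx := talenti_pos x
  have hy := talenti_pos y
  have ex := talenti_sq_mul x
  have ey := talenti_sq_mul y
  have bx : talenti x ^ 2 * ‖x‖ ≤ 2 := by
    have h1 := talenti_mul_norm_le x
    have h2 := talenti_le_one x
    nlinarith [mul_nonneg hx.le (norm_nonneg x)]
  have bY : talenti y ^ 2 * ‖y‖ ≤ 2 := by
    have h1 := talenti_mul_norm_le y
    have h2 := talenti_le_one y
    nlinarith [mul_nonneg hy.le (norm_nonneg y)]
  have hn : |‖y‖ - ‖x‖| ≤ ‖x - y‖ := by
    rw [norm_sub_rev]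
    exact abs_norm_sub_norm_le y x
  have e : talenti x ^ 2 - talenti y ^ 2
      = ((‖y‖ - ‖x‖) / 3) * (talenti x ^ 2 * ‖x‖ * talenti y ^ 2
        + talenti y ^ 2 * ‖y‖ * talenti x ^ 2) := by
    linear_combination (talenti y ^ 2) * ex - (talenti x ^ 2) * ey
  have h1 : |talenti x ^ 2 - talenti y ^ 2|
      ≤ ‖x - y‖ / 3 * (2 * talenti y ^ 2 + 2 * talenti x ^ 2) := by
    rw [e, abs_mul, abs_div, abs_of_pos (by norm_num : (0 : ℝ) < 3)]
    have hp : 0 ≤ talenti x ^ 2 * ‖x‖ * talenti y ^ 2 + talenti y ^ 2 * ‖y‖ * talenti x ^ 2 := by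
      positivity
    rw [abs_of_nonneg hp]
    gcongr
  have e2 : talenti x ^ 4 - talenti y ^ 4
      = (talenti x ^ 2 - talenti y ^ 2) * (talenti x ^ 2 + talenti y ^ 2) := by ring
  have hx4 := talenti_pow_le_wt 4 x
  have hy4 := talenti_pow_le_wt 4 y
  rw [e2, abs_mul, abs_of_pos (by positivity : 0 < talenti x ^ 2 + talenti y ^ 2)]
  calc |talenti x ^ 2 - talenti y ^ 2| * (talenti x ^ 2 + talenti y ^ 2)
      ≤ ‖x - y‖ / 3 * (2 * talenti y ^ 2 + 2 * talenti x ^ 2) * (talenti x ^ 2 + talenti y ^ 2) := by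
        gcongr
    _ = 2 / 3 * ‖x - y‖ * (talenti x ^ 2 + talenti y ^ 2) ^ 2 := by ring
    _ ≤ 2 / 3 * ‖x - y‖ * (2 * (talenti x ^ 4 + talenti y ^ 4)) := by
        gcongr
        nlinarith [sq_nonneg (talenti x ^ 2 - talenti y ^ 2)]
    _ ≤ 2 / 3 * ‖x - y‖ * (2 * (3 ^ 4 * wt x ^ 4 + 3 ^ 4 * wt y ^ 4)) := by gcongr
    _ = _ := by ring

/-- The range `|c| ≤ 5` covers both potentials, `-5 W⁴` and `-W⁴`. The decay comes entirely from
`W⁴`, so the factor `U` need only be bounded and Lipschitz. -/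
lemma profileBound_mul {c B : ℝ} (hc : |c| ≤ 5) {U : E3 → ℝ} (hUc : Continuous U)
    (hU : ∀ x, |U x| ≤ B) (hU' : ∀ x y, |U x - U y| ≤ B * ‖x - y‖) :
    ProfileBound (1000 * B) fun x => c * talenti x ^ 4 * U x where
  continuous := (continuous_const.mul (continuous_talenti.pow 4)).mul hUc
  abs_le x := by
    have hB : 0 ≤ B := (abs_nonneg _).trans (hU 0)
    have hx := talenti_pos x
    have hw := pow_nonneg (wt_nonneg x) 4
    rw [abs_mul, abs_mul, abs_of_pos (pow_pos hx 4)]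
    calc |c| * talenti x ^ 4 * |U x| ≤ 5 * (3 ^ 4 * wt x ^ 4) * B := by
          gcongr
          exacts [talenti_pow_le_wt 4 x, hU x]
      _ = 405 * (B * wt x ^ 4) := by ring
      _ ≤ 1000 * (B * wt x ^ 4) := by gcongr; norm_num
      _ = _ := by ring
  abs_sub_le x y := by
    have hB : 0 ≤ B := (abs_nonneg _).trans (hU 0)
    have hy := talenti_pos y
    have hwx := pow_nonneg (wt_nonneg x) 4
    have hwy := pow_nonneg (wt_nonneg y) 4
    have e : c * talenti x ^ 4 * U x - c * talenti y ^ 4 * U y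
        = c * ((talenti x ^ 4 - talenti y ^ 4) * U x + talenti y ^ 4 * (U x - U y)) := by ring
    rw [e, abs_mul]
    calc |c| * |(talenti x ^ 4 - talenti y ^ 4) * U x + talenti y ^ 4 * (U x - U y)|
        ≤ 5 * ((108 * ‖x - y‖ * (wt x ^ 4 + wt y ^ 4)) * B
            + (3 ^ 4 * wt y ^ 4) * (B * ‖x - y‖)) := by
          gcongr
          refine (abs_add_le _ _).trans (add_le_add ?_ ?_)
          · rw [abs_mul]
            gcongr
            exacts [abs_talenti_pow_four_sub_le x y, hU x]
          · rw [abs_mul, abs_of_pos (pow_pos hy 4)]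
            gcongr
            exacts [talenti_pow_le_wt 4 y, hU' x y]
      _ = B * ‖x - y‖ * (540 * wt x ^ 4 + 945 * wt y ^ 4) := by ring
      _ ≤ B * ‖x - y‖ * (1000 * wt x ^ 4 + 1000 * wt y ^ 4) := by gcongr <;> norm_num
      _ = _ := by ring

lemma continuous_of_abs_sub_le {U : E3 → ℝ} {B : ℝ} (h : ∀ x y, |U x - U y| ≤ B * ‖x - y‖) :
    Continuous U := by
  refine (LipschitzWith.of_dist_le_mul (K := B.toNNReal) fun x y => ?_).continuous
  rw [Real.dist_eq, dist_eq_norm]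
  exact (h x y).trans (by gcongr; exact Real.le_coe_toNNReal B)

lemma profileBound_expPotential {c a : ℝ} (hc : |c| ≤ 5) (ha : 0 ≤ a) (ha1 : a ≤ 1)
    {ψ : E3 → ℝ} (hψ : Integrable ψ) :
    ProfileBound (1000 * ∫ y, |ψ y|) fun x => c * talenti x ^ 4 * expPotential a ψ x := by
  have h0 : 0 ≤ ∫ y, |ψ y| := integral_nonneg fun _ => abs_nonneg _
  have h : ∀ x y, |expPotential a ψ x - expPotential a ψ y| ≤ (∫ y, |ψ y|) * ‖x - y‖ :=
    fun x y => (abs_expPotential_sub_le ha hψ x y).trans (by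
      gcongr
      exact mul_le_of_le_one_left h0 ha1)
  exact profileBound_mul hc (continuous_of_abs_sub_le h) (abs_expPotential_le ha hψ) h

/-- Both estimates of the potential carry a factor `a`: the Lipschitz one from the kernel, the
uniform one from the vanishing mean. The division by `a` is therefore harmless. -/
lemma profileBound_expPotential_of_integral_eq_zero {c a : ℝ} (hc : |c| ≤ 5) (ha : 0 < a)
    {ψ : E3 → ℝ} (hψ : Integrable ψ) (hψ1 : Integrable fun y => ‖y‖ * |ψ y|)
    (h0 : ∫ y, ψ y = 0) :
    ProfileBound (1000 * ((∫ y, |ψ y|) + ∫ y, ‖y‖ * |ψ y|))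
      fun x => c * talenti x ^ 4 * (a⁻¹ * expPotential a ψ x) := by
  have n1 : 0 ≤ ∫ y, |ψ y| := integral_nonneg fun _ => abs_nonneg _
  have n2 : 0 ≤ ∫ y, ‖y‖ * |ψ y| := integral_nonneg fun _ => by positivity
  have h : ∀ x y, |a⁻¹ * expPotential a ψ x - a⁻¹ * expPotential a ψ y|
      ≤ ((∫ y, |ψ y|) + ∫ y, ‖y‖ * |ψ y|) * ‖x - y‖ := by
    intro x y
    rw [← mul_sub, abs_mul, abs_of_pos (inv_pos.2 ha)]
    calc a⁻¹ * |expPotential a ψ x - expPotential a ψ y|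
        ≤ a⁻¹ * ((a * ∫ y, |ψ y|) * ‖x - y‖) := by
          gcongr
          exact abs_expPotential_sub_le ha.le hψ x y
      _ = (∫ y, |ψ y|) * ‖x - y‖ := by field_simp
      _ ≤ _ := by gcongr; linarith
  refine profileBound_mul hc (continuous_of_abs_sub_le h) (fun x => ?_) h
  rw [abs_mul, abs_of_pos (inv_pos.2 ha), inv_mul_le_iff₀ ha]
  refine (abs_expPotential_le_of_integral_eq_zero ha.le hψ hψ1 h0 x).trans ?_
  gcongr
  linarith

/-- The test profile of the translation direction `e_j`. -/
def translProfile (a : ℝ) (j : Fin 3) (x : E3) : ℝ :=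
  Vplus x * (a⁻¹ * expPotential a (fun y => Vplus y * partialD j talenti y) x)

/-- The test profile of the scaling direction. -/
def scaleProfile (a : ℝ) (x : E3) : ℝ :=
  Vplus x * expPotential a (fun y => Vplus y * lam talenti y) x

/-- The test profile of the phase direction. -/
def phaseProfile (a : ℝ) (x : E3) : ℝ :=
  Vminus x * expPotential a (fun y => Vminus y * talenti y) x

lemma decayingLap_talenti_Vminus :
    DecayingLap talenti (fun j x => -(1 / 3) * talenti x ^ 3 * x j)
      (fun x => Vminus x * talenti x) := by
  convert decayingLap_talenti using 2 with x
  rw [Vminus]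
  ring

/-- The scalar is of order `α` rather than `√α` because the profile already contains the factor
`a⁻¹`, `a = √α`. -/
lemma Gstar_transl {α : ℝ} (hα : 0 < α) (j : Fin 3) (x : E3) :
    Gstar α (fun x => ((Vplus x * partialD j talenti x : ℝ) : ℂ)) x
      = ((-(α / (4 * Real.pi)) * translProfile (√α) j x : ℝ) : ℂ) := by
  rw [Gstar_ofReal_mul (decayingLap_partialD_talenti j), translProfile]
  congr 1
  have h1 := Real.sqrt_pos.2 hα
  have h2 := Real.mul_self_sqrt hα.le
  have hpi := Real.pi_pos
  field_simp
  linear_combination (-expPotential (√α) (fun y => Vplus y * partialD j talenti y) x * Vplus x) * h2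

lemma Gstar_scale (α : ℝ) (x : E3) :
    Gstar α (fun x => ((Vplus x * lam talenti x : ℝ) : ℂ)) x
      = ((-(√α / (4 * Real.pi)) * scaleProfile (√α) x : ℝ) : ℂ) :=
  Gstar_ofReal_mul decayingLap_lam_talenti α x

lemma Gstar_phase (α : ℝ) (x : E3) :
    Gstar α (fun x => Complex.I * ((Vminus x * talenti x : ℝ) : ℂ)) x
      = -Complex.I * ((-(√α / (4 * Real.pi)) * phaseProfile (√α) x : ℝ) : ℂ) :=
  Gstar_I_mul decayingLap_talenti_Vminus α x

lemma Vplus_mul_partialD (j : Fin 3) :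
    (fun x => Vplus x * partialD j talenti x) = fun x => (5 / 3 * talenti x ^ 7) * x j := by
  funext x
  rw [Vplus, partialD_talenti']
  ring

lemma talenti_coordRefl (j : Fin 3) (x : E3) : talenti (coordRefl j x) = talenti x := by
  simp [talenti]

lemma integral_Vplus_mul_partialD (j : Fin 3) : ∫ x, Vplus x * partialD j talenti x = 0 := by
  rw [Vplus_mul_partialD]
  refine integral_eq_zero_of_odd j fun x => ?_
  simp [talenti_coordRefl, coordRefl_apply]

lemma integrable_norm_mul_Vplus_mul_partialD (j : Fin 3) :
    Integrable fun x => ‖x‖ * |Vplus x * partialD j talenti x| := by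
  have e : ∀ x, Vplus x * partialD j talenti x = (5 / 3 * talenti x ^ 7) * x j := fun x =>
    congrFun (Vplus_mul_partialD j) x
  simp_rw [e]
  refine integrable_of_le_wt (n := 5) (C := 5 / 3 * 4 * 3 ^ 5) (by norm_num)
    (Continuous.aestronglyMeasurable ?_) fun x => ?_
  · have := continuous_talenti
    fun_prop
  · have h1 := talenti_pos x
    have h2 := abs_coord_le x j
    have h3 := talenti_mul_norm_le x
    have h4 := talenti_pow_le_wt 5 x
    rw [norm_mul, norm_norm, Real.norm_eq_abs, abs_abs, abs_mul,
      abs_of_pos (by positivity : 0 < 5 / 3 * talenti x ^ 7)]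
    calc ‖x‖ * (5 / 3 * talenti x ^ 7 * |x j|) ≤ ‖x‖ * (5 / 3 * talenti x ^ 7 * ‖x‖) := by gcongr
      _ = 5 / 3 * (talenti x * ‖x‖) * (talenti x * ‖x‖) * talenti x ^ 5 := by ring
      _ ≤ 5 / 3 * 2 * 2 * (3 ^ 5 * wt x ^ 5) := by gcongr
      _ = _ := by ring

/-- Integrate the divergence of the field `W⁵ x`, which is `5 W⁷ - 2 W⁵`. -/
lemma integral_talenti_pow_seven : 5 * ∫ x, talenti x ^ 7 = 2 * ∫ x, talenti x ^ 5 := by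
  have hd : ∀ x, ∑ j, fderiv ℝ (fun x : E3 => 1 * talenti x ^ (4 + 1) * x j) x (e3 j)
      = 5 * talenti x ^ 7 - 2 * talenti x ^ 5 := by
    intro x
    simp_rw [fderiv_talenti_pow_mul_coord 4]
    have h := sum_coord_sq x
    have h2 := talenti_sq_mul x
    simp only [Fin.sum_univ_three] at h ⊢
    simp
    linear_combination (-5 / 3 * talenti x ^ 7) * h - 5 * talenti x ^ 5 * h2
  have i1 := (integrable_talenti_pow (n := 7) (by norm_num)).const_mul 5
  have i2 := (integrable_talenti_pow (n := 5) (by norm_num)).const_mul 2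
  have key := integral_divergence_eq_zero (Φ := fun j x => 1 * talenti x ^ (4 + 1) * x j)
    (fun j => (contDiff_const.mul (contDiff_talenti.pow 5)).mul (contDiff_coord j))
    (fun j => by
      refine integrable_of_le_wt (n := 5) (C := 2 * 3 ^ 4) (by norm_num)
        (continuous_wt.mul ((continuous_const.mul (continuous_talenti.pow 5)).mul
          (contDiff_coord (n := 0) j).continuous)).aestronglyMeasurable fun x => ?_
      rw [norm_mul, Real.norm_of_nonneg (wt_nonneg x), one_mul, pow_succ' (wt x)]
      have := mul_le_mul_of_nonneg_left (abs_talenti_pow_mul_coord_le 4 j x) (wt_nonneg x)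
      rw [Real.norm_eq_abs]
      linarith)
    ((i1.sub i2).congr (Eventually.of_forall fun x => (hd x).symm))
  simp_rw [hd] at key
  rw [integral_sub i1 i2, integral_const_mul, integral_const_mul] at key
  linarith

lemma integral_talenti_pow_five_pos : 0 < ∫ x, talenti x ^ 5 := by
  rw [integral_talenti_pow_five]
  have := Real.pi_pos
  positivity

/-- The integrand is `5/2 W⁵ - 5 W⁷`, so by the preceding moment identity the mean is half of `∫
W⁵`. -/
lemma integral_Vplus_mul_lam_ne_zero : ∫ x, Vplus x * lam talenti x ≠ 0 := by
  have e : ∀ x, Vplus x * lam talenti x = 5 / 2 * talenti x ^ 5 - 5 * talenti x ^ 7 := fun x => by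
    rw [lam_talenti, Vplus]
    ring
  have h := integral_talenti_pow_five_pos
  have h7 := integral_talenti_pow_seven
  simp_rw [e]
  rw [integral_sub ((integrable_talenti_pow (by norm_num)).const_mul _)
    ((integrable_talenti_pow (by norm_num)).const_mul _), integral_const_mul, integral_const_mul]
  linarith

lemma integral_Vminus_mul_talenti_ne_zero : ∫ x, Vminus x * talenti x ≠ 0 := by
  have e : ∀ x, Vminus x * talenti x = -talenti x ^ 5 := fun x => by
    rw [Vminus]
    ring
  have h := integral_talenti_pow_five_pos
  simp_rw [e]
  rw [integral_neg]
  linarith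

/-- The test profiles are bounded uniformly in the spectral parameter. -/
lemma exists_profileBound : ∃ C : ℝ, 0 < C ∧ ∀ a : ℝ, 0 < a → a ≤ 1 →
    (∀ j, ProfileBound C (translProfile a j)) ∧ ProfileBound C (scaleProfile a) ∧
      ProfileBound C (phaseProfile a) := by
  set A : Fin 3 → ℝ := fun j => 1000 * ((∫ y, |Vplus y * partialD j talenti y|)
    + ∫ y, ‖y‖ * |Vplus y * partialD j talenti y|) with hA
  set B := 1000 * ∫ y, |Vplus y * lam talenti y| with hB
  set D := 1000 * ∫ y, |Vminus y * talenti y| with hD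
  have hA0 : ∀ j, 0 ≤ A j := fun j => mul_nonneg (by norm_num) (add_nonneg
    (integral_nonneg fun _ => abs_nonneg _) (integral_nonneg fun _ => by positivity))
  have hB0 : 0 ≤ B := mul_nonneg (by norm_num) (integral_nonneg fun _ => abs_nonneg _)
  have hD0 : 0 ≤ D := mul_nonneg (by norm_num) (integral_nonneg fun _ => abs_nonneg _)
  have hS : 0 ≤ ∑ j, A j := Finset.sum_nonneg fun j _ => hA0 j
  refine ⟨1 + ∑ j, A j + B + D, by positivity, fun a ha ha1 => ⟨fun j => ?_, ?_, ?_⟩⟩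
  · refine (profileBound_expPotential_of_integral_eq_zero (c := -5) (by norm_num) ha
      (decayingLap_partialD_talenti j).integrable_lap
      (integrable_norm_mul_Vplus_mul_partialD j) (integral_Vplus_mul_partialD j)).mono ?_
    have := Finset.single_le_sum (f := A) (fun j _ => hA0 j) (Finset.mem_univ j)
    change A j ≤ _
    linarith
  · refine (profileBound_expPotential (c := -5) (by norm_num) ha.le ha1
      decayingLap_lam_talenti.integrable_lap).mono ?_
    change B ≤ _
    linarith
  · have h := profileBound_expPotential (c := -1) (by norm_num) ha.le ha1
      decayingLap_talenti_Vminus.integrable_lap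
    have e : phaseProfile a = fun x => -1 * talenti x ^ 4
        * expPotential a (fun x => Vminus x * talenti x) x := by
      funext x
      rw [phaseProfile]
      simp only [Vminus]
      ring
    rw [e]
    refine h.mono ?_
    change D ≤ _
    linarith

/-! ### The Jacobian matrix at the bubble -/

section Jacobian

variable {a : ℝ}

lemma integral_mul_translProfile (ha : 0 ≤ a) (j : Fin 3) {f : E3 → ℝ}
    (hf : Integrable fun x => Vplus x * f x) :
    ∫ x, f x * translProfile a j x = a⁻¹ * kernelForm (expKernel a) (fun x => Vplus x * f x)
      (fun x => Vplus x * partialD j talenti x) := by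
  rw [← integral_mul_expPotential ha hf (decayingLap_partialD_talenti j).integrable_lap,
    ← integral_const_mul]
  refine integral_congr_ae (Eventually.of_forall fun x => ?_)
  simp only [translProfile]
  ring

lemma integral_mul_scaleProfile (ha : 0 ≤ a) {f : E3 → ℝ}
    (hf : Integrable fun x => Vplus x * f x) :
    ∫ x, f x * scaleProfile a x = kernelForm (expKernel a) (fun x => Vplus x * f x)
      (fun x => Vplus x * lam talenti x) := by
  rw [← integral_mul_expPotential ha hf decayingLap_lam_talenti.integrable_lap]
  refine integral_congr_ae (Eventually.of_forall fun x => ?_)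
  simp only [scaleProfile]
  ring

lemma integral_talenti_mul_phaseProfile (ha : 0 ≤ a) :
    ∫ x, talenti x * phaseProfile a x = kernelForm (expKernel a) (fun x => Vminus x * talenti x)
      (fun x => Vminus x * talenti x) := by
  rw [← integral_mul_expPotential ha decayingLap_talenti_Vminus.integrable_lap
    decayingLap_talenti_Vminus.integrable_lap]
  refine integral_congr_ae (Eventually.of_forall fun x => ?_)
  simp only [phaseProfile]
  ring

/-- Reflection in the `i`-th coordinate changes the sign of the `i`-th density and fixes the `j`-th.
-/
lemma integral_partialD_mul_translProfile_of_ne (ha : 0 ≤ a) {i j : Fin 3} (h : i ≠ j) :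
    ∫ x, partialD i talenti x * translProfile a j x = 0 := by
  rw [integral_mul_translProfile ha j (decayingLap_partialD_talenti i).integrable_lap,
    kernelForm_eq_zero _ i, mul_zero]
  intro x y
  have e := fun i x => congrFun (Vplus_mul_partialD i) x
  simp only at e
  rw [e, e, e, e]
  simp [talenti_coordRefl, coordRefl_apply, h.symm]

lemma Vplus_mul_lam_coordRefl (j : Fin 3) (x : E3) :
    Vplus (coordRefl j x) * lam talenti (coordRefl j x) = Vplus x * lam talenti x := by
  simp [Vplus, lam_talenti, talenti_coordRefl]

lemma Vplus_mul_partialD_coordRefl (j : Fin 3) (x : E3) :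
    Vplus (coordRefl j x) * partialD j talenti (coordRefl j x)
      = -(Vplus x * partialD j talenti x) := by
  simp [Vplus, partialD_talenti', talenti_coordRefl, coordRefl_apply]

lemma integral_lam_mul_translProfile (ha : 0 ≤ a) (j : Fin 3) :
    ∫ x, lam talenti x * translProfile a j x = 0 := by
  rw [integral_mul_translProfile ha j decayingLap_lam_talenti.integrable_lap,
    kernelForm_eq_zero _ j, mul_zero]
  intro x y
  rw [Vplus_mul_lam_coordRefl, Vplus_mul_partialD_coordRefl]
  ring

lemma integral_partialD_mul_scaleProfile (ha : 0 ≤ a) (j : Fin 3) :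
    ∫ x, partialD j talenti x * scaleProfile a x = 0 := by
  rw [integral_mul_scaleProfile ha (decayingLap_partialD_talenti j).integrable_lap,
    kernelForm_eq_zero _ j]
  intro x y
  rw [Vplus_mul_lam_coordRefl, Vplus_mul_partialD_coordRefl]
  ring

/-- The diagonal entries of the Jacobian are bounded below uniformly. -/
lemma exists_le_diagonal : ∃ c : ℝ, 0 < c ∧ ∀ a : ℝ, 0 < a → a ≤ 1 →
    (∀ j, c ≤ ∫ x, partialD j talenti x * translProfile a j x) ∧
      c ≤ ∫ x, lam talenti x * scaleProfile a x ∧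
      c ≤ ∫ x, talenti x * phaseProfile a x := by
  have ht : ∀ j, ∃ c : ℝ, 0 < c ∧ ∀ a : ℝ, 0 < a → a ≤ 1 →
      c ≤ ∫ x, partialD j talenti x * translProfile a j x := by
    intro j
    have hρ : ∀ x, 5 / 3 * talenti (coordRefl j x) ^ 7 = 5 / 3 * talenti x ^ 7 := fun x => by
      rw [talenti_coordRefl]
    have hρ0 : ∀ x, 0 < 5 / 3 * talenti x ^ 7 := fun x => by
      have := talenti_pos x
      positivity
    have hint : Integrable fun x : E3 => 5 / 3 * talenti x ^ 7 * x j := by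
      rw [← Vplus_mul_partialD j]
      exact (decayingLap_partialD_talenti j).integrable_lap
    -- The lower bound is the form at `a = 1`; the loss of a factor `a` for smaller `a` is repaid by
    -- the `a⁻¹` in the profile.
    refine ⟨_, kernelForm_odd_pos hρ hρ0
      (continuous_const.mul (continuous_talenti.pow 7)) hint, fun a ha ha1 => ?_⟩
    rw [integral_mul_translProfile ha.le j (decayingLap_partialD_talenti j).integrable_lap,
      Vplus_mul_partialD, le_inv_mul_iff₀ ha]
    exact mul_kernelForm_odd_le hρ (fun x => (hρ0 x).le) hint ha.le ha1
  choose c hc hct using ht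
  obtain ⟨c₁, hc₁, h₁⟩ := exists_le_kernelForm_expKernel decayingLap_lam_talenti.integrable_lap
    integral_Vplus_mul_lam_ne_zero
  obtain ⟨c₂, hc₂, h₂⟩ := exists_le_kernelForm_expKernel
    decayingLap_talenti_Vminus.integrable_lap integral_Vminus_mul_talenti_ne_zero
  refine ⟨min (min (c 0) (min (c 1) (c 2))) (min c₁ c₂),
    lt_min (lt_min (hc 0) (lt_min (hc 1) (hc 2))) (lt_min hc₁ hc₂), fun a ha ha1 =>
      ⟨fun j => le_trans ?_ (hct j a ha ha1), ?_, ?_⟩⟩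
  · fin_cases j <;> simp
  · rw [integral_mul_scaleProfile ha.le decayingLap_lam_talenti.integrable_lap]
    exact ((min_le_right _ _).trans (min_le_left _ _)).trans (h₁ a ha.le ha1)
  · rw [integral_talenti_mul_phaseProfile ha.le]
    exact ((min_le_right _ _).trans (min_le_right _ _)).trans (h₂ a ha.le ha1)

end Jacobian

open scoped Convolution

/-! ### The Sobolev inequality in `Ḣ¹` -/

lemma holderTriple_three_six_two : ENNReal.HolderTriple 3 6 2 := ⟨by
  rw [← ENNReal.toReal_eq_toReal_iff' (by simp) (by simp), ENNReal.toReal_add (by simp) (by simp)]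
  norm_num⟩

/-- Convolution with a probability density does not increase `Lᵖ` norms. -/
lemma eLpNorm_convolution_le {ρ : E3 → ℝ} (hρm : Measurable ρ) (hρ0 : ∀ x, 0 ≤ ρ x)
    (hρ1 : ∫⁻ x, ENNReal.ofReal (ρ x) = 1) {g : E3 → ℂ} (hg : StronglyMeasurable g)
    {p : ℝ≥0∞} (hp : 1 ≤ p) (hp' : p ≠ ⊤) :
    eLpNorm (ρ ⋆[ContinuousLinearMap.lsmul ℝ ℝ, volume] g) p volume ≤ eLpNorm g p volume := by
  have hp0 : p ≠ 0 := (zero_lt_one.trans_le hp).ne'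
  have hpr : 0 < p.toReal := ENNReal.toReal_pos hp0 hp'
  set ν : Measure E3 := volume.withDensity fun x => ENNReal.ofReal (ρ x) with hν
  have hνp : IsProbabilityMeasure ν := ⟨by rw [hν, withDensity_apply _ MeasurableSet.univ]; simpa⟩
  have hpt : ∀ x, ‖(ρ ⋆[ContinuousLinearMap.lsmul ℝ ℝ, volume] g) x‖ₑ ^ p.toReal
      ≤ ∫⁻ t, ‖g (x - t)‖ₑ ^ p.toReal ∂ν := by
    intro x
    have hgx : StronglyMeasurable fun t => g (x - t) :=
      hg.comp_measurable (measurable_const.sub measurable_id)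
    have h1 : ‖(ρ ⋆[ContinuousLinearMap.lsmul ℝ ℝ, volume] g) x‖ₑ ≤ ∫⁻ t, ‖g (x - t)‖ₑ ∂ν := by
      rw [convolution, hν, lintegral_withDensity_eq_lintegral_mul _ hρm.ennreal_ofReal
        hgx.measurable.enorm]
      refine (enorm_integral_le_lintegral_enorm _).trans (le_of_eq (lintegral_congr fun t => ?_))
      simp only [ContinuousLinearMap.lsmul_apply, Pi.mul_apply, enorm_smul]
      rw [Real.enorm_of_nonneg (hρ0 t)]
    -- Jensen's inequality, in the form of monotonicity of `Lᵖ` norms for the probability measure of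
    -- density `ρ`.
    have h2 := eLpNorm_le_eLpNorm_of_exponent_le hp (μ := ν) hgx.aestronglyMeasurable
    rw [eLpNorm_one_eq_lintegral_enorm, eLpNorm_eq_lintegral_rpow_enorm_toReal hp0 hp'] at h2
    calc _ ≤ ((∫⁻ t, ‖g (x - t)‖ₑ ^ p.toReal ∂ν) ^ (1 / p.toReal)) ^ p.toReal := by
          gcongr
          exact h1.trans h2
      _ = _ := by
          rw [← ENNReal.rpow_mul, one_div_mul_cancel hpr.ne', ENNReal.rpow_one]
  rw [eLpNorm_eq_lintegral_rpow_enorm_toReal hp0 hp', eLpNorm_eq_lintegral_rpow_enorm_toReal hp0 hp']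
  refine ENNReal.rpow_le_rpow ?_ (by positivity)
  calc ∫⁻ x, ‖(ρ ⋆[ContinuousLinearMap.lsmul ℝ ℝ, volume] g) x‖ₑ ^ p.toReal
      ≤ ∫⁻ x, ∫⁻ t, ‖g (x - t)‖ₑ ^ p.toReal ∂ν := lintegral_mono hpt
    _ = ∫⁻ t, (∫⁻ x, ‖g (x - t)‖ₑ ^ p.toReal) ∂ν := by
      refine lintegral_lintegral_swap (Measurable.aemeasurable ?_)
      exact ((hg.measurable.comp (measurable_fst.sub measurable_snd)).enorm).pow_const _
    _ = ∫⁻ t, (∫⁻ x, ‖g x‖ₑ ^ p.toReal) ∂ν := by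
      refine lintegral_congr fun t => ?_
      exact lintegral_sub_right_eq_self (fun x => ‖g x‖ₑ ^ p.toReal) t
    _ = ∫⁻ x, ‖g x‖ₑ ^ p.toReal := by simp

lemma tendsto_eLpNorm_indicator_zero {w : E3 → ℂ} (hw : MemLp w 6 volume) :
    Tendsto (fun n : ℕ => eLpNorm ({x : E3 | (n : ℝ) + 1 ≤ ‖x‖}.indicator w) 6 volume) atTop
      (𝓝 0) := by
  have hfin : ∫⁻ x, ‖w x‖ₑ ^ (6 : ℝ≥0∞).toReal ≠ ⊤ :=
    (lintegral_rpow_enorm_lt_top_of_eLpNorm_lt_top (by norm_num) (by norm_num) hw.2).ne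
  have hms : ∀ n : ℕ, MeasurableSet {x : E3 | (n : ℝ) + 1 ≤ ‖x‖} := fun n =>
    measurableSet_le measurable_const measurable_norm
  have h1 : Tendsto (fun n : ℕ => ∫⁻ x, ‖{x : E3 | (n : ℝ) + 1 ≤ ‖x‖}.indicator w x‖ₑ
      ^ (6 : ℝ≥0∞).toReal) atTop (𝓝 (∫⁻ _ : E3, 0)) := by
    refine tendsto_lintegral_of_dominated_convergence' (fun x => ‖w x‖ₑ ^ (6 : ℝ≥0∞).toReal)
      (fun n => ((hw.1.indicator (hms n)).enorm.pow_const _))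
      (fun n => Eventually.of_forall fun x => ?_) hfin (Eventually.of_forall fun x => ?_)
    · exact ENNReal.rpow_le_rpow (enorm_indicator_le_enorm_self _ _) (by norm_num)
    · refine tendsto_const_nhds.congr' ?_
      obtain ⟨N, hN⟩ := exists_nat_ge ‖x‖
      filter_upwards [eventually_ge_atTop N] with n hn
      have : (N : ℝ) ≤ n := by exact_mod_cast hn
      rw [indicator_of_notMem]
      · simp
      · simp only [mem_ofPred_eq, not_le]
        linarith
  rw [lintegral_zero] at h1
  have h2 := (ENNReal.continuous_rpow_const (y := 1 / (6 : ℝ≥0∞).toReal)).tendsto 0 |>.comp h1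
  rw [ENNReal.zero_rpow_of_pos (by norm_num)] at h2
  refine h2.congr fun n => ?_
  rw [eLpNorm_eq_lintegral_rpow_enorm_toReal (by norm_num) (by norm_num)]
  rfl

/-- In dimension three the `L³` norm of a gradient is invariant under dilation: the factor `1/(n+1)`
balances the cube root of the volume of the ball of radius `2(n+1)`. -/
lemma exists_eLpNorm_fderiv_cutoff_le :
    ∃ K : ℝ≥0∞, K ≠ ⊤ ∧ ∀ n, eLpNorm (fderiv ℝ (cutoff n)) 3 volume ≤ K := by
  obtain ⟨C, hC0, hC⟩ := exists_norm_fderiv_cutoff_le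
  refine ⟨ENNReal.ofReal (2 * C) * ENNReal.ofReal (Real.pi * 4 / 3) ^ (1 / (3 : ℝ≥0∞).toReal),
    by finiteness, fun n => ?_⟩
  have hn : (0 : ℝ) < n + 1 := by positivity
  have h1 : eLpNorm (fderiv ℝ (cutoff n)) 3 volume ≤
      eLpNorm ((Metric.closedBall (0 : E3) (2 * ((n : ℝ) + 1))).indicator
        fun _ => C * ((n : ℝ) + 1)⁻¹) 3 volume := by
    refine eLpNorm_mono_real fun x => ?_
    by_cases hx : 2 * ((n : ℝ) + 1) < ‖x‖
    · rw [fderiv_cutoff_eq_zero_of_gt hx, norm_zero]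
      exact indicator_nonneg (fun _ _ => by positivity) _
    · rw [indicator_of_mem (by simpa using hx)]
      exact hC n x
  refine h1.trans ((eLpNorm_indicator_const_le _ _).trans ?_)
  rw [EuclideanSpace.volume_closedBall_fin_three, Real.enorm_of_nonneg (by positivity),
    ENNReal.mul_rpow_of_nonneg _ _ (by simp), ← ENNReal.rpow_natCast, ← ENNReal.rpow_mul,
    ← mul_assoc]
  simp only [ENNReal.toReal_ofNat, Nat.cast_ofNat, mul_one_div_cancel (three_ne_zero (α := ℝ)),
    ENNReal.rpow_one]
  rw [← ENNReal.ofReal_mul (by positivity)]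
  apply le_of_eq
  congr 2
  · field_simp

/-- The Sobolev constant of `ℝ³`. -/
def sobolevConst : ℝ≥0∞ := SNormLESNormFDerivOfEqConst ℂ (volume : Measure E3) (2 : NNReal)

/-- The compactly supported inequality is applied to `χ_n w`. The error `w ∇χ_n` is at most the
bounded `‖∇χ_n‖_{L³}` times the `L⁶` norm of `w` on `|x| ≥ n + 1`, which vanishes in the limit
because `w ∈ L⁶`. Some such condition at infinity is needed, as constants show. -/
lemma eLpNorm_six_le_of_contDiff {w : E3 → ℂ} (hw : ContDiff ℝ 1 w) (hw6 : MemLp w 6 volume) :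
    eLpNorm w 6 volume ≤ sobolevConst * eLpNorm (fderiv ℝ w) 2 volume := by
  obtain ⟨K, hK, hKn⟩ := exists_eLpNorm_fderiv_cutoff_le
  set τ : ℕ → ℝ≥0∞ := fun n => eLpNorm ({x : E3 | (n : ℝ) + 1 ≤ ‖x‖}.indicator w) 6 volume with hτ
  have hχ : ∀ n, ContDiff ℝ 1 (cutoff n) := fun n => (contDiff_cutoff n).of_le (by simp)
  have hms : ∀ n : ℕ, MeasurableSet {x : E3 | (n : ℝ) + 1 ≤ ‖x‖} := fun n =>
    measurableSet_le measurable_const measurable_norm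
  have hwd : Continuous (fderiv ℝ w) := hw.continuous_fderiv (by simp)
  have hχd : ∀ n, Continuous (fderiv ℝ (cutoff n)) := fun n => (hχ n).continuous_fderiv (by simp)
  have hn : ∀ n, eLpNorm (fun x => cutoff n x • w x) 6 volume
      ≤ sobolevConst * (eLpNorm (fderiv ℝ w) 2 volume + K * τ n) := by
    intro n
    have h1 := eLpNorm_le_eLpNorm_fderiv_of_eq (volume : Measure E3) (F := ℂ)
      (u := fun x => cutoff n x • w x) ((hχ n).smul hw)
      (hasCompactSupport_cutoff n).smul_right (p := 2) (p' := 6) (by norm_num)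
      (by simp) (by simp; norm_num)
    refine h1.trans ?_
    change sobolevConst * _ ≤ _
    gcongr
    have hd : ∀ x, fderiv ℝ (fun x => cutoff n x • w x) x
        = cutoff n x • fderiv ℝ w x + (fderiv ℝ (cutoff n) x).smulRight (w x) := fun x =>
      fderiv_fun_smul ((hχ n).differentiable (by simp) x) (hw.differentiable (by simp) x)
    have e : fderiv ℝ (fun x => cutoff n x • w x)
        = (fun x => cutoff n x • fderiv ℝ w x)
          + fun x => (fderiv ℝ (cutoff n) x).smulRight (w x) := funext hd
    have c1 : Continuous fun x => cutoff n x • fderiv ℝ w x := (hχ n).continuous.smul hwd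
    have c2 : Continuous fun x => (fderiv ℝ (cutoff n) x).smulRight (w x) := by
      have : (fun x => (fderiv ℝ (cutoff n) x).smulRight (w x))
          = fun x => fderiv ℝ (fun x => cutoff n x • w x) x - cutoff n x • fderiv ℝ w x := by
        funext x
        rw [hd x]
        abel
      rw [this]
      exact (((hχ n).smul hw).continuous_fderiv (by simp)).sub c1
    rw [show ((2 : NNReal) : ℝ≥0∞) = 2 by norm_num, e]
    refine (eLpNorm_add_le c1.aestronglyMeasurable c2.aestronglyMeasurable (by norm_num)).trans ?_
    refine add_le_add (eLpNorm_mono fun x => ?_) ?_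
    · rw [norm_smul, Real.norm_of_nonneg (cutoff_nonneg n x)]
      exact mul_le_of_le_one_left (norm_nonneg _) (cutoff_le_one n x)
    · have := holderTriple_three_six_two
      have h2 := eLpNorm_smul_le_mul_eLpNorm (p := 3) (q := 6) (r := 2) (μ := (volume : Measure E3))
        (f := {x : E3 | (n : ℝ) + 1 ≤ ‖x‖}.indicator w) (φ := fun x => ‖fderiv ℝ (cutoff n) x‖)
        (hw6.1.indicator (hms n)) (hχd n).norm.aestronglyMeasurable
      rw [eLpNorm_norm] at h2
      refine le_trans (eLpNorm_mono fun x => ?_) (h2.trans (mul_le_mul_left (hKn n) _))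
      rw [ContinuousLinearMap.norm_smulRight_apply, Pi.smul_apply', norm_smul, norm_norm]
      by_cases hx : ‖x‖ < n + 1
      · simp [fderiv_cutoff_eq_zero_of_lt hx]
      · rw [indicator_of_mem (by simpa using hx)]
  have hlim : Tendsto (fun n => sobolevConst * (eLpNorm (fderiv ℝ w) 2 volume + K * τ n)) atTop
      (𝓝 (sobolevConst * (eLpNorm (fderiv ℝ w) 2 volume + K * 0))) := by
    refine ENNReal.Tendsto.const_mul (tendsto_const_nhds.add (ENNReal.Tendsto.const_mul
      (tendsto_eLpNorm_indicator_zero hw6) (Or.inr hK))) (Or.inr ?_)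
    simp [sobolevConst]
  rw [mul_zero, add_zero] at hlim
  have hfatou := Lp.eLpNorm_lim_le_liminf_eLpNorm (p := 6) (μ := (volume : Measure E3))
    (f := fun n x => cutoff n x • w x)
    (fun n => ((hχ n).continuous.smul hw.continuous).aestronglyMeasurable) w
    (Eventually.of_forall fun x => by simpa using (tendsto_cutoff x).smul_const (w x))
  refine hfatou.trans ?_
  rw [← hlim.liminf_eq]
  exact liminf_le_liminf (Eventually.of_forall hn)

/-- The mollifier of radius `2 / (n + 1)`. -/
def mollifierBump (n : ℕ) : ContDiffBump (0 : E3) :=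
  ⟨1 / ((n : ℝ) + 1), 2 * (1 / ((n : ℝ) + 1)), by positivity, by
    have : 0 < 1 / ((n : ℝ) + 1) := by positivity
    linarith⟩

/-- Sobolev's inequality `‖u‖_{L⁶} ≤ C ∑ ‖∂_j u‖_{L²}` for functions with weak derivatives. -/
theorem eLpNorm_six_le_of_hasWeakPartial {u : Lp ℂ 6 (volume : Measure E3)}
    {g : Fin 3 → Lp ℂ 2 (volume : Measure E3)} (h : ∀ j, HasWeakPartial j u (g j)) :
    eLpNorm u 6 volume ≤ sobolevConst * ∑ j, eLpNorm (g j) 2 volume := by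
  set ρ : ℕ → E3 → ℝ := fun n => (mollifierBump n).normed volume with hρ
  have hρc : ∀ n, ContDiff ℝ ∞ (ρ n) := fun n => (mollifierBump n).contDiff_normed
  have hρs : ∀ n, HasCompactSupport (ρ n) := fun n => (mollifierBump n).hasCompactSupport_normed
  have hρ0 : ∀ n x, 0 ≤ ρ n x := fun n x => (mollifierBump n).nonneg_normed x
  have hρ1 : ∀ n, ∫⁻ x, ENNReal.ofReal (ρ n x) = 1 := by
    intro n
    rw [← ofReal_integral_eq_lintegral_ofReal (mollifierBump n).integrable_normed
      (Eventually.of_forall (hρ0 n)), (mollifierBump n).integral_normed, ENNReal.ofReal_one]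
  have hul : LocallyIntegrable u (volume : Measure E3) :=
    (Lp.memLp u).locallyIntegrable (by norm_num)
  set v : ℕ → E3 → ℂ := fun n => ρ n ⋆[ContinuousLinearMap.lsmul ℝ ℝ, volume] u with hv
  have hvc : ∀ n, ContDiff ℝ 1 (v n) := fun n =>
    (hρs n).contDiff_convolution_left (n := 1) _ ((hρc n).of_le (by simp)) hul
  have hv6 : ∀ n, MemLp (v n) 6 volume := fun n =>
    ⟨(hvc n).continuous.aestronglyMeasurable, (eLpNorm_convolution_le (hρc n).continuous.measurable
      (hρ0 n) (hρ1 n) (Lp.stronglyMeasurable u) (by norm_num) (by norm_num)).trans_lt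
        (Lp.memLp u).2⟩
  -- Mollification commutes with weak derivatives: test the weak derivative against `y ↦ ρ_n (x -
  -- y)`, where the reflection in `y` cancels the minus sign of integration by parts.
  have hvd : ∀ n j x, fderiv ℝ (v n) x (e3 j)
      = (ρ n ⋆[ContinuousLinearMap.lsmul ℝ ℝ, volume] (g j)) x := by
    intro n j x
    have h1 := (hρs n).hasFDerivAt_convolution_left (ContinuousLinearMap.lsmul ℝ ℝ)
      ((hρc n).of_le (by simp) : ContDiff ℝ 1 (ρ n)) hul x
    have hex : ConvolutionExistsAt (fderiv ℝ (ρ n)) u x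
        (ContinuousLinearMap.precompL E3 (ContinuousLinearMap.lsmul ℝ ℝ)) volume :=
      ((hρs n).fderiv (𝕜 := ℝ)).convolutionExists_left _
        ((hρc n).continuous_fderiv (by simp)) hul x
    have hφ : ContDiff ℝ ∞ fun y => ρ n (x - y) := (hρc n).comp (contDiff_const.sub contDiff_id)
    have hφs : HasCompactSupport fun y => ρ n (x - y) :=
      (hρs n).comp_homeomorph (Homeomorph.subLeft x)
    have hφd : ∀ y, fderiv ℝ (fun y => ρ n (x - y)) y (e3 j)
        = -(fderiv ℝ (ρ n) (x - y) (e3 j)) := by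
      intro y
      have h2 : HasFDerivAt (fun y => ρ n (x - y)) ((fderiv ℝ (ρ n) (x - y)).comp
          (-ContinuousLinearMap.id ℝ E3)) y :=
        HasFDerivAt.comp y ((hρc n).differentiable (by simp) _).hasFDerivAt
          ((hasFDerivAt_id y).const_sub x)
      rw [h2.fderiv]
      simp
    have h3 := h j _ hφ hφs
    simp_rw [hφd] at h3
    rw [hv, h1.fderiv, convolution_eq_swap, convolution_eq_swap]
    rw [ContinuousLinearMap.integral_apply]
    · simp only [ContinuousLinearMap.precompL_apply, ContinuousLinearMap.lsmul_apply]
      simp only [neg_smul, integral_neg, neg_inj] at h3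
      exact h3
    · exact hex.integrable_swap
  have hn : ∀ n, eLpNorm (v n) 6 volume ≤ sobolevConst * ∑ j, eLpNorm (g j) 2 volume := by
    intro n
    refine (eLpNorm_six_le_of_contDiff (hvc n) (hv6 n)).trans ?_
    gcongr
    have hc : ∀ j, Continuous fun x => fderiv ℝ (v n) x (e3 j) := fun j =>
      ((hvc n).continuous_fderiv (by simp)).clm_apply continuous_const
    have hop : ∀ x, ‖fderiv ℝ (v n) x‖ ≤ ∑ j, ‖fderiv ℝ (v n) x (e3 j)‖ := by
      intro x
      refine ContinuousLinearMap.opNorm_le_bound _ (Finset.sum_nonneg fun _ _ => norm_nonneg _)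
        fun z => ?_
      have hz : z = ∑ j, z j • e3 j := by
        ext i
        simp [Finset.sum_apply, Pi.single_apply]
      conv_lhs => rw [hz, map_sum]
      rw [Finset.sum_mul]
      refine (norm_sum_le _ _).trans (Finset.sum_le_sum fun j _ => ?_)
      rw [map_smul, norm_smul, mul_comm]
      gcongr
      exact abs_coord_le z j
    calc eLpNorm (fderiv ℝ (v n)) 2 volume
        ≤ eLpNorm (fun x => ∑ j, ‖fderiv ℝ (v n) x (e3 j)‖) 2 volume := eLpNorm_mono_real hop
      _ ≤ ∑ j, eLpNorm (fun x => ‖fderiv ℝ (v n) x (e3 j)‖) 2 volume := by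
        have := eLpNorm_sum_le (μ := (volume : Measure E3)) (p := 2) (s := Finset.univ)
          (f := fun j x => ‖fderiv ℝ (v n) x (e3 j)‖)
          (fun j _ => (hc j).norm.aestronglyMeasurable) (by norm_num)
        simpa [Finset.sum_fn] using this
      _ ≤ ∑ j, eLpNorm (g j) 2 volume := by
        refine Finset.sum_le_sum fun j _ => ?_
        rw [eLpNorm_norm, funext (hvd n j)]
        exact eLpNorm_convolution_le (hρc n).continuous.measurable (hρ0 n) (hρ1 n)
          (Lp.stronglyMeasurable (g j)) (by norm_num) (by norm_num)
  have hae : ∀ᵐ x, Tendsto (fun n => v n x) atTop (𝓝 (u x)) := by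
    refine ContDiffBump.ae_convolution_tendsto_right_of_locallyIntegrable (K := 2)
      (φ := mollifierBump) ?_ (Eventually.of_forall fun n => le_rfl) hul
    have := (tendsto_one_div_add_atTop_nhds_zero_nat (𝕜 := ℝ)).const_mul 2
    rwa [mul_zero] at this
  -- Almost everywhere convergence of the mollifications and Fatou are enough; no convergence in
  -- norm is used.
  have hfatou := Lp.eLpNorm_lim_le_liminf_eLpNorm (p := 6) (μ := (volume : Measure E3))
    (f := v) (fun n => (hvc n).continuous.aestronglyMeasurable) u hae
  refine hfatou.trans (liminf_le_of_le (by isBoundedDefault) fun b hb => ?_)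
  obtain ⟨n, hbn⟩ := hb.exists
  exact hbn.trans (hn n)

lemma eLpNorm_toFun_le (u : Hdot1) :
    eLpNorm u.toFun 6 volume ≤ 3 * sobolevConst * ENNReal.ofReal ‖u‖ := by
  have h1 := eLpNorm_six_le_of_hasWeakPartial u.2
  have h2 : ∀ j, eLpNorm (u.1.2 j) 2 volume ≤ ENNReal.ofReal ‖u‖ := by
    intro j
    have h3 : ‖u.1.2 j‖ ≤ ‖u‖ := PiLp.norm_apply_le u.1.2 j
    rw [← Lp.enorm_def, ← ofReal_norm]
    exact ENNReal.ofReal_le_ofReal h3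
  refine h1.trans ?_
  calc sobolevConst * ∑ j, eLpNorm (u.1.2 j) 2 volume
      ≤ sobolevConst * ∑ _j : Fin 3, ENNReal.ofReal ‖u‖ := by
        gcongr with j
        exact h2 j
    _ = _ := by
        simp
        ring

/-- The exponent `6/5` is conjugate to `6`, and `3 · 6/5 = 18/5` exceeds the dimension. Hence the
weight `wt³` pairs with `L⁶`. -/
lemma integrable_wt_rpow : Integrable fun x : E3 => (wt x ^ 3) ^ (6 / 5 : ℝ) := by
  have h := integrable_one_add_norm (E := E3) (μ := volume) (r := 18 / 5) (by simp; norm_num)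
  refine h.congr (Eventually.of_forall fun x => ?_)
  simp only [wt]
  rw [inv_pow, Real.inv_rpow (by positivity), ← Real.rpow_natCast, ← Real.rpow_mul (by positivity),
    Real.rpow_neg (by positivity)]
  norm_num

/-- `Ḣ¹` embeds into the weighted space `L¹((1 + |x|)⁻³ dx)`. -/
theorem exists_integral_norm_mul_wt_le : ∃ C : ℝ, 0 < C ∧ ∀ u : Hdot1,
    Integrable (fun x => ‖u.toFun x‖ * wt x ^ 3) ∧ ∫ x, ‖u.toFun x‖ * wt x ^ 3 ≤ C * ‖u‖ := by
  set A : ℝ≥0∞ := (∫⁻ x : E3, ENNReal.ofReal (wt x ^ 3) ^ (6 / 5 : ℝ)) ^ (1 / (6 / 5) : ℝ) with hA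
  have hAfin : A ≠ ⊤ := by
    refine ENNReal.rpow_ne_top_of_nonneg (by norm_num) ?_
    have h1 := integrable_wt_rpow.lintegral_lt_top
    refine (lt_of_eq_of_lt (lintegral_congr fun x => ?_) h1).ne
    rw [ENNReal.ofReal_rpow_of_nonneg (pow_nonneg (wt_nonneg x) 3) (by norm_num)]
  set S : ℝ≥0∞ := 3 * sobolevConst * A with hS
  have hSfin : S ≠ ⊤ := ENNReal.mul_ne_top (ENNReal.mul_ne_top (by simp) (by simp [sobolevConst])) hAfin
  have key : ∀ u : Hdot1, ∫⁻ x, ‖‖u.toFun x‖ * wt x ^ 3‖ₑ ≤ S * ENNReal.ofReal ‖u‖ := by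
    intro u
    have hm : AEMeasurable (fun x => ‖u.toFun x‖ₑ) (volume : Measure E3) :=
      (Lp.stronglyMeasurable u.1.1).measurable.enorm.aemeasurable
    have h1 := ENNReal.lintegral_mul_le_Lp_mul_Lq (volume : Measure E3) (p := 6) (q := 6 / 5)
      (by constructor <;> norm_num) hm
      (continuous_wt.measurable.pow_const 3).ennreal_ofReal.aemeasurable
    have h2 := eLpNorm_toFun_le u
    rw [eLpNorm_eq_lintegral_rpow_enorm_toReal (by norm_num) (by norm_num)] at h2
    calc ∫⁻ x, ‖‖u.toFun x‖ * wt x ^ 3‖ₑ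
        = ∫⁻ x, ((fun x => ‖u.toFun x‖ₑ) * fun x => ENNReal.ofReal (wt x ^ 3)) x := by
          refine lintegral_congr fun x => ?_
          rw [enorm_mul, enorm_norm, Real.enorm_of_nonneg (pow_nonneg (wt_nonneg x) 3)]
          rfl
      _ ≤ (3 * sobolevConst * ENNReal.ofReal ‖u‖) * A := by
          refine h1.trans ?_
          gcongr
          simpa using h2
      _ = _ := by
          rw [hS]
          ring
  refine ⟨S.toReal + 1, by positivity, fun u => ?_⟩
  have hm : AEStronglyMeasurable (fun x => ‖u.toFun x‖ * wt x ^ 3) (volume : Measure E3) :=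
    (Lp.stronglyMeasurable u.1.1).norm.aestronglyMeasurable.mul
      (continuous_wt.pow 3).aestronglyMeasurable
  have hint : Integrable (fun x => ‖u.toFun x‖ * wt x ^ 3) :=
    ⟨hm, (key u).trans_lt (ENNReal.mul_lt_top hSfin.lt_top ENNReal.ofReal_lt_top)⟩
  refine ⟨hint, ?_⟩
  have h3 : ENNReal.ofReal (∫ x, ‖u.toFun x‖ * wt x ^ 3) ≤ ENNReal.ofReal (S.toReal * ‖u‖) := by
    rw [ofReal_integral_eq_lintegral_ofReal hint (Eventually.of_forall fun x =>
      mul_nonneg (norm_nonneg _) (pow_nonneg (wt_nonneg x) 3)),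
      ENNReal.ofReal_mul ENNReal.toReal_nonneg, ENNReal.ofReal_toReal hSfin]
    refine le_trans (le_of_eq (lintegral_congr fun x => ?_)) (key u)
    rw [Real.enorm_of_nonneg (mul_nonneg (norm_nonneg _) (pow_nonneg (wt_nonneg x) 3))]
  have h4 := (ENNReal.ofReal_le_ofReal_iff (mul_nonneg ENNReal.toReal_nonneg (norm_nonneg u))).1 h3
  have := norm_nonneg u
  linarith

/-! ### Pairings of transformed functions with test profiles -/

/-- The neutral parameter `(0, 1, 0)`. -/
def baseParam : E3 × ℝ × ℝ := (0, 1, 0)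

lemma mem_ball_baseParam {b : E3 × ℝ × ℝ} {r : ℝ} :
    b ∈ Metric.ball baseParam r ↔ ‖b.1‖ < r ∧ |b.2.1 - 1| < r ∧ |b.2.2| < r := by
  rw [mem_ball_iff_norm, Prod.norm_def, Prod.norm_def, max_lt_iff, max_lt_iff]
  simp [baseParam]

lemma scale_bounds {b : E3 × ℝ × ℝ} (hb : b ∈ Metric.ball baseParam (1 / 2)) :
    1 / 2 < b.2.1 ∧ b.2.1 < 3 / 2 := by
  have := abs_lt.1 (mem_ball_baseParam.1 hb).2.1
  constructor <;> linarith

lemma norm_components_le (b : E3 × ℝ × ℝ) : ‖b.1‖ ≤ ‖b‖ ∧ |b.2.1| ≤ ‖b‖ ∧ |b.2.2| ≤ ‖b‖ :=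
  ⟨norm_fst_le b, (norm_fst_le b.2).trans (norm_snd_le b), (norm_snd_le b.2).trans (norm_snd_le b)⟩

/-- The test profile pulled back by the change of variables of `T_b`. -/
def pulledProfile (g : E3 → ℝ) (b : E3 × ℝ × ℝ) (z : E3) : ℂ :=
  ((b.2.1 ^ 5 : ℝ) : ℂ) * Complex.exp (Complex.I * b.2.2) * (g (b.2.1 ^ 2 • (z - b.1)) : ℝ)

lemma transf_mul_eq {g : E3 → ℝ} {b : E3 × ℝ × ℝ} (hb : 0 < b.2.1) (v : E3 → ℂ) (x : E3) :
    transf b v x * g x = ((((b.2.1 ^ 6)⁻¹ : ℝ) : ℂ) • fun z => v z * pulledProfile g b z)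
      ((b.2.1 ^ 2)⁻¹ • x + b.1) := by
  have h : b.2.1 ^ 2 • ((b.2.1 ^ 2)⁻¹ • x + b.1 - b.1) = x := by
    rw [add_sub_cancel_right, smul_smul, mul_inv_cancel₀ (by positivity), one_smul]
  simp only [Pi.smul_apply, pulledProfile, h, transf, smul_eq_mul]
  have hν : (b.2.1 : ℂ) ≠ 0 := by exact_mod_cast hb.ne'
  push_cast
  field_simp

/-- The change of variables moves the parameter from `u`, which has no pointwise regularity, onto
the Lipschitz profile. The power `ν⁵` of the pulled profile is the amplitude `ν⁻¹` times the
Jacobian `ν⁶`. -/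
lemma integral_transf_mul {g : E3 → ℝ} {b : E3 × ℝ × ℝ} (hb : 0 < b.2.1) (v : E3 → ℂ) :
    ∫ x, transf b v x * g x = ∫ z, v z * pulledProfile g b z := by
  have hb2 : 0 < b.2.1 ^ 2 := by positivity
  simp_rw [transf_mul_eq hb]
  rw [Measure.integral_comp_smul volume
    (fun x => ((((b.2.1 ^ 6)⁻¹ : ℝ) : ℂ) • fun z => v z * pulledProfile g b z) (x + b.1)),
    integral_add_right_eq_self
      ((((b.2.1 ^ 6)⁻¹ : ℝ) : ℂ) • fun z => v z * pulledProfile g b z)]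
  simp only [Pi.smul_apply, finrank_euclideanSpace, Fintype.card_fin]
  rw [integral_smul, abs_of_pos (by positivity), Complex.real_smul, smul_eq_mul, ← mul_assoc,
    ← Complex.ofReal_mul]
  have : (((b.2.1 ^ 2)⁻¹ ^ 3)⁻¹ : ℝ) * (b.2.1 ^ 6)⁻¹ = 1 := by field_simp
  rw [this, Complex.ofReal_one, one_mul]

lemma integrable_transf_mul {g : E3 → ℝ} {b : E3 × ℝ × ℝ} (hb : 0 < b.2.1) {v : E3 → ℂ}
    (h : Integrable fun z => v z * pulledProfile g b z) :
    Integrable fun x => transf b v x * g x := by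
  have hb2 : (b.2.1 ^ 2)⁻¹ ≠ 0 := by positivity
  simp_rw [transf_mul_eq hb]
  exact ((h.smul (((b.2.1 ^ 6)⁻¹ : ℝ) : ℂ)).comp_add_right b.1).comp_smul hb2

lemma wt_scaled_le {b : E3 × ℝ × ℝ} (hb : b ∈ Metric.ball baseParam (1 / 2)) (z : E3) :
    wt (b.2.1 ^ 2 • (z - b.1)) ≤ 4 * wt z := by
  obtain ⟨h1, h2⟩ := scale_bounds hb
  have h3 := (mem_ball_baseParam.1 hb).1
  unfold wt
  rw [← div_eq_mul_inv, inv_eq_one_div, div_le_div_iff₀ (by positivity) (by positivity),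
    norm_smul, Real.norm_of_nonneg (by positivity)]
  have h4 : ‖z‖ ≤ ‖z - b.1‖ + ‖b.1‖ := by simpa using norm_add_le (z - b.1) b.1
  have h5 : 1 / 4 ≤ b.2.1 ^ 2 := by nlinarith
  nlinarith [norm_nonneg (z - b.1), mul_le_mul_of_nonneg_right h5 (norm_nonneg (z - b.1))]

lemma norm_exp_I_mul (θ : ℝ) : ‖Complex.exp (Complex.I * θ)‖ = 1 := by
  rw [mul_comm]
  exact Complex.norm_exp_ofReal_mul_I θ

lemma norm_exp_I_mul_sub_le (θ θ' : ℝ) :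
    ‖Complex.exp (Complex.I * θ) - Complex.exp (Complex.I * θ')‖ ≤ |θ - θ'| := by
  have e : Complex.exp (Complex.I * θ) - Complex.exp (Complex.I * θ')
      = Complex.exp (Complex.I * θ') * (Complex.exp (Complex.I * (θ - θ' : ℝ)) - 1) := by
    rw [mul_sub, ← Complex.exp_add, mul_one]
    congr 2
    push_cast
    ring
  rw [e, norm_mul, norm_exp_I_mul, one_mul]
  exact Real.norm_exp_I_mul_ofReal_sub_one_le

section

variable {C : ℝ} {g : E3 → ℝ} {b b' : E3 × ℝ × ℝ}

lemma ProfileBound.nonneg (hg : ProfileBound C g) : 0 ≤ C := by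
  have := (abs_nonneg _).trans (hg.abs_le 0)
  exact nonneg_of_mul_nonneg_left this (pow_pos (wt_pos 0) 4)

lemma continuous_pulledProfile (hg : ProfileBound C g) (b : E3 × ℝ × ℝ) :
    Continuous (pulledProfile g b) := by
  unfold pulledProfile
  have := hg.continuous
  fun_prop

lemma abs_profile_scaled_le (hg : ProfileBound C g) (hb : b ∈ Metric.ball baseParam (1 / 2))
    (z : E3) : |g (b.2.1 ^ 2 • (z - b.1))| ≤ 256 * C * wt z ^ 4 := by
  refine (hg.abs_le _).trans ?_
  have := pow_le_pow_left₀ (wt_nonneg _) (wt_scaled_le hb z) 4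
  calc C * wt (b.2.1 ^ 2 • (z - b.1)) ^ 4 ≤ C * (4 * wt z) ^ 4 :=
        mul_le_mul_of_nonneg_left this hg.nonneg
    _ = _ := by ring

lemma pow_five_le (hb : b ∈ Metric.ball baseParam (1 / 2)) : b.2.1 ^ 5 ≤ 8 := by
  obtain ⟨h1, h2⟩ := scale_bounds hb
  calc b.2.1 ^ 5 ≤ (3 / 2) ^ 5 := by gcongr
    _ ≤ 8 := by norm_num

lemma norm_pulledProfile_le (hg : ProfileBound C g) (hb : b ∈ Metric.ball baseParam (1 / 2))
    (z : E3) : ‖pulledProfile g b z‖ ≤ 2048 * C * wt z ^ 4 := by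
  have h1 := (scale_bounds hb).1
  rw [pulledProfile, norm_mul, norm_mul, norm_exp_I_mul, Complex.norm_real, Complex.norm_real,
    Real.norm_of_nonneg (by positivity), mul_one]
  calc b.2.1 ^ 5 * |g (b.2.1 ^ 2 • (z - b.1))| ≤ 8 * (256 * C * wt z ^ 4) := by
        gcongr
        exacts [pow_five_le hb, abs_profile_scaled_le hg hb z]
    _ = _ := by ring

lemma norm_scaled_sub_le (hb : b ∈ Metric.ball baseParam (1 / 2))
    (hb' : b' ∈ Metric.ball baseParam (1 / 2)) (z : E3) :
    ‖b.2.1 ^ 2 • (z - b.1) - b'.2.1 ^ 2 • (z - b'.1)‖ ≤ 4 * ‖b - b'‖ * (1 + ‖z‖) := by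
  obtain ⟨h1, h2⟩ := scale_bounds hb
  obtain ⟨h1', h2'⟩ := scale_bounds hb'
  have h3 := (mem_ball_baseParam.1 hb).1
  obtain ⟨n1, n2, -⟩ := norm_components_le (b - b')
  simp only [Prod.fst_sub, Prod.snd_sub] at n1 n2
  have e : b.2.1 ^ 2 • (z - b.1) - b'.2.1 ^ 2 • (z - b'.1)
      = ((b.2.1 - b'.2.1) * (b.2.1 + b'.2.1)) • (z - b.1) - b'.2.1 ^ 2 • (b.1 - b'.1) := by
    module
  have h4 : ‖z - b.1‖ ≤ ‖z‖ + 1 / 2 := (norm_sub_le _ _).trans (by linarith)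
  have h5 := norm_nonneg (b - b')
  rw [e]
  refine (norm_sub_le _ _).trans ?_
  rw [norm_smul, norm_smul, Real.norm_of_nonneg (by positivity : 0 ≤ b'.2.1 ^ 2), norm_mul,
    Real.norm_eq_abs, Real.norm_of_nonneg (by linarith : 0 ≤ b.2.1 + b'.2.1)]
  calc |b.2.1 - b'.2.1| * (b.2.1 + b'.2.1) * ‖z - b.1‖ + b'.2.1 ^ 2 * ‖b.1 - b'.1‖
      ≤ ‖b - b'‖ * 3 * (‖z‖ + 1 / 2) + (3 / 2) ^ 2 * ‖b - b'‖ := by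
        gcongr
        linarith
    _ ≤ _ := by nlinarith [mul_nonneg h5 (norm_nonneg z)]

/-- Changing the scale moves the argument by an amount of order `|z|`, so one of the four powers of
the weight is lost. The cube that remains is the weight against which `Ḣ¹` functions are integrable.
-/
lemma norm_pulledProfile_sub_le (hg : ProfileBound C g)
    (hb : b ∈ Metric.ball baseParam (1 / 2)) (hb' : b' ∈ Metric.ball baseParam (1 / 2)) (z : E3) :
    ‖pulledProfile g b z - pulledProfile g b' z‖ ≤ 26000 * C * ‖b - b'‖ * wt z ^ 3 := by
  obtain ⟨h1, h2⟩ := scale_bounds hb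
  obtain ⟨h1', h2'⟩ := scale_bounds hb'
  obtain ⟨-, n2, n3⟩ := norm_components_le (b - b')
  simp only [Prod.snd_sub, Prod.fst_sub] at n2 n3
  have hC := hg.nonneg
  have h5 := norm_nonneg (b - b')
  have hw := wt_nonneg z
  have c1 : ‖((b.2.1 ^ 5 : ℝ) : ℂ) * Complex.exp (Complex.I * b.2.2)
      - ((b'.2.1 ^ 5 : ℝ) : ℂ) * Complex.exp (Complex.I * b'.2.2)‖ ≤ 34 * ‖b - b'‖ := by
    have e : ((b.2.1 ^ 5 : ℝ) : ℂ) * Complex.exp (Complex.I * b.2.2)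
      - ((b'.2.1 ^ 5 : ℝ) : ℂ) * Complex.exp (Complex.I * b'.2.2)
      = ((b.2.1 ^ 5 - b'.2.1 ^ 5 : ℝ) : ℂ) * Complex.exp (Complex.I * b.2.2)
        + ((b'.2.1 ^ 5 : ℝ) : ℂ) * (Complex.exp (Complex.I * b.2.2)
          - Complex.exp (Complex.I * b'.2.2)) := by
      push_cast
      ring
    have d1 : |b.2.1 ^ 5 - b'.2.1 ^ 5| ≤ 26 * ‖b - b'‖ := by
      have e5 : b.2.1 ^ 5 - b'.2.1 ^ 5 = (b.2.1 - b'.2.1) * (b.2.1 ^ 4 + b.2.1 ^ 3 * b'.2.1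
        + b.2.1 ^ 2 * b'.2.1 ^ 2 + b.2.1 * b'.2.1 ^ 3 + b'.2.1 ^ 4) := by ring
      rw [e5, abs_mul, abs_of_pos (by positivity : 0 < b.2.1 ^ 4 + b.2.1 ^ 3 * b'.2.1
        + b.2.1 ^ 2 * b'.2.1 ^ 2 + b.2.1 * b'.2.1 ^ 3 + b'.2.1 ^ 4), mul_comm]
      have hp : b.2.1 ^ 4 + b.2.1 ^ 3 * b'.2.1 + b.2.1 ^ 2 * b'.2.1 ^ 2 + b.2.1 * b'.2.1 ^ 3
          + b'.2.1 ^ 4 ≤ (3 / 2) ^ 4 + (3 / 2) ^ 3 * (3 / 2) + (3 / 2) ^ 2 * (3 / 2) ^ 2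
            + (3 / 2) * (3 / 2) ^ 3 + (3 / 2) ^ 4 := by gcongr
      gcongr
      exact hp.trans (by norm_num)
    rw [e]
    refine (norm_add_le _ _).trans ?_
    rw [norm_mul, norm_mul, norm_exp_I_mul, Complex.norm_real, Complex.norm_real,
      Real.norm_eq_abs, Real.norm_of_nonneg (by positivity : 0 ≤ b'.2.1 ^ 5), mul_one]
    calc _ ≤ 26 * ‖b - b'‖ + 8 * ‖b - b'‖ := by
          gcongr
          · exact pow_five_le hb'
          · exact (norm_exp_I_mul_sub_le _ _).trans n3
      _ = _ := by ring
  have c2 : |g (b.2.1 ^ 2 • (z - b.1)) - g (b'.2.1 ^ 2 • (z - b'.1))|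
      ≤ 2048 * C * ‖b - b'‖ * wt z ^ 3 := by
    have w1 := pow_le_pow_left₀ (wt_nonneg _) (wt_scaled_le hb z) 4
    have w2 := pow_le_pow_left₀ (wt_nonneg _) (wt_scaled_le hb' z) 4
    have w3 : (1 + ‖z‖) * wt z = 1 := mul_inv_cancel₀ (by positivity)
    calc _ ≤ C * ‖b.2.1 ^ 2 • (z - b.1) - b'.2.1 ^ 2 • (z - b'.1)‖
            * (wt (b.2.1 ^ 2 • (z - b.1)) ^ 4 + wt (b'.2.1 ^ 2 • (z - b'.1)) ^ 4) :=
          hg.abs_sub_le _ _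
      _ ≤ C * (4 * ‖b - b'‖ * (1 + ‖z‖)) * ((4 * wt z) ^ 4 + (4 * wt z) ^ 4) := by
          have q1 := pow_nonneg (wt_nonneg (b.2.1 ^ 2 • (z - b.1))) 4
          have q2 := pow_nonneg (wt_nonneg (b'.2.1 ^ 2 • (z - b'.1))) 4
          gcongr
          exact norm_scaled_sub_le hb hb' z
      _ = 2048 * C * ‖b - b'‖ * wt z ^ 3 * ((1 + ‖z‖) * wt z) := by ring
      _ = _ := by rw [w3, mul_one]
  have e : pulledProfile g b z - pulledProfile g b' z
      = (((b.2.1 ^ 5 : ℝ) : ℂ) * Complex.exp (Complex.I * b.2.2)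
        - ((b'.2.1 ^ 5 : ℝ) : ℂ) * Complex.exp (Complex.I * b'.2.2))
          * (g (b.2.1 ^ 2 • (z - b.1)) : ℝ)
        + ((b'.2.1 ^ 5 : ℝ) : ℂ) * Complex.exp (Complex.I * b'.2.2)
          * ((g (b.2.1 ^ 2 • (z - b.1)) - g (b'.2.1 ^ 2 • (z - b'.1)) : ℝ) : ℂ) := by
    simp only [pulledProfile]
    push_cast
    ring
  rw [e]
  refine (norm_add_le _ _).trans ?_
  rw [norm_mul, norm_mul, norm_mul, norm_exp_I_mul, Complex.norm_real, Complex.norm_real,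
    Complex.norm_real, Real.norm_of_nonneg (by positivity : 0 ≤ b'.2.1 ^ 5), mul_one,
    Real.norm_eq_abs, Real.norm_eq_abs]
  calc _ ≤ 34 * ‖b - b'‖ * (256 * C * wt z ^ 3) + 8 * (2048 * C * ‖b - b'‖ * wt z ^ 3) := by
        gcongr
        · refine (abs_profile_scaled_le hg hb z).trans ?_
          gcongr 256 * C * ?_
          exact wt_pow_le (by norm_num) z
        · exact pow_five_le hb'
    _ ≤ _ := by
        have : 0 ≤ C * ‖b - b'‖ * wt z ^ 3 := by positivity
        linarith

variable {v : E3 → ℂ}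

lemma integrable_mul_of_norm_le (hv : AEStronglyMeasurable v)
    (hvi : Integrable fun x => ‖v x‖ * wt x ^ 3) {k : E3 → ℂ} (hk : Continuous k) {A : ℝ}
    (hkA : ∀ z, ‖k z‖ ≤ A * wt z ^ 3) :
    Integrable (fun z => v z * k z) ∧
      ‖∫ z, v z * k z‖ ≤ A * ∫ x, ‖v x‖ * wt x ^ 3 := by
  have hpt : ∀ z, ‖v z * k z‖ ≤ A * (‖v z‖ * wt z ^ 3) := fun z => by
    rw [norm_mul]
    have := mul_le_mul_of_nonneg_left (hkA z) (norm_nonneg (v z))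
    linarith
  refine ⟨(hvi.const_mul A).mono' (hv.mul hk.aestronglyMeasurable) (Eventually.of_forall hpt), ?_⟩
  refine (norm_integral_le_of_norm_le (hvi.const_mul A) (Eventually.of_forall hpt)).trans ?_
  rw [integral_const_mul]

lemma integrable_mul_pulledProfile (hv : AEStronglyMeasurable v)
    (hvi : Integrable fun x => ‖v x‖ * wt x ^ 3) (hg : ProfileBound C g)
    (hb : b ∈ Metric.ball baseParam (1 / 2)) :
    Integrable (fun z => v z * pulledProfile g b z) ∧
      ‖∫ z, v z * pulledProfile g b z‖ ≤ 2048 * C * ∫ x, ‖v x‖ * wt x ^ 3 := by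
  refine integrable_mul_of_norm_le hv hvi (continuous_pulledProfile hg b) fun z => ?_
  refine (norm_pulledProfile_le hg hb z).trans ?_
  have := hg.nonneg
  gcongr 2048 * C * ?_
  exact wt_pow_le (by norm_num) z

lemma integrable_transf_mul_profile (hv : AEStronglyMeasurable v)
    (hvi : Integrable fun x => ‖v x‖ * wt x ^ 3) (hg : ProfileBound C g)
    (hb : b ∈ Metric.ball baseParam (1 / 2)) :
    Integrable fun x => transf b v x * g x :=
  integrable_transf_mul (by linarith [(scale_bounds hb).1])
    (integrable_mul_pulledProfile hv hvi hg hb).1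

lemma norm_integral_transf_mul_le (hv : AEStronglyMeasurable v)
    (hvi : Integrable fun x => ‖v x‖ * wt x ^ 3) (hg : ProfileBound C g)
    (hb : b ∈ Metric.ball baseParam (1 / 2)) :
    ‖∫ x, transf b v x * g x‖ ≤ 2048 * C * ∫ x, ‖v x‖ * wt x ^ 3 := by
  rw [integral_transf_mul (by linarith [(scale_bounds hb).1])]
  exact (integrable_mul_pulledProfile hv hvi hg hb).2

lemma norm_integral_transf_mul_sub_le (hv : AEStronglyMeasurable v)
    (hvi : Integrable fun x => ‖v x‖ * wt x ^ 3) (hg : ProfileBound C g)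
    (hb : b ∈ Metric.ball baseParam (1 / 2)) (hb' : b' ∈ Metric.ball baseParam (1 / 2)) :
    ‖(∫ x, transf b v x * g x) - ∫ x, transf b' v x * g x‖
      ≤ 26000 * C * (∫ x, ‖v x‖ * wt x ^ 3) * ‖b - b'‖ := by
  rw [integral_transf_mul (by linarith [(scale_bounds hb).1]),
    integral_transf_mul (by linarith [(scale_bounds hb').1]),
    ← integral_sub (integrable_mul_pulledProfile hv hvi hg hb).1
      (integrable_mul_pulledProfile hv hvi hg hb').1]
  simp_rw [← mul_sub]
  refine (integrable_mul_of_norm_le hv hvi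
    ((continuous_pulledProfile hg b).sub (continuous_pulledProfile hg b'))
    (norm_pulledProfile_sub_le hg hb hb')).2.trans (le_of_eq ?_)
  ring

end

/-! ### The orbit of the Talenti function under the parameter group -/

/-- The point at which `T_b` evaluates its argument. -/
def movedPoint (b : E3 × ℝ × ℝ) (x : E3) : E3 := (b.2.1 ^ 2)⁻¹ • x + b.1

/-- The coefficient of the scale direction in the derivative of `b ↦ T_b W`. -/
def orbitScaleCoeff (b : E3 × ℝ × ℝ) (x : E3) : ℝ :=
  -(b.2.1 ^ 2)⁻¹ * talenti (movedPoint b x)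
    + 2 / 3 * (b.2.1 ^ 4)⁻¹ * talenti (movedPoint b x) ^ 3 * inner ℝ (movedPoint b x) x

/-- The derivative of `b ↦ T_b W(x)`. -/
def orbitDeriv (b : E3 × ℝ × ℝ) (x : E3) : E3 × ℝ × ℝ →L[ℝ] ℂ :=
  Complex.exp (Complex.I * b.2.2) •
    (Complex.ofRealCLM.comp
      ((-(1 / 3) * b.2.1⁻¹ * talenti (movedPoint b x) ^ 3) •
          (innerSL ℝ (movedPoint b x)).comp (ContinuousLinearMap.fst ℝ E3 (ℝ × ℝ))
        + orbitScaleCoeff b x •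
          (ContinuousLinearMap.fst ℝ ℝ ℝ).comp (ContinuousLinearMap.snd ℝ E3 (ℝ × ℝ)))
      + (Complex.I * ((b.2.1⁻¹ * talenti (movedPoint b x) : ℝ) : ℂ)) •
        Complex.ofRealCLM.comp
          ((ContinuousLinearMap.snd ℝ ℝ ℝ).comp (ContinuousLinearMap.snd ℝ E3 (ℝ × ℝ))))

lemma orbitDeriv_apply (b : E3 × ℝ × ℝ) (x : E3) (c : E3 × ℝ × ℝ) :
    orbitDeriv b x c = Complex.exp (Complex.I * b.2.2) *
      (((-(1 / 3) * b.2.1⁻¹ * talenti (movedPoint b x) ^ 3 * inner ℝ (movedPoint b x) c.1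
        + orbitScaleCoeff b x * c.2.1 : ℝ) : ℂ)
        + Complex.I * ((b.2.1⁻¹ * talenti (movedPoint b x) * c.2.2 : ℝ) : ℂ)) := by
  simp [orbitDeriv]
  ring

lemma hasFDerivAt_transf_talenti {b : E3 × ℝ × ℝ} (hb : b.2.1 ≠ 0) (x : E3) :
    HasFDerivAt (fun b => transf b (fun x => (talenti x : ℂ)) x) (orbitDeriv b x) b := by
  have hν : HasFDerivAt (fun b : E3 × ℝ × ℝ => b.2.1)
      ((ContinuousLinearMap.fst ℝ ℝ ℝ).comp (ContinuousLinearMap.snd ℝ E3 (ℝ × ℝ))) b :=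
    ((ContinuousLinearMap.fst ℝ ℝ ℝ).comp (ContinuousLinearMap.snd ℝ E3 (ℝ × ℝ))).hasFDerivAt
  have hθ : HasFDerivAt (fun b : E3 × ℝ × ℝ => b.2.2)
      ((ContinuousLinearMap.snd ℝ ℝ ℝ).comp (ContinuousLinearMap.snd ℝ E3 (ℝ × ℝ))) b :=
    ((ContinuousLinearMap.snd ℝ ℝ ℝ).comp (ContinuousLinearMap.snd ℝ E3 (ℝ × ℝ))).hasFDerivAt
  have hi := (hasDerivAt_inv hb).comp_hasFDerivAt b hν
  have hi2 := ((hasDerivAt_pow 2 b.2.1).fun_inv (pow_ne_zero 2 hb)).comp_hasFDerivAt b hν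
  have hz : HasFDerivAt (fun b => movedPoint b x) _ b :=
    (hi2.smul_const x).add hasFDerivAt_fst
  have ht := (hasFDerivAt_talenti' (movedPoint b x)).comp b hz
  have hA := Complex.ofRealCLM.hasFDerivAt.comp b (hi.mul ht)
  have hE := ((Complex.ofRealCLM.hasFDerivAt.comp b hθ).const_mul Complex.I).cexp
  refine ((hE.mul hA).congr_fderiv ?_).congr_of_eventuallyEq (Eventually.of_forall fun c => ?_)
  · refine ContinuousLinearMap.ext fun c => ?_
    rw [orbitDeriv_apply]
    simp [orbitScaleCoeff]
    have : (b.2.1 : ℂ) ≠ 0 := by exact_mod_cast hb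
    field_simp
    ring
  · simp [transf, movedPoint]
    ring

/-- The tangent directions of the orbit are those paired with the test profiles. The factor `-2` of
`ΛW` comes from the parametrization by `ν⁻¹ W(ν⁻² x)`. -/
lemma orbitDeriv_baseParam (x : E3) (c : E3 × ℝ × ℝ) :
    orbitDeriv baseParam x c =
      ((∑ j, c.1 j * partialD j talenti x - 2 * c.2.1 * lam talenti x : ℝ) : ℂ)
        + Complex.I * ((c.2.2 * talenti x : ℝ) : ℂ) := by
  have hm : movedPoint baseParam x = x := by simp [movedPoint, baseParam]
  have h1 : ∑ j, c.1 j * partialD j talenti x = -(1 / 3) * talenti x ^ 3 * inner ℝ x c.1 := by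
    simp only [partialD_talenti', PiLp.inner_apply, RCLike.inner_apply, conj_trivial,
      Finset.mul_sum]
    exact Finset.sum_congr rfl fun j _ => by ring
  rw [orbitDeriv_apply, hm, h1, lam_talenti, orbitScaleCoeff, hm, real_inner_self_eq_norm_sq,
    mul_assoc (2 / 3 * _), talenti_cube_mul_norm_sq]
  simp [baseParam]
  ring

lemma continuous_movedPoint (b : E3 × ℝ × ℝ) : Continuous (movedPoint b) := by
  unfold movedPoint
  fun_prop

lemma continuous_orbitDeriv (b : E3 × ℝ × ℝ) : Continuous (orbitDeriv b) := by
  have h1 := continuous_movedPoint b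
  have h2 := continuous_talenti.comp h1
  simp only [Function.comp_def] at h2
  have h3 : Continuous fun x => innerSL ℝ (movedPoint b x) := (innerSL ℝ).continuous.comp h1
  have h4 : Continuous (orbitScaleCoeff b) := by
    unfold orbitScaleCoeff
    fun_prop
  unfold orbitDeriv
  have h5 := Complex.continuous_ofReal.comp (continuous_const.mul h2 :
    Continuous fun x => b.2.1⁻¹ * talenti (movedPoint b x))
  simp only [Function.comp_def] at h5
  fun_prop

lemma continuousAt_orbitDeriv {b : E3 × ℝ × ℝ} (hb : b.2.1 ≠ 0) (x : E3) :
    ContinuousAt (fun b => orbitDeriv b x) b := by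
  have hν : ContinuousAt (fun b : E3 × ℝ × ℝ => b.2.1) b := by fun_prop
  have hi : ContinuousAt (fun b : E3 × ℝ × ℝ => b.2.1⁻¹) b := hν.inv₀ hb
  have hi2 : ContinuousAt (fun b : E3 × ℝ × ℝ => (b.2.1 ^ 2)⁻¹) b :=
    (hν.pow 2).inv₀ (pow_ne_zero 2 hb)
  have hi4 : ContinuousAt (fun b : E3 × ℝ × ℝ => (b.2.1 ^ 4)⁻¹) b :=
    (hν.pow 4).inv₀ (pow_ne_zero 4 hb)
  have h1 : ContinuousAt (fun b => movedPoint b x) b := by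
    unfold movedPoint
    fun_prop
  have h2 : ContinuousAt (fun b => talenti (movedPoint b x)) b :=
    continuous_talenti.continuousAt.comp h1
  have h3 : ContinuousAt (fun b => innerSL ℝ (movedPoint b x)) b :=
    (innerSL ℝ).continuous.continuousAt.comp h1
  have h4 : ContinuousAt (fun b => orbitScaleCoeff b x) b := by
    unfold orbitScaleCoeff
    fun_prop
  have h5 : ContinuousAt (fun b => ((b.2.1⁻¹ * talenti (movedPoint b x) : ℝ) : ℂ)) b :=
    Complex.continuous_ofReal.continuousAt.comp (hi.mul h2)
  have h6 : ContinuousAt (fun b : E3 × ℝ × ℝ => Complex.exp (Complex.I * b.2.2)) b := by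
    fun_prop
  unfold orbitDeriv
  fun_prop

/-- Differentiating in the scale produces a factor `x`, but `∇W` decays like `|x|⁻²`, so the
derivative is bounded. The three directions contribute at most `2`, `20` and `2`. -/
lemma norm_orbitDeriv_le {b : E3 × ℝ × ℝ} (hb : b ∈ Metric.ball baseParam (1 / 2)) (x : E3) :
    ‖orbitDeriv b x‖ ≤ 30 := by
  obtain ⟨h1, h2⟩ := scale_bounds hb
  have hy := (mem_ball_baseParam.1 hb).1
  set z := movedPoint b x with hz
  -- Everything is expressed through the moved point `z`, where the bounds on `W` apply.
  have hx : x = b.2.1 ^ 2 • (z - b.1) := by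
    rw [hz, movedPoint, add_sub_cancel_right, smul_smul, mul_inv_cancel₀ (by positivity), one_smul]
  have t0 := talenti_pos z
  have t1 := talenti_le_one z
  have t2 := talenti_mul_norm_le z
  have i1 : b.2.1⁻¹ ≤ 2 := by
    rw [inv_le_comm₀ (by linarith) (by norm_num)]
    linarith
  have i0 : 0 < b.2.1⁻¹ := by positivity
  have i2 : (b.2.1 ^ 2)⁻¹ ≤ 4 := by
    rw [← inv_pow]
    nlinarith
  have hzz : talenti z ^ 3 * ‖z‖ ≤ 2 := by
    calc talenti z ^ 3 * ‖z‖ = talenti z ^ 2 * (talenti z * ‖z‖) := by ring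
      _ ≤ 1 ^ 2 * 2 := by gcongr
      _ = 2 := by norm_num
  have hzz2 : talenti z ^ 3 * ‖z‖ * ‖z - b.1‖ ≤ 5 := by
    have q : ‖z - b.1‖ ≤ ‖z‖ + 1 / 2 := (norm_sub_le _ _).trans (by linarith)
    calc talenti z ^ 3 * ‖z‖ * ‖z - b.1‖ ≤ talenti z ^ 3 * ‖z‖ * (‖z‖ + 1 / 2) := by gcongr
      _ = talenti z * (talenti z * ‖z‖) ^ 2 + talenti z ^ 3 * ‖z‖ * (1 / 2) := by ring
      _ ≤ 1 * 2 ^ 2 + 2 * (1 / 2) := by gcongr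
      _ = 5 := by norm_num
  have hs : |orbitScaleCoeff b x| ≤ 20 := by
    have e : orbitScaleCoeff b x = -((b.2.1 ^ 2)⁻¹ * talenti z)
        + 2 / 3 * (b.2.1 ^ 2)⁻¹ * (talenti z ^ 3 * inner ℝ z (z - b.1)) := by
      have : inner ℝ z x = b.2.1 ^ 2 * inner ℝ z (z - b.1) := by
        conv_lhs => rw [hx]
        rw [inner_smul_right]
      rw [orbitScaleCoeff, ← hz, this]
      field_simp
    rw [e]
    refine (abs_add_le _ _).trans ?_
    rw [abs_neg, abs_of_pos (by positivity), abs_mul (2 / 3 * (b.2.1 ^ 2)⁻¹), abs_mul (_ ^ 3),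
      abs_of_pos (by positivity : (0:ℝ) < 2 / 3 * (b.2.1 ^ 2)⁻¹),
      abs_of_pos (by positivity : 0 < talenti z ^ 3)]
    have q : talenti z ^ 3 * |inner ℝ z (z - b.1)| ≤ 5 := by
      refine le_trans ?_ hzz2
      rw [mul_assoc]
      gcongr
      exact abs_real_inner_le_norm _ _
    have q2 : (b.2.1 ^ 2)⁻¹ * talenti z
        + 2 / 3 * (b.2.1 ^ 2)⁻¹ * (talenti z ^ 3 * |inner ℝ z (z - b.1)|)
        ≤ 4 * 1 + 2 / 3 * 4 * 5 := by gcongr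
    exact q2.trans (by norm_num)
  refine ContinuousLinearMap.opNorm_le_bound _ (by norm_num) fun c => ?_
  obtain ⟨n1, n2, n3⟩ := norm_components_le c
  have nc := norm_nonneg c
  rw [orbitDeriv_apply, norm_mul, norm_exp_I_mul, one_mul, ← hz]
  refine (norm_add_le _ _).trans ?_
  rw [norm_mul, Complex.norm_I, one_mul, Complex.norm_real, Complex.norm_real, Real.norm_eq_abs,
    Real.norm_eq_abs]
  have p1 : |-(1 / 3) * b.2.1⁻¹ * talenti z ^ 3 * inner ℝ z c.1| ≤ 2 * ‖c‖ := by
    rw [abs_mul, abs_mul, abs_mul, abs_of_pos i0, abs_of_pos (by positivity : 0 < talenti z ^ 3)]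
    calc _ ≤ |-(1 / 3 : ℝ)| * b.2.1⁻¹ * talenti z ^ 3 * (‖z‖ * ‖c.1‖) := by
          gcongr
          exact abs_real_inner_le_norm _ _
      _ = 1 / 3 * b.2.1⁻¹ * (talenti z ^ 3 * ‖z‖) * ‖c.1‖ := by
          rw [abs_neg, abs_of_pos (by norm_num : (0:ℝ) < 1 / 3)]
          ring
      _ ≤ 1 / 3 * 2 * 2 * ‖c‖ := by gcongr
      _ ≤ _ := by linarith
  have p2 : |orbitScaleCoeff b x * c.2.1| ≤ 20 * ‖c‖ := by
    rw [abs_mul]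
    gcongr
  have p3 : |b.2.1⁻¹ * talenti z * c.2.2| ≤ 2 * ‖c‖ := by
    rw [abs_mul, abs_mul, abs_of_pos i0, abs_of_pos t0]
    calc _ ≤ 2 * 1 * ‖c‖ := by gcongr
      _ = _ := by ring
  have := abs_add_le (-(1 / 3) * b.2.1⁻¹ * talenti z ^ 3 * inner ℝ z c.1)
    (orbitScaleCoeff b x * c.2.1)
  linarith

lemma integrable_norm_talenti_mul_wt :
    Integrable fun x : E3 => ‖((talenti x : ℝ) : ℂ)‖ * wt x ^ 3 := by
  refine integrable_of_le_wt (n := 4) (C := 3) le_rfl ?_ fun x => ?_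
  · have := continuous_talenti
    have := continuous_wt
    fun_prop
  · rw [norm_mul, norm_norm, Complex.norm_real, Real.norm_of_nonneg (talenti_pos x).le,
      Real.norm_of_nonneg (pow_nonneg (wt_nonneg x) 3)]
    have := mul_le_mul_of_nonneg_right (talenti_le_wt x) (pow_nonneg (wt_nonneg x) 3)
    linarith

/-- The modulus of continuity of the derivative of the orbit, in weighted `L¹`. -/
lemma tendsto_integral_norm_orbitDeriv_sub :
    Tendsto (fun b => ∫ x, ‖orbitDeriv b x - orbitDeriv baseParam x‖ * wt x ^ 4)
      (𝓝 baseParam) (𝓝 0) := by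
  have h0 : ∫ x, ‖orbitDeriv baseParam x - orbitDeriv baseParam x‖ * wt x ^ 4 = 0 := by simp
  rw [← h0]
  have hb0 : (baseParam).2.1 ≠ 0 := by simp [baseParam]
  have hball : Metric.ball baseParam (1 / 2) ∈ 𝓝 baseParam := Metric.ball_mem_nhds _ (by norm_num)
  refine tendsto_integral_filter_of_dominated_convergence (fun x => 60 * wt x ^ 4) ?_ ?_
    ((integrable_wt_pow le_rfl).const_mul 60) ?_
  · refine Eventually.of_forall fun b => Continuous.aestronglyMeasurable ?_
    exact ((continuous_orbitDeriv b).sub (continuous_orbitDeriv _)).norm.mul (continuous_wt.pow 4)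
  · filter_upwards [hball] with b hb
    refine Eventually.of_forall fun x => ?_
    have hw := pow_nonneg (wt_nonneg x) 4
    rw [norm_mul, norm_norm, Real.norm_of_nonneg hw]
    refine mul_le_mul_of_nonneg_right ?_ hw
    have := norm_sub_le (orbitDeriv b x) (orbitDeriv baseParam x)
    have := norm_orbitDeriv_le hb x
    have := norm_orbitDeriv_le (Metric.mem_ball_self (by norm_num : (0:ℝ) < 1 / 2)) x
    linarith
  · refine Eventually.of_forall fun x => Tendsto.mul_const _ (Tendsto.norm ?_)
    exact (continuousAt_orbitDeriv hb0 x).sub continuousAt_const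

section

variable {C : ℝ} {g : E3 → ℝ} {b b' : E3 × ℝ × ℝ}

lemma integrable_orbitDeriv_mul (hg : ProfileBound C g) (hb : b ∈ Metric.ball baseParam (1 / 2)) :
    Integrable fun x => (g x : ℂ) • orbitDeriv b x := by
  refine integrable_of_le_wt (n := 4) (C := 30 * C) le_rfl ?_ fun x => ?_
  · exact ((Complex.continuous_ofReal.comp hg.continuous).smul
      (continuous_orbitDeriv b)).aestronglyMeasurable
  · rw [norm_smul, Complex.norm_real, Real.norm_eq_abs]
    have := mul_le_mul (hg.abs_le x) (norm_orbitDeriv_le hb x) (norm_nonneg _)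
      (mul_nonneg hg.nonneg (pow_nonneg (wt_nonneg x) 4))
    linarith

lemma hasFDerivAt_integral_transf_talenti (hg : ProfileBound C g)
    (hb : b ∈ Metric.ball baseParam (1 / 2)) :
    HasFDerivAt (fun b => ∫ x, transf b (fun x => (talenti x : ℂ)) x * g x)
      (∫ x, (g x : ℂ) • orbitDeriv b x) b := by
  have hWm : AEStronglyMeasurable (fun x : E3 => ((talenti x : ℝ) : ℂ)) :=
    (Complex.continuous_ofReal.comp continuous_talenti).aestronglyMeasurable
  have hnh := Metric.isOpen_ball.mem_nhds hb
  refine hasFDerivAt_integral_of_dominated_of_fderiv_le (bound := fun x => 30 * C * wt x ^ 4)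
    (F' := fun b x => (g x : ℂ) • orbitDeriv b x)
    hnh ?_ ?_ (integrable_orbitDeriv_mul hg hb).aestronglyMeasurable ?_
    ((integrable_wt_pow le_rfl).const_mul _) ?_
  · filter_upwards [hnh] with b hb
    exact (integrable_transf_mul_profile hWm integrable_norm_talenti_mul_wt hg
      hb).aestronglyMeasurable
  · exact integrable_transf_mul_profile hWm integrable_norm_talenti_mul_wt hg hb
  · refine Eventually.of_forall fun x b hb => ?_
    rw [norm_smul, Complex.norm_real, Real.norm_eq_abs]
    have := mul_le_mul (hg.abs_le x) (norm_orbitDeriv_le hb x) (norm_nonneg _)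
      (mul_nonneg hg.nonneg (pow_nonneg (wt_nonneg x) 4))
    linarith
  · refine Eventually.of_forall fun x b hb => ?_
    exact (hasFDerivAt_transf_talenti (by linarith [(scale_bounds hb).1]) x).mul_const (g x : ℂ)

lemma norm_integral_orbitDeriv_sub_le (hg : ProfileBound C g)
    (hb : b ∈ Metric.ball baseParam (1 / 2)) :
    ‖(∫ x, (g x : ℂ) • orbitDeriv b x) - ∫ x, (g x : ℂ) • orbitDeriv baseParam x‖
      ≤ C * ∫ x, ‖orbitDeriv b x - orbitDeriv baseParam x‖ * wt x ^ 4 := by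
  have hb0 : baseParam ∈ Metric.ball baseParam (1 / 2) := Metric.mem_ball_self (by norm_num)
  have hi : Integrable fun x => ‖orbitDeriv b x - orbitDeriv baseParam x‖ * wt x ^ 4 := by
    refine integrable_of_le_wt (n := 4) (C := 60) le_rfl ?_ fun x => ?_
    · exact (((continuous_orbitDeriv b).sub (continuous_orbitDeriv _)).norm.mul
        (continuous_wt.pow 4)).aestronglyMeasurable
    · have hw := pow_nonneg (wt_nonneg x) 4
      rw [norm_mul, norm_norm, Real.norm_of_nonneg hw]
      refine mul_le_mul_of_nonneg_right ?_ hw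
      have := norm_sub_le (orbitDeriv b x) (orbitDeriv baseParam x)
      have := norm_orbitDeriv_le hb x
      have := norm_orbitDeriv_le hb0 x
      linarith
  rw [← integral_sub (integrable_orbitDeriv_mul hg hb) (integrable_orbitDeriv_mul hg hb0),
    ← integral_const_mul]
  refine norm_integral_le_of_norm_le (hi.const_mul C) (Eventually.of_forall fun x => ?_)
  have e : (g x : ℂ) • orbitDeriv b x - (g x : ℂ) • orbitDeriv baseParam x
      = (g x : ℂ) • (orbitDeriv b x - orbitDeriv baseParam x) := (smul_sub _ _ _).symm
  rw [e, norm_smul, Complex.norm_real, Real.norm_eq_abs]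
  have := mul_le_mul_of_nonneg_right (hg.abs_le x)
    (norm_nonneg (orbitDeriv b x - orbitDeriv baseParam x))
  linarith

end

/-- Near the neutral parameter, the orbit map tested against profiles is uniformly close to its
linearization. -/
theorem exists_orbit_linearization {ε : ℝ} (hε : 0 < ε) :
    ∃ r, 0 < r ∧ r < 1 / 2 ∧ ∀ (C : ℝ) (g : E3 → ℝ), ProfileBound C g →
      ∀ b ∈ Metric.ball baseParam r, ∀ b' ∈ Metric.ball baseParam r,
        ‖(∫ x, transf b (fun x => (talenti x : ℂ)) x * g x)
          - (∫ x, transf b' (fun x => (talenti x : ℂ)) x * g x)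
          - ∫ x, (g x : ℂ) * orbitDeriv baseParam x (b - b')‖ ≤ ε * C * ‖b - b'‖ := by
  obtain ⟨r₀, hr₀, hr⟩ := Metric.eventually_nhds_iff_ball.1
    (tendsto_integral_norm_orbitDeriv_sub.eventually_lt_const hε)
  refine ⟨min r₀ (1 / 4), lt_min hr₀ (by norm_num), (min_le_right _ _).trans_lt (by norm_num),
    fun C g hg b hb b' hb' => ?_⟩
  have hsub : Metric.ball baseParam (min r₀ (1 / 4)) ⊆ Metric.ball baseParam (1 / 2) :=
    Metric.ball_subset_ball ((min_le_right _ _).trans (by norm_num))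
  have hb0 : baseParam ∈ Metric.ball baseParam (1 / 2) := Metric.mem_ball_self (by norm_num)
  -- The mean value inequality on a convex ball, for the map minus its derivative at the neutral
  -- parameter. The radius depends only on the orbit of `W`, and the profile enters only through
  -- `C`.
  have h := (convex_ball baseParam (min r₀ (1 / 4))).norm_image_sub_le_of_norm_hasFDerivWithin_le'
    (𝕜 := ℝ)
    (f := fun b => ∫ x, transf b (fun x => (talenti x : ℂ)) x * g x)
    (φ := ∫ x, (g x : ℂ) • orbitDeriv baseParam x) (C := ε * C)
    (fun c hc => (hasFDerivAt_integral_transf_talenti hg (hsub hc)).hasFDerivWithinAt)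
    (fun c hc => (norm_integral_orbitDeriv_sub_le hg (hsub hc)).trans (by
      rw [mul_comm ε]
      exact mul_le_mul_of_nonneg_left
        (hr c (Metric.ball_subset_ball (min_le_left _ _) hc)).le hg.nonneg)) hb' hb
  rwa [ContinuousLinearMap.integral_apply (integrable_orbitDeriv_mul hg hb0)] at h

/-! ### Zeros of perturbations of the identity depending on a parameter -/

/-- For each `u` the map `b ↦ b - N u b` is a contraction of factor `1/2`, so its fixed points are
the zeros of `N u`. The same estimate makes `N u` injective on the whole ball with an inverse of
Lipschitz constant `2`, which yields uniqueness there and Lipschitz dependence on `u`. -/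
theorem exists_continuous_zero {X P : Type*} [PseudoMetricSpace X] [NormedAddCommGroup P]
    [CompleteSpace P] {N : X → P → P} {p : P} {r K : ℝ} (hr : 0 < r)
    (hN : ∀ u, ∀ b ∈ Metric.ball p r, ∀ b' ∈ Metric.ball p r,
      ‖N u b - N u b' - (b - b')‖ ≤ 1 / 2 * ‖b - b'‖)
    (hNp : ∀ u, ‖N u p‖ ≤ r / 8)
    (hNu : ∀ u u', ∀ b ∈ Metric.ball p r, ‖N u b - N u' b‖ ≤ K * dist u u') :
    ∃ β : X → P, Continuous β ∧ (∀ u, β u ∈ Metric.closedBall p (r / 4) ∧ N u (β u) = 0) ∧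
      ∀ u, ∀ b ∈ Metric.ball p r, N u b = 0 → b = β u := by
  have hsub : Metric.closedBall p (r / 4) ⊆ Metric.ball p r :=
    Metric.closedBall_subset_ball (by linarith)
  have hp : p ∈ Metric.ball p r := Metric.mem_ball_self hr
  have hinj : ∀ u, ∀ b ∈ Metric.ball p r, ∀ b' ∈ Metric.ball p r,
      ‖b - b'‖ ≤ 2 * ‖N u b - N u b'‖ := fun u b hb b' hb' => by
    have h1 := hN u b hb b' hb'
    have h2 := norm_sub_norm_le (b - b') (N u b - N u b')
    rw [norm_sub_rev (b - b')] at h2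
    linarith
  have hex : ∀ u, ∃ b ∈ Metric.closedBall p (r / 4), N u b = 0 := fun u => by
    -- The radius `r/4` is preserved because contraction gives `r/8` and the value at the centre
    -- adds at most `r/8`.
    have hmaps : MapsTo (fun b => b - N u b) (Metric.closedBall p (r / 4))
        (Metric.closedBall p (r / 4)) := fun b hb => by
      have h1 := hN u b (hsub hb) p hp
      rw [mem_closedBall_iff_norm] at hb ⊢
      have h2 : b - N u b - p = -(N u b - N u p - (b - p)) - N u p := by abel
      rw [h2]
      refine (norm_sub_le _ _).trans ?_
      rw [norm_neg]
      linarith [hNp u]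
    have hc : ContractingWith (1 / 2) (hmaps.restrict (fun b => b - N u b) _ _) := by
      refine ⟨by norm_num, LipschitzWith.of_dist_le_mul fun b b' => ?_⟩
      rw [Subtype.dist_eq, Subtype.dist_eq, dist_eq_norm, dist_eq_norm]
      have h1 := hN u b (hsub b.2) b' (hsub b'.2)
      have h2 : (b : P) - N u b - (b' - N u b') = -(N u b - N u b' - (b - b')) := by abel
      simp only [MapsTo.val_restrict_apply, h2, norm_neg]
      simpa using h1
    obtain ⟨b, hb, hfix, -⟩ := hc.exists_fixedPoint' Metric.isClosed_closedBall.isComplete hmaps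
      (Metric.mem_closedBall_self (by linarith : 0 ≤ r / 4)) (edist_ne_top _ _)
    exact ⟨b, hb, by simpa [Function.IsFixedPt] using hfix⟩
  choose β hβ hβ0 using hex
  refine ⟨β, ?_, fun u => ⟨hβ u, hβ0 u⟩, fun u b hb h0 => ?_⟩
  -- Compare the two zeros under `N u`: there `N u (β u')` differs from `N u' (β u') = 0` by at most
  -- `K dist u u'`.
  · refine (LipschitzWith.of_dist_le_mul (K := (2 * K).toNNReal) fun u u' => ?_).continuous
    rw [dist_eq_norm]
    have h1 := hinj u _ (hsub (hβ u)) _ (hsub (hβ u'))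
    have h2 := hNu u' u _ (hsub (hβ u'))
    rw [hβ0 u', zero_sub, norm_neg, dist_comm] at h2
    rw [hβ0 u, zero_sub, norm_neg] at h1
    refine (h1.trans (by linarith)).trans (mul_le_mul_of_nonneg_right
      (Real.le_coe_toNNReal (2 * K)) dist_nonneg)
  · have := hinj u b hb _ (hsub (hβ u))
    rw [h0, hβ0 u, sub_self, norm_zero, mul_zero] at this
    exact sub_eq_zero.1 (norm_le_zero_iff.1 this)

/-! ### The pairings defining the modulation parameters -/

/-- The pairing of `T_b u - W` with a test profile. -/
def profilePairing (g : E3 → ℝ) (u : E3 → ℂ) (b : E3 × ℝ × ℝ) : ℂ :=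
  ∫ x, (transf b u x - (talenti x : ℂ)) * g x

lemma toFun_sub_ae (u u' : Hdot1) :
    (fun x => u.toFun x - u'.toFun x) =ᵐ[volume] (u - u').toFun := by
  have h : (u - u').1.1 = u.1.1 - u'.1.1 := rfl
  simp only [Hdot1.toFun, h]
  filter_upwards [Lp.coeFn_sub u.1.1 u'.1.1] with x hx
  rw [hx, Pi.sub_apply]

lemma toFun_talentiH_ae : talentiH.toFun =ᵐ[volume] fun x => (talenti x : ℂ) :=
  memLp_talenti.coeFn_toLp

lemma exists_integral_norm_sub_mul_wt_le : ∃ K, 0 < K ∧ ∀ u u' : Hdot1,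
    (Integrable fun x => ‖u.toFun x - u'.toFun x‖ * wt x ^ 3) ∧
      ∫ x, ‖u.toFun x - u'.toFun x‖ * wt x ^ 3 ≤ K * dist u u' := by
  obtain ⟨K, hK, h⟩ := exists_integral_norm_mul_wt_le
  refine ⟨K, hK, fun u u' => ?_⟩
  have e : (fun x => ‖u.toFun x - u'.toFun x‖ * wt x ^ 3)
      =ᵐ[volume] fun x => ‖(u - u').toFun x‖ * wt x ^ 3 := by
    filter_upwards [toFun_sub_ae u u'] with x hx
    rw [hx]
  rw [integrable_congr e, integral_congr_ae e, dist_eq_norm]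
  exact h (u - u')

lemma aestronglyMeasurable_toFun (u : Hdot1) : AEStronglyMeasurable u.toFun :=
  (Lp.stronglyMeasurable u.1.1).aestronglyMeasurable

lemma aestronglyMeasurable_talenti :
    AEStronglyMeasurable (fun x : E3 => ((talenti x : ℝ) : ℂ)) :=
  (Complex.continuous_ofReal.comp continuous_talenti).aestronglyMeasurable

lemma transf_sub (b : E3 × ℝ × ℝ) (u v : E3 → ℂ) (x : E3) :
    transf b (fun x => u x - v x) x = transf b u x - transf b v x := by
  simp only [transf, mul_sub]

lemma transf_baseParam (u : E3 → ℂ) (x : E3) : transf baseParam u x = u x := by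
  simp [transf, baseParam]

section

variable {C : ℝ} {g : E3 → ℝ} {b : E3 × ℝ × ℝ}

lemma integrable_talenti_mul_profile (hg : ProfileBound C g) :
    Integrable fun x => (talenti x : ℂ) * g x := by
  simpa only [transf_baseParam] using integrable_transf_mul_profile aestronglyMeasurable_talenti
    integrable_norm_talenti_mul_wt hg (Metric.mem_ball_self (by norm_num : (0:ℝ) < 1 / 2))

lemma integrable_transf_sub_mul (hg : ProfileBound C g) (hb : b ∈ Metric.ball baseParam (1 / 2))
    (u : Hdot1) :
    Integrable fun x => (transf b u.toFun x - (talenti x : ℂ)) * g x := by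
  obtain ⟨_, -, h⟩ := exists_integral_norm_mul_wt_le
  simp_rw [sub_mul]
  exact (integrable_transf_mul_profile (aestronglyMeasurable_toFun u) (h u).1 hg hb).sub
    (integrable_talenti_mul_profile hg)

lemma profilePairing_eq (hg : ProfileBound C g) (hb : b ∈ Metric.ball baseParam (1 / 2))
    (u : Hdot1) :
    profilePairing g u.toFun b = (∫ x, transf b u.toFun x * g x) - ∫ x, (talenti x : ℂ) * g x := by
  obtain ⟨_, -, h⟩ := exists_integral_norm_mul_wt_le
  rw [← integral_sub (integrable_transf_mul_profile (aestronglyMeasurable_toFun u) (h u).1 hg hb)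
    (integrable_talenti_mul_profile hg)]
  simp_rw [profilePairing, sub_mul]

end

lemma exists_integral_norm_sub_talenti_mul_wt_le : ∃ K, 0 < K ∧ ∀ u : Hdot1,
    (Integrable fun x => ‖u.toFun x - (talenti x : ℂ)‖ * wt x ^ 3) ∧
      ∫ x, ‖u.toFun x - (talenti x : ℂ)‖ * wt x ^ 3 ≤ K * dist u talentiH := by
  obtain ⟨K, hK, h⟩ := exists_integral_norm_sub_mul_wt_le
  refine ⟨K, hK, fun u => ?_⟩
  have e : (fun x => ‖u.toFun x - (talenti x : ℂ)‖ * wt x ^ 3)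
      =ᵐ[volume] fun x => ‖u.toFun x - talentiH.toFun x‖ * wt x ^ 3 := by
    filter_upwards [toFun_talentiH_ae] with x hx
    rw [hx]
  rw [integrable_congr e, integral_congr_ae e]
  exact h u talentiH

/-- The pairings are Lipschitz in the function and close to their linearization in the
parameter, uniformly over the profiles. -/
theorem exists_profilePairing_bounds : ∃ K, 0 < K ∧
    (∀ (C : ℝ) (g : E3 → ℝ), ProfileBound C g → ∀ b ∈ Metric.ball baseParam (1 / 2),
      ∀ u u' : Hdot1, ‖profilePairing g u.toFun b - profilePairing g u'.toFun b‖
        ≤ K * C * dist u u') ∧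
    (∀ (C : ℝ) (g : E3 → ℝ), ProfileBound C g → ∀ u : Hdot1,
      ‖profilePairing g u.toFun baseParam‖ ≤ K * C * dist u talentiH) ∧
    ∀ ε, 0 < ε → ∃ r, 0 < r ∧ r < 1 / 2 ∧ ∀ (C : ℝ) (g : E3 → ℝ), ProfileBound C g →
      ∀ u : Hdot1, ∀ b ∈ Metric.ball baseParam r, ∀ b' ∈ Metric.ball baseParam r,
        ‖profilePairing g u.toFun b - profilePairing g u.toFun b'
          - ∫ x, (g x : ℂ) * orbitDeriv baseParam x (b - b')‖
          ≤ (ε + K * dist u talentiH) * C * ‖b - b'‖ := by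
  obtain ⟨K₁, hK₁, h₁⟩ := exists_integral_norm_mul_wt_le
  obtain ⟨K₂, hK₂, h₂⟩ := exists_integral_norm_sub_mul_wt_le
  obtain ⟨K₃, hK₃, h₃⟩ := exists_integral_norm_sub_talenti_mul_wt_le
  have hbase : baseParam ∈ Metric.ball baseParam (1 / 2) := Metric.mem_ball_self (by norm_num)
  refine ⟨26000 * (K₂ + K₃), by positivity, fun C g hg b hb u u' => ?_, fun C g hg u => ?_,
    fun ε hε => ?_⟩
  · have hC := hg.nonneg
    have hd : 0 ≤ C * dist u u' := mul_nonneg hC dist_nonneg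
    have e : profilePairing g u.toFun b - profilePairing g u'.toFun b
        = ∫ x, transf b (fun x => u.toFun x - u'.toFun x) x * g x := by
      rw [profilePairing_eq hg hb, profilePairing_eq hg hb, sub_sub_sub_cancel_right,
        ← integral_sub
          (integrable_transf_mul_profile (aestronglyMeasurable_toFun u) (h₁ u).1 hg hb)
          (integrable_transf_mul_profile (aestronglyMeasurable_toFun u') (h₁ u').1 hg hb)]
      simp_rw [transf_sub, sub_mul]
    rw [e]
    calc _ ≤ 2048 * C * ∫ x, ‖u.toFun x - u'.toFun x‖ * wt x ^ 3 :=
          norm_integral_transf_mul_le ((aestronglyMeasurable_toFun u).sub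
            (aestronglyMeasurable_toFun u')) (h₂ u u').1 hg hb
      _ ≤ 2048 * C * (K₂ * dist u u') := by
          gcongr
          exact (h₂ u u').2
      _ ≤ _ := by nlinarith [mul_nonneg hK₂.le hd, mul_nonneg hK₃.le hd]
  · have hC := hg.nonneg
    have hd : 0 ≤ C * dist u talentiH := mul_nonneg hC dist_nonneg
    have e : profilePairing g u.toFun baseParam
        = ∫ x, transf baseParam (fun x => u.toFun x - (talenti x : ℂ)) x * g x := by
      simp only [profilePairing, transf_baseParam]
    rw [e]
    calc _ ≤ 2048 * C * ∫ x, ‖u.toFun x - (talenti x : ℂ)‖ * wt x ^ 3 :=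
          norm_integral_transf_mul_le ((aestronglyMeasurable_toFun u).sub
            aestronglyMeasurable_talenti) (h₃ u).1 hg hbase
      _ ≤ 2048 * C * (K₃ * dist u talentiH) := by
          gcongr
          exact (h₃ u).2
      _ ≤ _ := by nlinarith [mul_nonneg hK₂.le hd, mul_nonneg hK₃.le hd]
  · obtain ⟨r, hr0, hr1, hr⟩ := exists_orbit_linearization hε
    refine ⟨r, hr0, hr1, fun C g hg u b hb b' hb' => ?_⟩
    have hC := hg.nonneg
    have hsub := Metric.ball_subset_ball (x := baseParam) hr1.le
    have hd : 0 ≤ C * dist u talentiH * ‖b - b'‖ :=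
      mul_nonneg (mul_nonneg hC dist_nonneg) (norm_nonneg _)
    have hv : AEStronglyMeasurable fun x => u.toFun x - (talenti x : ℂ) :=
      (aestronglyMeasurable_toFun u).sub aestronglyMeasurable_talenti
    -- The bubble part is differentiable in the parameter; the remainder `u - W` is only Lipschitz
    -- in it, with a constant proportional to the distance to `W`.
    have split : ∀ c ∈ Metric.ball baseParam (1 / 2), ∫ x, transf c u.toFun x * g x
        = (∫ x, transf c (fun x => (talenti x : ℂ)) x * g x)
          + ∫ x, transf c (fun x => u.toFun x - (talenti x : ℂ)) x * g x := fun c hc => by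
      rw [← integral_add (integrable_transf_mul_profile aestronglyMeasurable_talenti
        integrable_norm_talenti_mul_wt hg hc) (integrable_transf_mul_profile hv
          (h₃ u).1 hg hc)]
      simp_rw [transf_sub, ← add_mul, add_sub_cancel]
    rw [profilePairing_eq hg (hsub hb), profilePairing_eq hg (hsub hb'), sub_sub_sub_cancel_right,
      split b (hsub hb), split b' (hsub hb')]
    have m1 := hr C g hg b hb b' hb'
    have m2 := norm_integral_transf_mul_sub_le hv (h₃ u).1 hg (hsub hb) (hsub hb')
    have m3 : 26000 * C * (∫ x, ‖u.toFun x - (talenti x : ℂ)‖ * wt x ^ 3) * ‖b - b'‖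
        ≤ 26000 * C * (K₃ * dist u talentiH) * ‖b - b'‖ := by
      gcongr
      exact (h₃ u).2
    have m4 : 0 ≤ K₂ * (C * dist u talentiH * ‖b - b'‖) := mul_nonneg hK₂.le hd
    calc _ = ‖((∫ x, transf b (fun x => (talenti x : ℂ)) x * g x)
          - (∫ x, transf b' (fun x => (talenti x : ℂ)) x * g x)
          - ∫ x, (g x : ℂ) * orbitDeriv baseParam x (b - b'))
          + ((∫ x, transf b (fun x => u.toFun x - (talenti x : ℂ)) x * g x)
            - ∫ x, transf b' (fun x => u.toFun x - (talenti x : ℂ)) x * g x)‖ := by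
          congr 1
          ring
      _ ≤ ε * C * ‖b - b'‖ + 26000 * C * (K₃ * dist u talentiH) * ‖b - b'‖ :=
          (norm_add_le _ _).trans (add_le_add m1 (m2.trans m3))
      _ ≤ _ := by nlinarith

/-! ### Normalization of the five pairings -/

/-- The five test profiles: three for translations, one for scaling, one for the phase. -/
def profileFamily (a : ℝ) : Fin 3 ⊕ Bool → E3 → ℝ
  | .inl j => translProfile a j
  | .inr false => scaleProfile a
  | .inr true => phaseProfile a

/-- The five pairings, divided by the diagonal entries of their linearization. -/
def normalizePairings (a : ℝ) (z : Fin 3 ⊕ Bool → ℂ) : E3 × ℝ × ℝ :=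
  (WithLp.toLp 2 fun j => (z (.inl j)).re / ∫ x, partialD j talenti x * translProfile a j x,
    -(z (.inr false)).re / (2 * ∫ x, lam talenti x * scaleProfile a x),
    (z (.inr true)).im / ∫ x, talenti x * phaseProfile a x)

lemma normalizePairings_sub (a : ℝ) (z z' : Fin 3 ⊕ Bool → ℂ) :
    normalizePairings a (z - z') = normalizePairings a z - normalizePairings a z' := by
  refine Prod.ext ?_ (Prod.ext ?_ ?_)
  · ext j
    simp [normalizePairings, sub_div]
  · simp [normalizePairings]
    ring
  · simp [normalizePairings, sub_div]

section

variable {a c : ℝ}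

lemma norm_normalizePairings_le (hc : 0 < c)
    (h₁ : ∀ j, c ≤ ∫ x, partialD j talenti x * translProfile a j x)
    (h₂ : c ≤ ∫ x, lam talenti x * scaleProfile a x)
    (h₃ : c ≤ ∫ x, talenti x * phaseProfile a x) {z : Fin 3 ⊕ Bool → ℂ} {η : ℝ}
    (hz : ∀ i, ‖z i‖ ≤ η) : ‖normalizePairings a z‖ ≤ 3 * (η / c) := by
  have hη : 0 ≤ η := (norm_nonneg _).trans (hz (.inr true))
  have key : ∀ {s A : ℝ}, |s| ≤ η → c ≤ A → |s / A| ≤ η / c := fun {s A} hs hA => by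
    rw [abs_div, abs_of_pos (hc.trans_le hA)]
    gcongr
  have hq : 0 ≤ η / c := by positivity
  rw [Prod.norm_def, Prod.norm_def]
  refine max_le ?_ (max_le ?_ ?_)
  · rw [← abs_of_nonneg (by positivity : 0 ≤ 3 * (η / c)), ← abs_of_nonneg (norm_nonneg _),
      ← sq_le_sq, EuclideanSpace.norm_sq_eq, Fin.sum_univ_three]
    -- The translation block carries the Euclidean norm, so its three components cost `√3`, rounded
    -- up to `3`.
    have hj : ∀ j, ‖(normalizePairings a z).1 j‖ ^ 2 ≤ (η / c) ^ 2 := fun j =>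
      pow_le_pow_left₀ (norm_nonneg _) (key ((Complex.abs_re_le_norm _).trans (hz _)) (h₁ j)) 2
    nlinarith [hj 0, hj 1, hj 2]
  · refine (key (A := 2 * ∫ x, lam talenti x * scaleProfile a x) ?_ (by linarith)).trans
      (by linarith)
    rw [abs_neg]
    exact (Complex.abs_re_le_norm _).trans (hz _)
  · exact (key ((Complex.abs_im_le_norm _).trans (hz _)) h₃).trans (by linarith)

lemma normalizePairings_eq_zero_iff (hc : 0 < c)
    (h₁ : ∀ j, c ≤ ∫ x, partialD j talenti x * translProfile a j x)
    (h₂ : c ≤ ∫ x, lam talenti x * scaleProfile a x)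
    (h₃ : c ≤ ∫ x, talenti x * phaseProfile a x) {z : Fin 3 ⊕ Bool → ℂ} :
    normalizePairings a z = 0 ↔
      (∀ j, (z (.inl j)).re = 0) ∧ (z (.inr false)).re = 0 ∧ (z (.inr true)).im = 0 := by
  have n₁ := fun j => (hc.trans_le (h₁ j)).ne'
  have n₂ := (hc.trans_le h₂).ne'
  have n₃ := (hc.trans_le h₃).ne'
  rw [Prod.ext_iff, Prod.ext_iff, PiLp.ext_iff]
  simp [normalizePairings, n₁, n₂, n₃]

end

lemma integral_profile_mul_orbitDeriv {C : ℝ} {g : E3 → ℝ} (hg : ProfileBound C g)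
    (c : E3 × ℝ × ℝ) :
    ∫ x, (g x : ℂ) * orbitDeriv baseParam x c =
      ((∑ j, c.1 j * (∫ x, partialD j talenti x * g x)
          - 2 * c.2.1 * ∫ x, lam talenti x * g x : ℝ) : ℂ)
        + Complex.I * ((c.2.2 * ∫ x, talenti x * g x : ℝ) : ℂ) := by
  have hint : ∀ f : E3 → ℝ, Continuous f → (∀ x, |f x| ≤ 2) → Integrable fun x => f x * g x :=
    fun f hf hf2 => by
      refine integrable_of_le_wt (n := 4) (C := 2 * C) le_rfl
        (hf.mul hg.continuous).aestronglyMeasurable fun x => ?_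
      rw [norm_mul, Real.norm_eq_abs, Real.norm_eq_abs]
      have := mul_le_mul (hf2 x) (hg.abs_le x) (abs_nonneg _) (by norm_num)
      linarith
  have i₁ : ∀ j, Integrable fun x => partialD j talenti x * g x := fun j =>
    hint _ (continuous_partialD_talenti j) fun x => by
      have t0 := talenti_pos x
      have t1 := talenti_le_one x
      rw [partialD_talenti', abs_mul, abs_mul, abs_neg, abs_of_pos (by norm_num : (0:ℝ) < 1 / 3),
        abs_of_pos (by positivity : 0 < talenti x ^ 3)]
      calc 1 / 3 * talenti x ^ 3 * |x j| ≤ 1 / 3 * talenti x ^ 3 * ‖x‖ := by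
            gcongr
            exact abs_coord_le x j
        _ = 1 / 3 * talenti x ^ 2 * (talenti x * ‖x‖) := by ring
        _ ≤ 1 / 3 * 1 ^ 2 * 2 := by
            gcongr
            exact talenti_mul_norm_le x
        _ ≤ 2 := by norm_num
  have i₂ : Integrable fun x => lam talenti x * g x := by
    refine hint _ ?_ fun x => ?_
    · simp_rw [funext lam_talenti]
      have := continuous_talenti
      fun_prop
    · have t0 := talenti_pos x
      have t1 := talenti_le_one x
      have t3 : talenti x ^ 3 ≤ 1 := pow_le_one₀ t0.le t1
      have t4 : 0 < talenti x ^ 3 := by positivity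
      rw [lam_talenti, abs_le]
      constructor <;> linarith
  have i₃ : Integrable fun x => talenti x * g x := hint _ continuous_talenti fun x => by
    rw [abs_of_pos (talenti_pos x)]
    linarith [talenti_le_one x]
  have j₁ : Integrable fun x => ∑ j, c.1 j * (partialD j talenti x * g x) :=
    integrable_finsetSum _ fun j _ => (i₁ j).const_mul _
  have e : ∀ x, (g x : ℂ) * orbitDeriv baseParam x c
      = ((∑ j, c.1 j * (partialD j talenti x * g x)
          - 2 * c.2.1 * (lam talenti x * g x) : ℝ) : ℂ)
        + Complex.I * ((c.2.2 * (talenti x * g x) : ℝ) : ℂ) := fun x => by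
    rw [orbitDeriv_baseParam]
    simp only [← mul_assoc, ← Finset.sum_mul]
    push_cast
    ring
  simp_rw [e]
  rw [integral_add (j₁.sub (i₂.const_mul _)).ofReal ((i₃.const_mul _).ofReal.const_mul _),
    integral_const_mul, integral_complex_ofReal, integral_complex_ofReal,
    integral_sub j₁ (i₂.const_mul _), integral_finsetSum _ fun j _ => (i₁ j).const_mul _,
    integral_const_mul, integral_const_mul]
  simp_rw [integral_const_mul]

/-- The matrix of the linearization is diagonal: parity removes the real cross terms, and taking
real or imaginary parts separates the phase. Dividing by the diagonal, and by `-2` for the scale,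
leaves exactly the identity. -/
lemma normalizePairings_linearization {a c C : ℝ} (ha : 0 < a) (hc : 0 < c)
    (h₁ : ∀ j, c ≤ ∫ x, partialD j talenti x * translProfile a j x)
    (h₂ : c ≤ ∫ x, lam talenti x * scaleProfile a x)
    (h₃ : c ≤ ∫ x, talenti x * phaseProfile a x) (hg : ∀ i, ProfileBound C (profileFamily a i))
    (d : E3 × ℝ × ℝ) :
    normalizePairings a (fun i => ∫ x, (profileFamily a i x : ℂ) * orbitDeriv baseParam x d)
      = d := by
  have n₁ := fun j => (hc.trans_le (h₁ j)).ne'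
  have n₂ := (hc.trans_le h₂).ne'
  have n₃ := (hc.trans_le h₃).ne'
  simp_rw [integral_profile_mul_orbitDeriv (hg _)]
  refine Prod.ext ?_ (Prod.ext ?_ ?_)
  · ext j
    have hs : ∑ i, d.1 i * ∫ x, partialD i talenti x * translProfile a j x
        = d.1 j * ∫ x, partialD j talenti x * translProfile a j x := by
      refine Finset.sum_eq_single_of_mem j (Finset.mem_univ j) fun i _ hij => ?_
      rw [integral_partialD_mul_translProfile_of_ne ha.le hij, mul_zero]
    simp only [normalizePairings, profileFamily, hs, integral_lam_mul_translProfile ha.le,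
      Complex.add_re, Complex.ofReal_re, Complex.re_mul_ofReal, Complex.I_re]
    field_simp [n₁ j]
    simp
  · simp only [normalizePairings, profileFamily, integral_partialD_mul_scaleProfile ha.le,
      Complex.add_re, Complex.ofReal_re, Complex.re_mul_ofReal, Complex.I_re, mul_zero,
      Finset.sum_const_zero]
    field_simp
    simp
  · simp only [normalizePairings, profileFamily, Complex.add_im, Complex.ofReal_im,
      Complex.im_mul_ofReal, Complex.I_im]
    field_simp
    simp

/-! ### Orthogonality conditions in terms of the profiles -/

/-- Here the scalars that degenerate as `α → 0` disappear from the problem: only their being nonzero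
matters. -/
lemma pairsToZero_real_iff {f : E3 → ℂ} {g : E3 → ℝ} {κ : ℝ} (hκ : κ ≠ 0)
    (hf : Integrable fun x => f x * g x) :
    PairsToZero f (fun x => ((κ * g x : ℝ) : ℂ)) ↔ (∫ x, f x * g x).re = 0 := by
  have e : (fun x => f x * conj ((κ * g x : ℝ) : ℂ)) = fun x => (κ : ℂ) * (f x * g x) := by
    funext x
    rw [Complex.conj_ofReal]
    push_cast
    ring
  rw [PairsToZero, e, integral_const_mul, Complex.re_ofReal_mul]
  simp [hκ, hf.const_mul]

/-- The factor `-i` produced by the adjoint operator on purely imaginary inputs becomes `i` under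
conjugation, so the real part of the pairing reads off the imaginary part. -/
lemma pairsToZero_imag_iff {f : E3 → ℂ} {g : E3 → ℝ} {κ : ℝ} (hκ : κ ≠ 0)
    (hf : Integrable fun x => f x * g x) :
    PairsToZero f (fun x => -Complex.I * ((κ * g x : ℝ) : ℂ)) ↔ (∫ x, f x * g x).im = 0 := by
  have e : (fun x => f x * conj (-Complex.I * ((κ * g x : ℝ) : ℂ)))
      = fun x => (Complex.I * κ : ℂ) * (f x * g x) := by
    funext x
    simp
    ring
  rw [PairsToZero, e, integral_const_mul, mul_assoc, Complex.I_mul_re, Complex.im_ofReal_mul]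
  simp [hκ, hf.const_mul]

/-- The five orthogonality conditions say that the normalized pairings vanish. -/
lemma orthogonality_iff {α c C : ℝ} (hα : 0 < α) (hc : 0 < c)
    (h₁ : ∀ j, c ≤ ∫ x, partialD j talenti x * translProfile (√α) j x)
    (h₂ : c ≤ ∫ x, lam talenti x * scaleProfile (√α) x)
    (h₃ : c ≤ ∫ x, talenti x * phaseProfile (√α) x)
    (hg : ∀ i, ProfileBound C (profileFamily (√α) i)) {b : E3 × ℝ × ℝ}
    (hb : b ∈ Metric.ball baseParam (1 / 2)) (u : Hdot1) :
    ((∀ j : Fin 3, PairsToZero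
        (fun x => transf b u.toFun x - (talenti x : ℂ))
        (Gstar α fun x => ((Vplus x * partialD j talenti x : ℝ) : ℂ))) ∧
      PairsToZero
        (fun x => transf b u.toFun x - (talenti x : ℂ))
        (Gstar α fun x => ((Vplus x * lam talenti x : ℝ) : ℂ)) ∧
      PairsToZero
        (fun x => transf b u.toFun x - (talenti x : ℂ))
        (Gstar α fun x => Complex.I * ((Vminus x * talenti x : ℝ) : ℂ))) ↔
      normalizePairings (√α) (fun i => profilePairing (profileFamily (√α) i) u.toFun b) = 0 := by
  have hs : 0 < √α := Real.sqrt_pos.2 hα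
  have k₁ : -(α / (4 * Real.pi)) ≠ 0 := by
    have := Real.pi_pos
    exact neg_ne_zero.2 (by positivity)
  have k₂ : -(√α / (4 * Real.pi)) ≠ 0 := by
    have := Real.pi_pos
    exact neg_ne_zero.2 (by positivity)
  have hi := fun i => integrable_transf_sub_mul (hg i) hb u
  rw [normalizePairings_eq_zero_iff hc h₁ h₂ h₃]
  refine and_congr (forall_congr' fun j => ?_) (and_congr ?_ ?_)
  · rw [funext (Gstar_transl hα j)]
    exact pairsToZero_real_iff k₁ (hi (.inl j))
  · rw [funext (Gstar_scale α)]
    exact pairsToZero_real_iff k₂ (hi (.inr false))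
  · rw [funext (Gstar_phase α)]
    exact pairsToZero_imag_iff k₂ (hi (.inr true))

lemma paramBall_subset {r : ℝ} : paramBall r ⊆ Metric.ball baseParam r := fun b hb => by
  have h := hb.2
  have h1 := norm_nonneg b.1
  have h2 := abs_nonneg (b.2.1 - 1)
  have h3 := abs_nonneg b.2.2
  rw [mem_ball_baseParam]
  refine ⟨?_, ?_, ?_⟩ <;> linarith

/-- The product metric is a maximum while the parameter ball uses a sum, so radius `r/4` gives at
most `3r/4 < r`. The angle lies in `[-π, π)` because `r` is small. -/
lemma closedBall_subset_paramBall {r : ℝ} (hr : 0 < r) (hr' : r < 1 / 2) :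
    Metric.closedBall baseParam (r / 4) ⊆ paramBall r := fun b hb => by
  rw [mem_closedBall_iff_norm] at hb
  obtain ⟨h1, h2, h3⟩ := norm_components_le (b - baseParam)
  simp only [baseParam, Prod.fst_sub, Prod.snd_sub, sub_zero] at h1 h2 h3 hb
  have h4 := abs_le.1 (h3.trans hb)
  have := Real.pi_gt_three
  exact ⟨⟨by linarith, by linarith⟩, by linarith⟩

end

/-! ### Uniform choice of the radii and conclusion -/

theorem theorem2p3 :
    ∃ (δ r : ℝ) (hδ : 0 < δ), δ < 1 ∧ 0 < r ∧ r < 1 / 2 ∧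
      ∀ α : ℝ, 0 < α → α < 1 →
        ∃! b : C(Metric.closedBall talentiH δ, paramBall r),
          (b ⟨talentiH, Metric.mem_closedBall_self hδ.le⟩ : E3 × ℝ × ℝ) = (0, 1, 0) ∧
          ∀ u : Metric.closedBall talentiH δ,
            (∀ j : Fin 3, PairsToZero
              (fun x => transf (b u) u.1.toFun x - (talenti x : ℂ))
              (Gstar α fun x => ((Vplus x * partialD j talenti x : ℝ) : ℂ))) ∧
            PairsToZero
              (fun x => transf (b u) u.1.toFun x - (talenti x : ℂ))
              (Gstar α fun x => ((Vplus x * lam talenti x : ℝ) : ℂ)) ∧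
            PairsToZero
              (fun x => transf (b u) u.1.toFun x - (talenti x : ℂ))
              (Gstar α fun x => Complex.I * ((Vminus x * talenti x : ℝ) : ℂ)) := by
  obtain ⟨C, hC, hprof⟩ := exists_profileBound
  obtain ⟨c, hc, hdiag⟩ := exists_le_diagonal
  obtain ⟨K, hK, hKu, hKW, hlin⟩ := exists_profilePairing_bounds
  -- The linearization error and the perturbation by `u - W` each receive `c/(12C)`. The
  -- normalization multiplies their sum by `3C/c`, giving exactly the `1/2` required. All constants
  -- are fixed before `α`.
  obtain ⟨r, hr0, hr1, hr⟩ := hlin (c / (12 * C)) (by positivity)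
  -- The second entry controls the Lipschitz perturbation; the third makes `3KCδ/c ≤ r/8`, the
  -- admissible size at the neutral parameter.
  set δ := min (1 / 2) (min (c / (12 * C) / K) (r * c / (24 * K * C))) with hδdef
  have hδ : 0 < δ := by positivity
  have hδ1 : K * δ ≤ c / (12 * C) := by
    rw [mul_comm, ← le_div_iff₀ hK]
    exact (min_le_right _ _).trans (min_le_left _ _)
  have hδ2 : δ * (24 * K * C) ≤ r * c := by
    rw [← le_div_iff₀ (by positivity)]
    exact (min_le_right _ _).trans (min_le_right _ _)
  refine ⟨δ, r, hδ, (min_le_left _ _).trans_lt (by norm_num), hr0, hr1, fun α hα hα1 => ?_⟩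
  have ha : 0 < √α := Real.sqrt_pos.2 hα
  have ha1 : √α ≤ 1 := Real.sqrt_le_one.2 hα1.le
  obtain ⟨d₁, d₂, d₃⟩ := hdiag _ ha ha1
  have hg : ∀ i, ProfileBound C (profileFamily (√α) i) := by
    obtain ⟨p₁, p₂, p₃⟩ := hprof _ ha ha1
    rintro (j | _ | _)
    exacts [p₁ j, p₂, p₃]
  have hsub : Metric.ball baseParam r ⊆ Metric.ball baseParam (1 / 2) :=
    Metric.ball_subset_ball hr1.le
  let N : Metric.closedBall talentiH δ → E3 × ℝ × ℝ → E3 × ℝ × ℝ := fun u b =>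
    normalizePairings (√α) fun i => profilePairing (profileFamily (√α) i) u.1.toFun b
  have hN0 : ∀ u : Metric.closedBall talentiH δ,
      ‖N u baseParam‖ ≤ 3 * (K * C * dist u.1 talentiH / c) := fun u =>
    norm_normalizePairings_le hc d₁ d₂ d₃ fun i => hKW C _ (hg i) u.1
  obtain ⟨β, hβc, hβ, hβu⟩ := exists_continuous_zero (N := N) (p := baseParam)
    (K := 3 * (K * C / c)) hr0
    (fun u b hb b' hb' => by
      have e : N u b - N u b' - (b - b') = normalizePairings (√α) fun i =>
          profilePairing (profileFamily (√α) i) u.1.toFun b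
            - profilePairing (profileFamily (√α) i) u.1.toFun b'
            - ∫ x, (profileFamily (√α) i x : ℂ) * orbitDeriv baseParam x (b - b') := by
        conv_lhs => rw [← normalizePairings_linearization ha hc d₁ d₂ d₃ hg (b - b')]
        rw [← normalizePairings_sub, ← normalizePairings_sub]
        rfl
      rw [e]
      refine (norm_normalizePairings_le hc d₁ d₂ d₃
        fun i => hr C _ (hg i) u.1 b hb b' hb').trans ?_
      have hu : K * dist u.1 talentiH ≤ c / (12 * C) :=
        (mul_le_mul_of_nonneg_left (Metric.mem_closedBall.1 u.2) hK.le).trans hδ1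
      calc 3 * ((c / (12 * C) + K * dist u.1 talentiH) * C * ‖b - b'‖ / c)
          ≤ 3 * ((c / (12 * C) + c / (12 * C)) * C * ‖b - b'‖ / c) := by gcongr
        _ = 1 / 2 * ‖b - b'‖ := by
            field_simp
            ring)
    (fun u => by
      refine (hN0 u).trans ?_
      calc 3 * (K * C * dist u.1 talentiH / c) ≤ 3 * (K * C * δ / c) := by
            gcongr
            exact Metric.mem_closedBall.1 u.2
        _ ≤ r / 8 := by
            rw [← mul_div_assoc, div_le_iff₀ hc]
            linarith)
    (fun u u' b hb => by
      have e : N u b - N u' b = normalizePairings (√α) fun i =>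
          profilePairing (profileFamily (√α) i) u.1.toFun b
            - profilePairing (profileFamily (√α) i) u'.1.toFun b := by
        rw [← normalizePairings_sub]
        rfl
      rw [e]
      refine (norm_normalizePairings_le hc d₁ d₂ d₃
        fun i => hKu C _ (hg i) b (hsub hb) u.1 u'.1).trans (le_of_eq ?_)
      rw [Subtype.dist_eq]
      ring)
  have horth : ∀ (u : Metric.closedBall talentiH δ) (b : paramBall r), _ ↔ N u b = 0 :=
    fun u b => orthogonality_iff hα hc d₁ d₂ d₃ hg (hsub (paramBall_subset b.2)) u.1
  refine ⟨⟨fun u => ⟨β u, closedBall_subset_paramBall hr0 hr1 (hβ u).1⟩,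
    hβc.subtype_mk _⟩, ⟨?_, fun u => (horth u _).2 (hβ u).2⟩, fun b hb => ?_⟩
  -- For `u = W` the neutral parameter is a zero, hence the zero.
  · refine (hβu _ baseParam (Metric.mem_ball_self hr0) ?_).symm
    have := hN0 ⟨talentiH, Metric.mem_closedBall_self hδ.le⟩
    rw [dist_self, mul_zero, zero_div, mul_zero] at this
    exact norm_le_zero_iff.1 this
  · ext1 u
    -- Uniqueness is pointwise: each `u` has a single zero in the parameter ball.
    exact Subtype.ext (hβu u _ (paramBall_subset (b u).2) ((horth u _).1 (hb.2 u)))
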